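/- Let $\lambda>0$, $P>0$, $\eta>2$, $T>0$ and $\sigma^2\ge 0$. Consider a single-tier downlink cellular network whose base stations (BSs) form a homogeneous Poisson point process $\Phi$ of intensity $\lambda$ in $\mathbb{R}^2$, with a test user at the origin. Let $r_1\le r_2\le r_3\le\cdots$ be the ordered distances from the user to the BSs. All BSs transmit with power $P$, the path loss exponent is $\eta$ and the noise power is $\sigma^2$. The fading is Rayleigh: the complex channel coefficients $g_1,g_2,\dots$ ($g_i$ belonging to the $i$-th nearest BS) are i.i.d. $\mathcal{CN}(0,1)$ and independent of $\Phi$, so the power gains $h_i=|g_i|^2$ are i.i.d. $\exp(1)$. Define the coverage probabilities $$\mathcal C_c=\mathbb P\Big\{\frac{P h_1 r_1^{-\eta}}{\sum_{i\ge 2}P h_i r_i^{-\eta}+\sigma^2}>T\Big\}$$ of the best connected user (served by the nearest BS), $$\mathcal C_{bk}^{(1)}=\mathbb P\Big\{\frac{P h_2 r_2^{-\eta}}{P h_1 r_1^{-\eta}+\sum_{i\ge 3}P h_i r_i^{-\eta}+\sigma^2}>T\Big\}$$ of the blackout user without cooperation (served by the second nearest BS), and $$\mathcal C_{bk}^{(2)}=\mathbb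 P\Big\{\frac{\big|\sqrt P g_2 r_2^{-\eta/2}+\sqrt P g_3 r_3^{-\eta/2}\big|^2}{P h_1 r_1^{-\eta}+\sum_{i\ge 4}P h_i r_i^{-\eta}+\sigma^2}>T\Big\}$$ of the blackout user served non-coherently by the second and third nearest BSs. Let ${}_2F_1$ be the Gauss hypergeometric function (analytically continued to $(-\infty,1)$) and put $s=s(r_2,r_3)=\dfrac{T}{P(r_2^{-\eta}+r_3^{-\eta})}$. Then the following integrals converge absolutely and $$\mathcal C_c=2\pi\lambda\int_0^\infty x\exp\Big(-\frac{T\sigma^2x^\eta}{P}-\pi\lambda x^2\Big(1+T^{2/\eta}\int_{T^{-2/\eta}}^\infty\frac{dw}{1+w^{\eta/2}}\Big)\Big)\,dx,$$ $$\mathcal C_{bk}^{(1)}=(2\pi\lambda)^2\int_0^\infty y\exp\Big(-\frac{T\sigma^2y^\eta}{P}-\pi\lambda y^2\Big(\frac{2T}{\eta-2}\,{}_2F_1\big(1,1-\tfrac2\eta;2-\tfrac2\eta;-T\big)+1\Big)\Big)\int_0^y\frac{x}{1+Ty^\eta x^{-\eta}}\,dx\,dy,$$ $$\mathcal C_{bk}^{(2)}=8(\pi\lambda)^3\int_0^\infty\int_{r_2}^\infty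 r_2r_3\exp\Big(-s\sigma^2-\pi\lambda r_3^2\Big(1+\frac{2sPr_3^{-\eta}}{\eta-2}\,{}_2F_1\big(1,1-\tfrac2\eta;2-\tfrac2\eta;-sPr_3^{-\eta}\big)\Big)\Big)\int_0^{r_2}\frac{r_1}{1+sPr_1^{-\eta}}\,dr_1\,dr_3\,dr_2.$$ If moreover $\sigma^2=0$ (interference-limited network) and $\eta=4$, then $$\mathcal C_{bk}^{(2)}=\int_0^\infty\int_{r_2}^\infty 4(\pi\lambda)^3r_2^3r_3\Big(1-\sqrt{\tfrac{Tr_3^4}{r_2^4+r_3^4}}\arctan\sqrt{\tfrac{r_2^4+r_3^4}{Tr_3^4}}\Big)\exp\Big(-\pi\lambda\Big(r_3^2+\sqrt{\tfrac{T}{r_2^{-4}+r_3^{-4}}}\arctan\sqrt{\tfrac{Tr_2^4}{r_2^4+r_3^4}}\Big)\Big)\,dr_3\,dr_2.$$ -/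

import Mathlib

open MeasureTheory ProbabilityTheory Set
open scoped ENNReal NNReal

/-- The Euclidean plane in which the base stations (BSs) live; the test user sits at the origin. -/
abbrev Plane : Type := EuclideanSpace ℝ (Fin 2)

section PointProcess

variable {Ω : Type*}

/-- The number of points of the point process `∑ᵢ δ_{X i}` that fall in `B`. -/
noncomputable def pointCount (X : ℕ → Ω → Plane) (B : Set Plane) (ω : Ω) : ℕ∞ :=
  {i : ℕ | X i ω ∈ B}.encard

/-- The random points `X 0, X 1, …` form a homogeneous Poisson point process of intensity `lam` in
the plane: the number of points in a Borel set of finite area is Poisson distributed with mean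
`lam` times the area, and the numbers of points in disjoint sets are independent. -/
structure IsHomogeneousPPP [MeasurableSpace Ω] (μ : Measure Ω) (lam : ℝ)
    (X : ℕ → Ω → Plane) : Prop where
  measurable : ∀ i, Measurable (X i)
  poisson : ∀ B : Set Plane, MeasurableSet B → volume B ≠ ∞ →
    HasLaw (pointCount X B)
      ((poissonMeasure (lam * volume.real B).toNNReal).map (Nat.cast : ℕ → ℕ∞)) μ
  indep : ∀ (n : ℕ) (B : Fin n → Set Plane), (∀ j, MeasurableSet (B j)) →
    (∀ j, volume (B j) ≠ ∞) → Pairwise (fun j k => Disjoint (B j) (B k)) →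
    iIndepFun (fun j => pointCount X (B j)) μ

/-- The circularly symmetric complex Gaussian law `CN(0,1)`: real and imaginary parts are
independent, centred, of variance `1/2`. -/
noncomputable def stdComplexGaussian : Measure ℂ :=
  ((gaussianReal 0 (1 / 2)).prod (gaussianReal 0 (1 / 2))).map
    Complex.measurableEquivRealProd.symm

/-- Rayleigh fading: the complex channel coefficients `g 0, g 1, …` of the BSs are i.i.d. `CN(0,1)`
(so that the power gains `‖g i‖²` are i.i.d. exponential of mean one), and they are independent of
the positions of the BSs. -/
structure IsRayleighFading [MeasurableSpace Ω] (μ : Measure Ω) (X : ℕ → Ω → Plane)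
    (g : ℕ → Ω → ℂ) : Prop where
  law : ∀ i, HasLaw (g i) stdComplexGaussian μ
  iIndep : iIndepFun g μ
  indep_positions : IndepFun (fun ω i => g i ω) (fun ω i => X i ω) μ

end PointProcess

section SINR

variable {Ω : Type*}

/-- The power that the user at the origin receives from the `i`-th BS: transmit power `P`, power
gain `‖g i‖²`, path loss exponent `η`. -/
noncomputable def rxPower (P η : ℝ) (X : ℕ → Ω → Plane) (g : ℕ → Ω → ℂ) (i : ℕ) (ω : Ω) : ℝ≥0∞ :=
  ENNReal.ofReal (P * ‖g i ω‖ ^ 2 * ‖X i ω‖ ^ (-η))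

/-- The aggregate interference of all the BSs except the first `k` ones. -/
noncomputable def interferenceFrom (k : ℕ) (P η : ℝ) (X : ℕ → Ω → Plane) (g : ℕ → Ω → ℂ)
    (ω : Ω) : ℝ≥0∞ :=
  ∑' i : ℕ, rxPower P η X g (k + i) ω

/-- SINR of the best connected user, served by the nearest BS (number `0`), when the BSs are
numbered by increasing distance. -/
noncomputable def sinrBestConnected (P η σ : ℝ) (X : ℕ → Ω → Plane) (g : ℕ → Ω → ℂ)
    (ω : Ω) : ℝ≥0∞ :=
  rxPower P η X g 0 ω / (interferenceFrom 1 P η X g ω + ENNReal.ofReal (σ ^ 2))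

/-- SINR of the blackout user without cooperation: served by the second nearest BS, while the
nearest BS and all the BSs from the third nearest on interfere. -/
noncomputable def sinrBlackout (P η σ : ℝ) (X : ℕ → Ω → Plane) (g : ℕ → Ω → ℂ) (ω : Ω) : ℝ≥0∞ :=
  rxPower P η X g 1 ω /
    (rxPower P η X g 0 ω + interferenceFrom 2 P η X g ω + ENNReal.ofReal (σ ^ 2))

/-- SINR of the blackout user with cooperation: the second and third nearest BSs transmit
non-coherently, so that their complex amplitudes add up, while the nearest BS and all the BSs from
the fourth nearest on interfere. -/
noncomputable def sinrBlackoutCoop (P η σ : ℝ) (X : ℕ → Ω → Plane) (g : ℕ → Ω → ℂ)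
    (ω : Ω) : ℝ≥0∞ :=
  ENNReal.ofReal
      (‖((√P * ‖X 1 ω‖ ^ (-η / 2) : ℝ) : ℂ) * g 1 ω
        + ((√P * ‖X 2 ω‖ ^ (-η / 2) : ℝ) : ℂ) * g 2 ω‖ ^ 2) /
    (rxPower P η X g 0 ω + interferenceFrom 3 P η X g ω + ENNReal.ofReal (σ ^ 2))

/-- The coverage probability: the probability that the SINR exceeds the threshold `T`. -/
noncomputable def coverageProbability [MeasurableSpace Ω] (μ : Measure Ω) (sinr : Ω → ℝ≥0∞)
    (T : ℝ) : ℝ :=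
  μ.real {ω | ENNReal.ofReal T < sinr ω}

end SINR

section Hypergeometric

/-- The Gauss hypergeometric function `₂F₁(a, b; c; z)` for real `c > b > 0` and real `z < 1`, by
Euler's integral. This is the analytic continuation to `(-∞, 1)` of the power series
`ordinaryHypergeometric`, which only converges for `|z| < 1`, whereas the arguments needed here
range over all negative reals. -/
noncomputable def gaussHypergeometric (a b c z : ℝ) : ℝ :=
  Real.Gamma c / (Real.Gamma b * Real.Gamma (c - b)) *
    ∫ t in (0 : ℝ)..1, t ^ (b - 1) * (1 - t) ^ (c - b - 1) * (1 - z * t) ^ (-a)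

/-- Inside the unit disc Euler's integral agrees with Mathlib's hypergeometric power series, for the
parameters `(1, b; b + 1)` used below. -/
theorem gaussHypergeometric_eq_ordinaryHypergeometric {b z : ℝ} (hb : 0 < b) (hz : |z| < 1) :
    gaussHypergeometric 1 b (b + 1) z = ordinaryHypergeometric (1 : ℝ) b (b + 1) z := by
  have hcoef : ∀ n : ℕ, b * (ascPochhammer ℝ n).eval (b + 1) =
      (ascPochhammer ℝ n).eval b * (b + n) := by
    intro n
    have h1 := ascPochhammer_succ_eval n b
    have h2 : (ascPochhammer ℝ (n + 1)).eval b = b * (ascPochhammer ℝ n).eval (b + 1) := by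
      rw [ascPochhammer_succ_left]; simp [Polynomial.eval_comp]
    linarith
  have hint : ∀ n : ℕ, ∫ t in (0 : ℝ)..1, t ^ (b - 1) * (z * t) ^ n = z ^ n / (b + n) := by
    intro n
    have : ∀ t ∈ uIoc (0 : ℝ) 1, t ^ (b - 1) * (z * t) ^ n = z ^ n * t ^ (b - 1 + n) := by
      intro t ht
      rw [uIoc_of_le zero_le_one] at ht
      rw [Real.rpow_add_natCast ht.1.ne', mul_pow]; ring
    rw [intervalIntegral.integral_congr_ae (Filter.Eventually.of_forall this),
      intervalIntegral.integral_const_mul,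
      integral_rpow (Or.inl (by have : (0 : ℝ) ≤ n := n.cast_nonneg; linarith))]
    have h0 : b - 1 + (n : ℝ) + 1 = b + n := by ring
    have : b + (n : ℝ) ≠ 0 := by positivity
    rw [h0, Real.one_rpow, Real.zero_rpow this]; ring
  have hbi : IntervalIntegrable (fun t : ℝ => t ^ (b - 1)) volume 0 1 :=
    intervalIntegral.intervalIntegrable_rpow' (by linarith)
  have hsum : HasSum (fun n : ℕ => ∫ t in (0 : ℝ)..1, t ^ (b - 1) * (z * t) ^ n)
      (∫ t in (0 : ℝ)..1, t ^ (b - 1) * (1 - z * t)⁻¹) := by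
    refine intervalIntegral.hasSum_integral_of_dominated_convergence
      (fun n t => t ^ (b - 1) * |z| ^ n) (fun n => ?_) (fun n => ?_) ?_ ?_ ?_
    · exact (Measurable.aestronglyMeasurable (by fun_prop))
    · refine Filter.Eventually.of_forall fun t ht => ?_
      rw [uIoc_of_le zero_le_one] at ht
      have := Real.rpow_nonneg ht.1.le (b - 1)
      rw [norm_mul, norm_pow, norm_mul, Real.norm_eq_abs, Real.norm_eq_abs, Real.norm_eq_abs,
        abs_of_nonneg this, abs_of_pos ht.1]
      exact mul_le_mul_of_nonneg_left (pow_le_pow_left₀ (mul_nonneg (abs_nonneg z) ht.1.le)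
        (mul_le_of_le_one_right (abs_nonneg z) ht.2) n) this
    · exact Filter.Eventually.of_forall fun t _ =>
        (summable_geometric_of_lt_one (abs_nonneg z) hz).mul_left _
    · have : (fun t : ℝ => ∑' n : ℕ, t ^ (b - 1) * |z| ^ n) =
          fun t : ℝ => t ^ (b - 1) * ∑' n : ℕ, |z| ^ n := funext fun t => tsum_mul_left
      rw [this]
      exact hbi.mul_const _
    · refine Filter.Eventually.of_forall fun t ht => ?_
      rw [uIoc_of_le zero_le_one] at ht
      have hzt : ‖z * t‖ < 1 := by
        rw [norm_mul, Real.norm_eq_abs, Real.norm_eq_abs, abs_of_pos ht.1]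
        exact lt_of_le_of_lt (mul_le_of_le_one_right (abs_nonneg z) ht.2) hz
      exact HasSum.mul_left (t ^ (b - 1)) (hasSum_geometric_of_norm_lt_one hzt)
  have hG : Real.Gamma b ≠ 0 := (Real.Gamma_pos_of_pos hb).ne'
  rw [gaussHypergeometric, ordinaryHypergeometric_eq_tsum]
  have h1 : b + 1 - b = 1 := by ring
  simp only [h1, sub_self, Real.rpow_zero, mul_one, Real.Gamma_one, Real.rpow_neg_one]
  rw [Real.Gamma_add_one hb.ne', mul_div_cancel_right₀ _ hG, ← hsum.tsum_eq, ← tsum_mul_left]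
  refine tsum_congr fun n => ?_
  have hp : (ascPochhammer ℝ n).eval (b + 1) ≠ 0 := (ascPochhammer_pos n _ (by linarith)).ne'
  have hn : b + (n : ℝ) ≠ 0 := by positivity
  have hf : ((n.factorial : ℕ) : ℝ) ≠ 0 := by positivity
  rw [hint, ascPochhammer_eval_one, smul_eq_mul]
  have := hcoef n
  field_simp
  linear_combination z ^ n * this

end Hypergeometric

section Integrands

/-- Integrand of the coverage probability of the best connected user, in the distance `x` to the
nearest BS. -/
noncomputable def bestConnectedIntegrand (lam P η σ T x : ℝ) : ℝ :=
  2 * Real.pi * lam * x *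
    Real.exp (-(T * σ ^ 2 * x ^ η / P) - Real.pi * lam * x ^ 2 *
      (1 + T ^ (2 / η) * ∫ w in Ioi (T ^ (-2 / η)), 1 / (1 + w ^ (η / 2))))

/-- Integrand of the coverage probability of the blackout user without cooperation, in the distance
`y` to the second nearest BS. -/
noncomputable def blackoutIntegrand (lam P η σ T y : ℝ) : ℝ :=
  (2 * Real.pi * lam) ^ 2 * (y *
    Real.exp (-(T * y ^ η * σ ^ 2 / P) - Real.pi * lam * y ^ 2 *
      (2 * T / (η - 2) * gaussHypergeometric 1 (1 - 2 / η) (2 - 2 / η) (-T) + 1)) *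
    ∫ x in (0 : ℝ)..y, x / (1 + T * y ^ η * x ^ (-η)))

/-- `s = T / (P (r₂^{-η} + r₃^{-η}))`. -/
noncomputable def coopS (P η T r₂ r₃ : ℝ) : ℝ :=
  T / (P * (r₂ ^ (-η) + r₃ ^ (-η)))

/-- Integrand of the coverage probability of the blackout user with cooperation, in the distances
`r₂`, `r₃` to the second and third nearest BSs. -/
noncomputable def coopIntegrand (lam P η σ T r₂ r₃ : ℝ) : ℝ :=
  8 * (Real.pi * lam) ^ 3 * (r₂ * r₃ *
    Real.exp (-(coopS P η T r₂ r₃ * σ ^ 2) - Real.pi * lam * r₃ ^ 2 *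
      (1 + 2 * coopS P η T r₂ r₃ * P * r₃ ^ (-η) / (η - 2) *
        gaussHypergeometric 1 (1 - 2 / η) (2 - 2 / η) (-(coopS P η T r₂ r₃ * P * r₃ ^ (-η))))) *
    ∫ r₁ in (0 : ℝ)..r₂, r₁ / (1 + coopS P η T r₂ r₃ * P * r₁ ^ (-η)))

/-- The closed form of the integrand with cooperation for `η = 4` and no noise. -/
noncomputable def coopIntegrandFour (lam T r₂ r₃ : ℝ) : ℝ :=
  4 * (Real.pi * lam) ^ 3 * r₂ ^ 3 * r₃ *
    (1 - √(T * r₃ ^ 4 / (r₂ ^ 4 + r₃ ^ 4)) *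
      Real.arctan (√((r₂ ^ 4 + r₃ ^ 4) / (T * r₃ ^ 4)))) *
    Real.exp (-(Real.pi * lam * (r₃ ^ 2 + √(T / ((r₂ ^ 4)⁻¹ + (r₃ ^ 4)⁻¹)) *
      Real.arctan (√(T * r₂ ^ 4 / (r₂ ^ 4 + r₃ ^ 4))))))

end Integrands

/-! Given the positions, the useful power is exponentially distributed. A single gain `‖g i‖²` is
exponential of mean one, and a combination `α g₁ + β g₂` of independent CN(0,1) variables is centred
circular Gaussian of variance `α² + β²`, so cooperation only changes the mean power. Coverage given
the positions is therefore the Laplace transform E exp(-s(I + σ²)) of interference plus noise, with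
s equal to T divided by the mean power. Since the fading variables are independent, it equals
exp(-sσ²) times the product over the interferers of 1/(1 + sP rᵢ^(-η)) (`measure_mul_lt_ofReal`,
`tendsto_prod_fadingFactor`).

It remains to average over the distances. Write Λ(t) = πλt². For consecutive disjoint intervals, the
event that the j-th distance lies in the j-th interval says that the Poisson counts in these
intervals are one and the counts in the gaps are zero. Independence of the counts gives the law
dΛ(u₀)⋯dΛ(uₙ) exp(-Λ(uₙ)) on increasing tuples (`IsHomogeneousPPP.measure_firstNorms_box`,
`IsHomogeneousPPP.map_firstNorms`). Thus the distances form a Markov chain: after r, the next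
distance u has law exp(Λ(r) - Λ(u)) dΛ(u) on u > r.

The infinite product is averaged along this chain. Let φ be the factor of one interferer and J(r)
the integral of 1 - φ against dΛ beyond r. Then exp(-J) is a fixed point of the operation "multiply
by φ and average over the next distance" (`lintegral_fadingFactor_mul_exp`). So the product of the
first m factors, times exp(-J) at the last distance used, has an expectation independent of m. As m
grows the distances tend to infinity, the correction tends to one, and the expectation of the
infinite product is that of exp(-J) at the last distance held fixed
(`IsHomogeneousPPP.tendsto_lintegral_prod_fadingFactor`). `measure_coverage_eq` joins the two
halves.

The averaging takes place in `ℝ≥0∞`, with exp(-∞) = 0, so finiteness of the interference is never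
needed. Absolute convergence comes for free, because the integrands are nonnegative and their total
is a probability. The stated forms of J follow by substitution, and for η = 4 by explicit arctangent
antiderivatives. -/

/-- Mean number of points of norm at most `t`. -/
noncomputable def meanCount (lam t : ℝ) : ℝ := Real.pi * lam * (max t 0) ^ 2

/-- Intensity measure of the distances of the points to the origin. -/
noncomputable def radialIntensity (lam : ℝ) : Measure ℝ :=
  (volume.restrict (Ioi 0)).withDensity fun u => ENNReal.ofReal (2 * Real.pi * lam * u)

/-- Law of the distance to the nearest point. -/
noncomputable def nearestLaw (lam : ℝ) : Measure ℝ :=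
  (radialIntensity lam).withDensity fun u => ENNReal.ofReal (Real.exp (-meanCount lam u))

/-! ### The radial intensity and the law of the nearest distance -/

section Radial

variable {lam : ℝ}

lemma meanCount_of_nonneg {t : ℝ} (ht : 0 ≤ t) : meanCount lam t = Real.pi * lam * t ^ 2 := by
  rw [meanCount, max_eq_left ht]

lemma meanCount_of_nonpos {t : ℝ} (ht : t ≤ 0) : meanCount lam t = 0 := by
  rw [meanCount, max_eq_right ht]; simp

lemma meanCount_mono (hlam : 0 ≤ lam) : Monotone (meanCount lam) := by
  intro a b hab
  have := Real.pi_pos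
  unfold meanCount
  gcongr

lemma continuous_meanCount : Continuous (meanCount lam) := by
  unfold meanCount; fun_prop

@[fun_prop]
lemma measurable_meanCount : Measurable (meanCount lam) := continuous_meanCount.measurable

lemma lintegral_radialIntensity {f : ℝ → ℝ≥0∞} (hf : Measurable f) :
    ∫⁻ u, f u ∂radialIntensity lam
      = ∫⁻ u in Ioi 0, ENNReal.ofReal (2 * Real.pi * lam * u) * f u := by
  rw [radialIntensity, lintegral_withDensity_eq_lintegral_mul _ (by fun_prop) hf]
  rfl

lemma setLIntegral_radialIntensity {f : ℝ → ℝ≥0∞} (hf : Measurable f) {s : Set ℝ}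
    (hs : MeasurableSet s) (hsub : s ⊆ Ioi 0) :
    ∫⁻ u in s, f u ∂radialIntensity lam
      = ∫⁻ u in s, ENNReal.ofReal (2 * Real.pi * lam * u) * f u := by
  rw [← lintegral_indicator hs, lintegral_radialIntensity (hf.indicator hs),
    ← lintegral_indicator measurableSet_Ioi, ← lintegral_indicator hs]
  congr 1
  ext u
  by_cases hu : u ∈ s
  · rw [indicator_of_mem (hsub hu), indicator_of_mem hu, indicator_of_mem hu]
  · simp [indicator, hu]

lemma radialIntensity_Ioc (hlam : 0 ≤ lam) {a b : ℝ} (hab : a ≤ b) :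
    radialIntensity lam (Ioc a b) = ENNReal.ofReal (meanCount lam b - meanCount lam a) := by
  have hpi := Real.pi_pos
  rw [radialIntensity, withDensity_apply _ measurableSet_Ioc,
    Measure.restrict_restrict measurableSet_Ioc, Ioc_inter_Ioi]
  rcases le_total b 0 with hb | hb
  · rw [meanCount_of_nonpos hb, meanCount_of_nonpos (hab.trans hb)]
    rw [Ioc_eq_empty (by simp [hb])]
    simp
  · have h0 : max a 0 ≤ b := max_le hab hb
    have hval : ∫ u in Ioc (max a 0) b, 2 * Real.pi * lam * u =
        meanCount lam b - meanCount lam a := by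
      rw [← intervalIntegral.integral_of_le h0, intervalIntegral.integral_const_mul,
        integral_id, meanCount, meanCount, max_eq_left hb]
      ring
    rw [← hval, ofReal_integral_eq_lintegral_ofReal]
    · have : Continuous fun u : ℝ => 2 * Real.pi * lam * u := by fun_prop
      exact this.integrableOn_Ioc
    · refine (ae_restrict_iff' measurableSet_Ioc).2 (Filter.Eventually.of_forall fun u hu => ?_)
      have : 0 < u := (le_max_right a 0).trans_lt hu.1
      simp only [Pi.zero_apply]
      positivity

lemma radialIntensity_Iic_zero : radialIntensity lam (Iic 0) = 0 := by
  rw [radialIntensity, withDensity_apply _ measurableSet_Iic,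
    Measure.restrict_restrict measurableSet_Iic, Iic_inter_Ioi]
  simp

instance : SigmaFinite (radialIntensity lam) := by
  unfold radialIntensity
  exact SigmaFinite.withDensity_ofReal _

lemma hasDerivAt_meanCount {u : ℝ} (hu : 0 < u) :
    HasDerivAt (meanCount lam) (2 * Real.pi * lam * u) u := by
  have h : HasDerivAt (fun t : ℝ => Real.pi * lam * t ^ 2) (2 * Real.pi * lam * u) u := by
    have := (hasDerivAt_pow 2 u).const_mul (Real.pi * lam)
    exact this.congr_deriv (by push_cast; ring)
  refine h.congr_of_eventuallyEq ?_
  filter_upwards [lt_mem_nhds hu] with t ht using meanCount_of_nonneg ht.le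

lemma tendsto_exp_neg_meanCount (hlam : 0 < lam) :
    Filter.Tendsto (fun t => Real.exp (-meanCount lam t)) Filter.atTop (nhds 0) := by
  refine Real.tendsto_exp_neg_atTop_nhds_zero.comp ?_
  have hpi := Real.pi_pos
  unfold meanCount
  refine Filter.Tendsto.const_mul_atTop (by positivity) ?_
  refine (Filter.tendsto_pow_atTop two_ne_zero).comp ?_
  exact Filter.tendsto_atTop_mono (fun t => le_max_left t 0) Filter.tendsto_id

/-- A function with an integrable nonnegative derivative: the `ℝ≥0∞` form of the fundamental theorem
of calculus against the radial intensity. -/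
lemma setLIntegral_radialIntensity_of_hasDerivAt (hlam : 0 < lam) {F f : ℝ → ℝ} {a : ℝ}
    (ha : 0 ≤ a) (hfm : Measurable f) (hcont : ContinuousWithinAt F (Ici a) a)
    (hF : ∀ u ∈ Ioi a, HasDerivAt F (-(2 * Real.pi * lam * u * f u)) u)
    (hf : ∀ u ∈ Ioi a, 0 ≤ f u) (hlim : Filter.Tendsto F Filter.atTop (nhds 0)) :
    ∫⁻ u in Ioi a, ENNReal.ofReal (f u) ∂radialIntensity lam = ENNReal.ofReal (F a) := by
  have hpi := Real.pi_pos
  have hpos : ∀ u ∈ Ioi a, 0 ≤ 2 * Real.pi * lam * u * f u := by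
    intro u hu
    have h1 : 0 < u := ha.trans_lt hu
    have := hf u hu
    positivity
  have hder : ∀ u ∈ Ioi a, HasDerivAt (fun t => -F t) (2 * Real.pi * lam * u * f u) u := by
    intro u hu
    have := (hF u hu).neg
    rwa [neg_neg] at this
  have hlim' : Filter.Tendsto (fun t => -F t) Filter.atTop (nhds 0) := by simpa using hlim.neg
  have hint := integrableOn_Ioi_deriv_of_nonneg hcont.neg hder hpos hlim'
  have hval := integral_Ioi_of_hasDerivAt_of_tendsto hcont.neg hder hint hlim'
  rw [Pi.neg_apply, sub_neg_eq_add, zero_add] at hval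
  rw [setLIntegral_radialIntensity (by fun_prop) measurableSet_Ioi (Ioi_subset_Ioi ha), ← hval, ofReal_integral_eq_lintegral_ofReal
    hint ((ae_restrict_iff' measurableSet_Ioi).2 (Filter.Eventually.of_forall hpos))]
  refine setLIntegral_congr_fun measurableSet_Ioi fun u hu => ?_
  have h1 : 0 < u := ha.trans_lt hu
  exact (ENNReal.ofReal_mul (by positivity)).symm

lemma lintegral_exp_neg_meanCount_Ioi (hlam : 0 < lam) {a : ℝ} (ha : 0 ≤ a) :
    ∫⁻ u in Ioi a, ENNReal.ofReal (Real.exp (-meanCount lam u)) ∂radialIntensity lam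
      = ENNReal.ofReal (Real.exp (-meanCount lam a)) := by
  refine setLIntegral_radialIntensity_of_hasDerivAt hlam ha (by fun_prop)
    (Continuous.continuousWithinAt (by have := @continuous_meanCount lam; fun_prop))
    (fun u hu => ?_) (fun u _ => (Real.exp_pos _).le) (tendsto_exp_neg_meanCount hlam)
  have := (hasDerivAt_meanCount (lam := lam) (ha.trans_lt hu)).fun_neg.exp
  convert this using 1
  ring

lemma lintegral_nearestLaw {f : ℝ → ℝ≥0∞} (hf : Measurable f) :
    ∫⁻ u, f u ∂nearestLaw lam
      = ∫⁻ u, ENNReal.ofReal (Real.exp (-meanCount lam u)) * f u ∂radialIntensity lam := by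
  rw [nearestLaw, lintegral_withDensity_eq_lintegral_mul _ (by fun_prop) hf]
  rfl

lemma nearestLaw_Ioi (hlam : 0 < lam) {a : ℝ} (ha : 0 ≤ a) :
    nearestLaw lam (Ioi a) = ENNReal.ofReal (Real.exp (-meanCount lam a)) := by
  rw [nearestLaw, withDensity_apply _ measurableSet_Ioi, lintegral_exp_neg_meanCount_Ioi hlam ha]

lemma nearestLaw_Iic_zero : nearestLaw lam (Iic 0) = 0 :=
  withDensity_absolutelyContinuous _ _ radialIntensity_Iic_zero

lemma nearestLaw_univ (hlam : 0 < lam) : nearestLaw lam univ = 1 := by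
  rw [← Iic_union_Ioi (a := (0 : ℝ)), measure_union (Iic_disjoint_Ioi le_rfl) measurableSet_Ioi,
    nearestLaw_Iic_zero, nearestLaw_Ioi hlam le_rfl, meanCount_of_nonpos le_rfl]
  simp

instance : SigmaFinite (nearestLaw lam) := by
  unfold nearestLaw
  exact SigmaFinite.withDensity_ofReal _

lemma nearestLaw_Ioc (hlam : 0 < lam) {a b : ℝ} (ha : 0 ≤ a) (hab : a ≤ b) :
    nearestLaw lam (Ioc a b) = ENNReal.ofReal (Real.exp (-meanCount lam a))
      - ENNReal.ofReal (Real.exp (-meanCount lam b)) := by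
  rw [← nearestLaw_Ioi hlam ha, ← nearestLaw_Ioi hlam (ha.trans hab),
    ← measure_sdiff (Ioi_subset_Ioi hab) measurableSet_Ioi.nullMeasurableSet
      (by rw [nearestLaw_Ioi hlam (ha.trans hab)]; exact ENNReal.ofReal_ne_top)]
  congr 1
  ext u
  simp

end Radial

/-! ### Areas of discs and annuli -/

section Annulus

lemma volume_norm_preimage_Iic (b : ℝ) :
    volume {x : Plane | ‖x‖ ≤ b} = ENNReal.ofReal (Real.pi * (max b 0) ^ 2) := by
  have : {x : Plane | ‖x‖ ≤ b} = Metric.closedBall 0 b := by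
    ext x; simp
  rw [this, EuclideanSpace.volume_closedBall_fin_two, show ENNReal.ofReal b = ENNReal.ofReal (max b 0) by
    rcases le_total b 0 with h | h <;> simp [h, ENNReal.ofReal_of_nonpos], mul_comm,
    ENNReal.ofReal_mul Real.pi_pos.le, ENNReal.ofReal_pow (le_max_right _ _)]

lemma volume_annulus_ne_top (a b : ℝ) : volume {x : Plane | ‖x‖ ∈ Ioc a b} ≠ ∞ := by
  have hsub : {x : Plane | ‖x‖ ∈ Ioc a b} ⊆ {x : Plane | ‖x‖ ≤ b} := fun x hx => hx.2
  refine measure_ne_top_of_subset hsub ?_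
  rw [volume_norm_preimage_Iic]
  exact ENNReal.ofReal_ne_top

lemma measurableSet_annulus (a b : ℝ) : MeasurableSet {x : Plane | ‖x‖ ∈ Ioc a b} :=
  measurable_norm measurableSet_Ioc

lemma mul_volume_real_annulus (lam : ℝ) {a b : ℝ} (hab : a ≤ b) :
    lam * volume.real {x : Plane | ‖x‖ ∈ Ioc a b} = meanCount lam b - meanCount lam a := by
  have h : {x : Plane | ‖x‖ ∈ Ioc a b} = {x : Plane | ‖x‖ ≤ b} \ {x : Plane | ‖x‖ ≤ a} := by
    ext x; simp [and_comm]
  have hm : MeasurableSet {x : Plane | ‖x‖ ≤ a} := measurable_norm measurableSet_Iic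
  have hpi := Real.pi_pos
  have hsub : {x : Plane | ‖x‖ ≤ a} ⊆ {x : Plane | ‖x‖ ≤ b} := fun x hx => le_trans hx hab
  rw [h, measureReal_sdiff hsub hm
      (by rw [volume_norm_preimage_Iic]; exact ENNReal.ofReal_ne_top)]
  · rw [measureReal_def, measureReal_def, volume_norm_preimage_Iic, volume_norm_preimage_Iic,
      ENNReal.toReal_ofReal (by positivity), ENNReal.toReal_ofReal (by positivity), meanCount,
      meanCount]
    ring

end Annulus

/-! ### Poisson counts in annuli and ordered distances -/

section Counts

variable {Ω : Type*} [MeasurableSpace Ω] {μ : Measure Ω} {lam : ℝ} {X : ℕ → Ω → Plane}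

lemma IsHomogeneousPPP.measure_pointCount_annulus (hX : IsHomogeneousPPP μ lam X)
    (hlam : 0 ≤ lam) {a b : ℝ} (hab : a ≤ b) (k : ℕ) :
    μ {ω | pointCount X {x | ‖x‖ ∈ Ioc a b} ω = k} =
      ENNReal.ofReal (Real.exp (-(meanCount lam b - meanCount lam a)) *
        (meanCount lam b - meanCount lam a) ^ k / k.factorial) := by
  have h := hX.poisson _ (measurableSet_annulus a b) (volume_annulus_ne_top a b)
  have h1 : μ {ω | pointCount X {x | ‖x‖ ∈ Ioc a b} ω = k} =
      μ.map (pointCount X {x | ‖x‖ ∈ Ioc a b}) {(k : ℕ∞)} := by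
    rw [Measure.map_apply_of_aemeasurable h.aemeasurable (measurableSet_singleton _)]
    rfl
  have h2 : (Nat.cast : ℕ → ℕ∞) ⁻¹' {(k : ℕ∞)} = {k} := by
    ext j; simp
  rw [h1, h.map_eq, Measure.map_apply (by fun_prop) (measurableSet_singleton _), h2,
    poissonMeasure_singleton, mul_volume_real_annulus lam hab, Real.coe_toNNReal]
  have := meanCount_mono hlam hab
  linarith

lemma IsHomogeneousPPP.ae_pointCount_ne_top (hX : IsHomogeneousPPP μ lam X) (a b : ℝ) :
    ∀ᵐ ω ∂μ, pointCount X {x | ‖x‖ ∈ Ioc a b} ω ≠ ⊤ := by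
  have h := hX.poisson _ (measurableSet_annulus a b) (volume_annulus_ne_top a b)
  have h1 : ∀ᵐ k ∂(μ.map (pointCount X {x | ‖x‖ ∈ Ioc a b})), k ≠ ⊤ := by
    rw [h.map_eq, ae_map_iff (by fun_prop) (MeasurableSet.of_discrete)]
    exact Filter.Eventually.of_forall fun k => ENat.natCast_ne_top k
  exact ae_of_ae_map h.aemeasurable h1

/-- Each disc of integer radius almost surely contains finitely many points. This is what later
makes the correction factor exp(-J) tend to one. -/
lemma IsHomogeneousPPP.ae_tendsto_norm (hX : IsHomogeneousPPP μ lam X) :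
    ∀ᵐ ω ∂μ, Filter.Tendsto (fun i => ‖X i ω‖) Filter.atTop Filter.atTop := by
  -- The lower end -1 turns the half-open annulus into a full disc, origin included.
  have h : ∀ᵐ ω ∂μ, ∀ m : ℕ, pointCount X {x | ‖x‖ ∈ Ioc (-1) (m : ℝ)} ω ≠ ⊤ :=
    ae_all_iff.2 fun m => hX.ae_pointCount_ne_top _ _
  filter_upwards [h] with ω hω
  rw [← Nat.cofinite_eq_atTop, Filter.tendsto_atTop]
  intro c
  obtain ⟨m, hm⟩ := exists_nat_gt c
  have hfin : {i : ℕ | X i ω ∈ {x : Plane | ‖x‖ ∈ Ioc (-1) (m : ℝ)}}.Finite :=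
    Set.encard_ne_top_iff.1 (hω m)
  rw [Filter.eventually_cofinite]
  refine hfin.subset fun i hi => ?_
  have : 0 ≤ ‖X i ω‖ := norm_nonneg _
  simp only [mem_ofPred_eq, not_le] at hi
  exact ⟨by linarith, by linarith⟩

/-- For a nondecreasing sequence, having the `j`-th term in the `j`-th of a sequence of ordered
intervals amounts to having exactly one term in each of them and none in between. -/
lemma forall_encard_eq_mod_two_iff {R t : ℕ → ℝ} (hR : Monotone R) (ht : Monotone t)
    (h0 : t 0 < R 0) (n : ℕ) :
    (∀ i < 2 * n + 1, {k | R k ∈ Ioc (t i) (t (i + 1))}.encard = ((i % 2 : ℕ) : ℕ∞)) ↔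
      (∀ j < n, R j ∈ Ioc (t (2 * j + 1)) (t (2 * j + 2))) ∧ t (2 * n + 1) < R n := by
  constructor
  · intro h
    have hzero : ∀ j ≤ n, ∀ k, R k ∉ Ioc (t (2 * j)) (t (2 * j + 1)) := by
      intro j hj k hk
      have h1 := h (2 * j) (by omega)
      rw [Nat.mul_mod_right, Nat.cast_zero, Set.encard_eq_zero] at h1
      exact (Set.eq_empty_iff_forall_notMem.1 h1 k) hk
    have hone : ∀ j < n, ∃ k, {k | R k ∈ Ioc (t (2 * j + 1)) (t (2 * j + 2))} = {k} := by
      intro j hj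
      have h1 := h (2 * j + 1) (by omega)
      rw [show (2 * j + 1) % 2 = 1 by omega, Nat.cast_one] at h1
      exact Set.encard_eq_one.1 h1
    -- The single index `k` with a term in the m-th interval is at least `m`, since earlier terms
    -- lie below. Monotonicity then puts `R m` there too. By uniqueness `R (m + 1)` lies above that
    -- interval, and by emptiness of the following gap it lies above the gap as well.
    have key : ∀ m ≤ n, (∀ j < m, R j ∈ Ioc (t (2 * j + 1)) (t (2 * j + 2))) ∧
        t (2 * m + 1) < R m := by
      intro m
      induction m with
      | zero =>
        intro _
        refine ⟨by simp, ?_⟩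
        by_contra hc
        exact hzero 0 (Nat.zero_le _) 0 ⟨by simpa using h0, not_lt.1 hc⟩
      | succ m ih =>
        intro hm
        obtain ⟨ih1, ih2⟩ := ih (by omega)
        obtain ⟨k, hk⟩ := hone m (by omega)
        have hkm : R k ∈ Ioc (t (2 * m + 1)) (t (2 * m + 2)) := by
          have : k ∈ ({k} : Set ℕ) := rfl
          rw [← hk] at this
          exact this
        have hmk : m ≤ k := by
          by_contra hc
          have h1 := (ih1 k (by omega)).2
          have h2 := ht (show 2 * k + 2 ≤ 2 * m + 1 by omega)
          linarith [hkm.1]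
        have hRm : R m ∈ Ioc (t (2 * m + 1)) (t (2 * m + 2)) := ⟨ih2, (hR hmk).trans hkm.2⟩
        refine ⟨fun j hj => ?_, ?_⟩
        · rcases Nat.lt_succ_iff_lt_or_eq.1 hj with hj | rfl
          · exact ih1 j hj
          · exact hRm
        · by_contra hc
          rw [not_lt] at hc
          have h1 : R m ≤ R (m + 1) := hR (Nat.le_succ m)
          by_cases h2 : R (m + 1) ≤ t (2 * m + 2)
          · have e1 : m ∈ ({k} : Set ℕ) := hk ▸ hRm
            have e2 : m + 1 ∈ ({k} : Set ℕ) := by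
              rw [← hk]
              exact ⟨hRm.1.trans_le h1, h2⟩
            simp only [mem_singleton_iff] at e1 e2
            omega
          · exact hzero (m + 1) hm (m + 1) ⟨by simpa [Nat.mul_succ] using not_le.1 h2, hc⟩
    exact key n le_rfl
  · rintro ⟨h1, h2⟩ i hi
    have hlow : ∀ j ≤ n, t (2 * j + 1) < R j := by
      intro j hj
      rcases hj.lt_or_eq with hj | rfl
      · exact (h1 j hj).1
      · exact h2
    rcases Nat.even_or_odd' i with ⟨j, rfl | rfl⟩
    · rw [Nat.mul_mod_right, Nat.cast_zero, Set.encard_eq_zero, Set.eq_empty_iff_forall_notMem]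
      rintro k ⟨hk1, hk2⟩
      rcases lt_or_ge k j with hkj | hkj
      · have e1 := (h1 k (by omega)).2
        have e2 := ht (show 2 * k + 2 ≤ 2 * j by omega)
        linarith
      · have e1 := hlow j (by omega)
        have e2 := hR hkj
        linarith
    · rw [show (2 * j + 1) % 2 = 1 by omega, Nat.cast_one, Set.encard_eq_one]
      refine ⟨j, Set.eq_singleton_iff_unique_mem.2 ⟨h1 j (by omega), ?_⟩⟩
      rintro k ⟨hk1, hk2⟩
      by_contra hne
      rcases lt_or_gt_of_ne hne with hkj | hkj
      · have e1 := (h1 k (by omega)).2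
        have e2 := ht (show 2 * k + 2 ≤ 2 * j + 1 by omega)
        linarith
      · have e1 := hlow (j + 1) (by omega)
        have e2 := hR (show j + 1 ≤ k from hkj)
        have e3 := ht (show 2 * j + 1 + 1 ≤ 2 * (j + 1) + 1 by omega)
        linarith

/-- The exponentials telescope. Only the odd positions, where the count is one, leave their
increment as a factor. -/
lemma prod_poisson_alternating {f : ℕ → ℝ} (hf : ∀ i, 0 ≤ f (i + 1) - f i) (n : ℕ) :
    ∏ i ∈ Finset.range (2 * n + 1), ENNReal.ofReal (Real.exp (-(f (i + 1) - f i)) *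
        (f (i + 1) - f i) ^ (i % 2) / ((i % 2).factorial : ℝ)) =
      (∏ j ∈ Finset.range n, ENNReal.ofReal (f (2 * j + 2) - f (2 * j + 1))) *
        ENNReal.ofReal (Real.exp (-(f (2 * n + 1) - f 0))) := by
  induction n with
  | zero => simp
  | succ n ih =>
    rw [show 2 * (n + 1) + 1 = (2 * n + 1) + 1 + 1 by ring, Finset.prod_range_succ,
      Finset.prod_range_succ, ih, Finset.prod_range_succ, show (2 * n + 1 + 1) % 2 = 0 by omega,
      show (2 * n + 1) % 2 = 1 by omega]
    have h1 := hf (2 * n + 1)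
    simp only [pow_one, pow_zero, Nat.factorial_zero, Nat.factorial_one, Nat.cast_one, div_one,
      mul_one]
    rw [mul_assoc, mul_assoc, mul_assoc]
    congr 1
    rw [← ENNReal.ofReal_mul (by positivity), ← ENNReal.ofReal_mul (by positivity),
      ← ENNReal.ofReal_mul h1]
    congr 1
    have : Real.exp (-(f (2 * n + 1 + 1 + 1) - f 0)) = Real.exp (-(f (2 * n + 1) - f 0)) *
        Real.exp (-(f (2 * n + 1 + 1) - f (2 * n + 1))) *
        Real.exp (-(f (2 * n + 1 + 1 + 1) - f (2 * n + 1 + 1))) := by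
      rw [← Real.exp_add, ← Real.exp_add]
      congr 1; ring
    rw [this]; ring

/-- By `forall_encard_eq_mod_two_iff` the event prescribes counts 0, 1, 0, 1, …, 0 in consecutive
annuli, and these counts are independent. Since `t 0 < 0`, the first gap contains the origin and the
telescoped exponent starts from zero. -/
lemma IsHomogeneousPPP.measure_ordered_intervals (hX : IsHomogeneousPPP μ lam X)
    (hlam : 0 ≤ lam) (hord : ∀ᵐ ω ∂μ, Monotone fun i => ‖X i ω‖) {t : ℕ → ℝ} (ht : Monotone t)
    (h0 : t 0 < 0) (n : ℕ) :
    μ {ω | (∀ j < n, ‖X j ω‖ ∈ Ioc (t (2 * j + 1)) (t (2 * j + 2))) ∧ t (2 * n + 1) < ‖X n ω‖} =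
      (∏ j ∈ Finset.range n, radialIntensity lam (Ioc (t (2 * j + 1)) (t (2 * j + 2)))) *
        ENNReal.ofReal (Real.exp (-meanCount lam (t (2 * n + 1)))) := by
  set c : ℕ → Ω → ℕ∞ := fun i => pointCount X {x | ‖x‖ ∈ Ioc (t i) (t (i + 1))} with hc
  have hset : μ {ω | (∀ j < n, ‖X j ω‖ ∈ Ioc (t (2 * j + 1)) (t (2 * j + 2))) ∧
      t (2 * n + 1) < ‖X n ω‖} =
      μ (⋂ i ∈ (Finset.univ : Finset (Fin (2 * n + 1))), c i ⁻¹' {((i % 2 : ℕ) : ℕ∞)}) := by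
    refine measure_congr ?_
    filter_upwards [hord] with ω hω
    have key := forall_encard_eq_mod_two_iff hω ht
      (h0.trans_le (norm_nonneg (X 0 ω))) n
    refine propext (key.symm.trans ?_)
    simp only [Finset.mem_univ, iInter_true]
    change _ ↔ ω ∈ ⋂ i : Fin (2 * n + 1), c i ⁻¹' {((i % 2 : ℕ) : ℕ∞)}
    rw [mem_iInter]
    exact ⟨fun h i => h i i.2, fun h i hi => h ⟨i, hi⟩⟩
  have hind := hX.indep (2 * n + 1) (fun i => {x | ‖x‖ ∈ Ioc (t i) (t (i + 1))})
    (fun i => measurableSet_annulus _ _) (fun i => volume_annulus_ne_top _ _) (by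
      intro i j hij
      refine Set.disjoint_left.2 fun x hx hx' => ?_
      rcases lt_or_gt_of_ne (fun h => hij (Fin.ext h) : (i : ℕ) ≠ j) with h | h
      · have := ht (show (i : ℕ) + 1 ≤ j from h)
        linarith [hx.2, hx'.1]
      · have := ht (show (j : ℕ) + 1 ≤ i from h)
        linarith [hx.1, hx'.2])
  have hprod := hind.measure_inter_preimage_eq_mul Finset.univ
    (sets := fun i : Fin (2 * n + 1) => {((i % 2 : ℕ) : ℕ∞)})
    (fun i _ => measurableSet_singleton _)
  rw [hset, hprod, Fin.prod_univ_eq_prod_range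
    (fun i => μ (pointCount X {x | ‖x‖ ∈ Ioc (t i) (t (i + 1))} ⁻¹' {((i % 2 : ℕ) : ℕ∞)}))
    (2 * n + 1)]
  have hterm : ∀ i : ℕ, μ (pointCount X {x | ‖x‖ ∈ Ioc (t i) (t (i + 1))} ⁻¹'
      {((i % 2 : ℕ) : ℕ∞)}) = _ :=
    fun i => hX.measure_pointCount_annulus hlam (ht (Nat.le_succ i)) (i % 2)
  simp only [hterm]
  have hmono : ∀ i, 0 ≤ meanCount lam (t (i + 1)) - meanCount lam (t i) := fun i =>
    sub_nonneg.2 (meanCount_mono hlam (ht (Nat.le_succ i)))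
  refine (prod_poisson_alternating (f := fun i => meanCount lam (t i)) hmono n).trans ?_
  congr 1
  · refine Finset.prod_congr rfl fun j _ => ?_
    rw [radialIntensity_Ioc hlam (ht (Nat.le_succ _))]
  · rw [meanCount_of_nonpos h0.le, sub_zero]

end Counts

/-! ### Joint law of the smallest distances -/

section OrderedLaw

/-- Positive strictly increasing tuples. -/
def increasingTuples (n : ℕ) : Set (Fin (n + 1) → ℝ) := {r | 0 < r 0 ∧ StrictMono r}

/-- On increasing tuples, the product of these measures is the law of the `n + 1` smallest
distances. -/
noncomputable def tupleIntensity (lam : ℝ) (n : ℕ) (j : Fin (n + 1)) : Measure ℝ :=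
  if j = Fin.last n then nearestLaw lam else radialIntensity lam

instance (lam : ℝ) (n : ℕ) (j : Fin (n + 1)) : SigmaFinite (tupleIntensity lam n j) := by
  unfold tupleIntensity
  split_ifs <;> infer_instance

variable {Ω : Type*} [MeasurableSpace Ω] {μ : Measure Ω} {lam : ℝ} {X : ℕ → Ω → Plane}

/-- The `n + 1` smallest distances. -/
noncomputable def firstNorms (X : ℕ → Ω → Plane) (n : ℕ) (ω : Ω) : Fin (n + 1) → ℝ :=
  fun j => ‖X j ω‖

lemma IsHomogeneousPPP.measurable_firstNorms (hX : IsHomogeneousPPP μ lam X) (n : ℕ) :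
    Measurable (firstNorms X n) :=
  measurable_pi_iff.2 fun j => (hX.measurable j).norm

lemma IsHomogeneousPPP.measure_intervals_of_chain (hX : IsHomogeneousPPP μ lam X)
    (hlam : 0 ≤ lam) (hord : ∀ᵐ ω ∂μ, Monotone fun i => ‖X i ω‖) {a b : ℕ → ℝ} (h0 : 0 ≤ a 0)
    (hab : ∀ j, a j ≤ b j) (hba : ∀ j, b j ≤ a (j + 1)) (n : ℕ) :
    μ {ω | (∀ j < n, ‖X j ω‖ ∈ Ioc (a j) (b j)) ∧ a n < ‖X n ω‖} =
      (∏ j ∈ Finset.range n, radialIntensity lam (Ioc (a j) (b j))) *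
        ENNReal.ofReal (Real.exp (-meanCount lam (a n))) := by
  -- The endpoints are interleaved as -1, a₀, b₀, a₁, b₁, …, so that index 2j+1 carries `a j` and
  -- index 2j+2 carries `b j`.
  let t : ℕ → ℝ := fun i => if i = 0 then -1 else if i % 2 = 1 then a (i / 2) else b (i / 2 - 1)
  have hodd : ∀ j, t (2 * j + 1) = a j := by
    intro j
    have h1 : (2 * j + 1) % 2 = 1 := by omega
    have h2 : (2 * j + 1) / 2 = j := by omega
    simp [t, h1, h2]
  have heven : ∀ j, t (2 * j + 2) = b j := by
    intro j
    simp [t]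
  have ht0 : t 0 = -1 := by simp [t]
  have ht : Monotone t := by
    refine monotone_nat_of_le_succ fun i => ?_
    rcases Nat.even_or_odd' i with ⟨j, rfl | rfl⟩
    · rw [hodd]
      rcases j with _ | j
      · rw [mul_zero, ht0]; linarith
      · rw [Nat.mul_succ, heven]; exact hba j
    · rw [hodd, heven]; exact hab j
  have := hX.measure_ordered_intervals hlam hord ht (by rw [ht0]; norm_num) n
  simpa only [hodd, heven] using this

/-- Bounding the last distance on both sides gives a difference of two events of the form treated in
`measure_intervals_of_chain`, with thresholds `a` and `b` for that distance. The difference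
exp(-Λ(a)) - exp(-Λ(b)) is the mass that `nearestLaw` gives to the interval, which explains the
special role of the last coordinate in `tupleIntensity`. -/
lemma IsHomogeneousPPP.measure_firstNorms_box [IsFiniteMeasure μ] (hX : IsHomogeneousPPP μ lam X)
    (hlam : 0 < lam) (hord : ∀ᵐ ω ∂μ, Monotone fun i => ‖X i ω‖) {n : ℕ} {a b : Fin (n + 1) → ℝ}
    (h0 : 0 ≤ a 0) (hab : ∀ j, a j ≤ b j) (hba : ∀ j : Fin n, b j.castSucc ≤ a j.succ) :
    μ {ω | ∀ j, firstNorms X n ω j ∈ Ioc (a j) (b j)} =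
      ∏ j, tupleIntensity lam n j (Ioc (a j) (b j)) := by
  have hlast : 0 ≤ a (Fin.last n) := by
    have hmono : Monotone a := Fin.monotone_iff_le_succ.2 fun j => (hab _).trans (hba j)
    exact h0.trans (hmono (Fin.zero_le _))
  have key : ∀ v : ℝ, a (Fin.last n) ≤ v →
      μ {ω | (∀ j : Fin n, ‖X j ω‖ ∈ Ioc (a j.castSucc) (b j.castSucc)) ∧ v < ‖X n ω‖} =
      (∏ j : Fin n, radialIntensity lam (Ioc (a j.castSucc) (b j.castSucc))) *
        ENNReal.ofReal (Real.exp (-meanCount lam v)) := by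
    intro v hv
    -- From index `n` on both sequences are constantly `v`, which keeps the chain of inequalities
    -- and makes `v` the lower bound for the last distance.
    let a' : ℕ → ℝ := fun j => if h : j < n then a ⟨j, by omega⟩ else v
    let b' : ℕ → ℝ := fun j => if h : j < n then b ⟨j, by omega⟩ else v
    have ha' : ∀ j : Fin n, a' j = a j.castSucc := fun j => by simp [a']; rfl
    have hb' : ∀ j : Fin n, b' j = b j.castSucc := fun j => by simp [b']; rfl
    have hn : a' n = v := by simp [a']
    have h := hX.measure_intervals_of_chain hlam.le hord (a := a') (b := b') ?_ ?_ ?_ n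
    · rw [hn, ← Fin.prod_univ_eq_prod_range (fun j => radialIntensity lam (Ioc (a' j) (b' j)))] at h
      simp only [ha', hb'] at h
      rw [← h]
      congr 1
      ext ω
      simp only [mem_ofPred_eq]
      refine and_congr_left' ⟨fun H j hj => ?_, fun H j => ?_⟩
      · have := H ⟨j, hj⟩
        rwa [← ha', ← hb'] at this
      · rw [← ha', ← hb']
        exact H j j.2
    · by_cases h : 0 < n
      · simpa [a', h] using h0
      · simpa [a', h] using hlast.trans hv
    · intro j
      by_cases h : j < n
      · simpa [a', b', h] using hab _
      · simp [a', b', h]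
    · intro j
      by_cases h : j + 1 < n
      · simpa [a', b', h, (Nat.lt_succ_self j).trans h] using hba ⟨j, by omega⟩
      · by_cases h' : j < n
        · obtain rfl : n = j + 1 := by omega
          simpa [a', b'] using (hba ⟨j, by omega⟩).trans hv
        · simp [a', b', h, h']
  have hset : {ω | ∀ j, firstNorms X n ω j ∈ Ioc (a j) (b j)} =
      {ω | (∀ j : Fin n, ‖X j ω‖ ∈ Ioc (a j.castSucc) (b j.castSucc)) ∧
          a (Fin.last n) < ‖X n ω‖} \
      {ω | (∀ j : Fin n, ‖X j ω‖ ∈ Ioc (a j.castSucc) (b j.castSucc)) ∧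
          b (Fin.last n) < ‖X n ω‖} := by
    ext ω
    simp only [mem_ofPred_eq, Set.mem_sdiff, Fin.forall_fin_succ', firstNorms, Fin.val_castSucc,
      Fin.val_last, not_and, not_lt]
    constructor
    · rintro ⟨h1, h2⟩
      exact ⟨⟨h1, h2.1⟩, fun _ => h2.2⟩
    · rintro ⟨⟨h1, h2⟩, h3⟩
      exact ⟨h1, h2, h3 h1⟩
  have hmeas : MeasurableSet {ω | (∀ j : Fin n, ‖X j ω‖ ∈ Ioc (a j.castSucc) (b j.castSucc)) ∧
          b (Fin.last n) < ‖X n ω‖} := by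
    have h1 : ∀ i, Measurable fun ω => ‖X i ω‖ := fun i => (hX.measurable i).norm
    refine MeasurableSet.inter ?_ (measurableSet_lt measurable_const (h1 n))
    exact measurableSet_setOfPred.2 (Measurable.forall fun j =>
      measurableSet_setOfPred.1 (h1 j measurableSet_Ioc))
  rw [hset, measure_sdiff ?_ hmeas.nullMeasurableSet (measure_ne_top _ _), key _ le_rfl,
    key _ (hab _), Fin.prod_univ_castSucc, ← ENNReal.mul_sub, ← nearestLaw_Ioc hlam hlast (hab _)]
  · congr 1
    · refine Finset.prod_congr rfl fun j _ => ?_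
      rw [tupleIntensity, if_neg (Fin.castSucc_lt_last j).ne]
    · rw [tupleIntensity, if_pos rfl]
  · intro _ _
    refine ENNReal.prod_ne_top fun j _ => ?_
    rw [radialIntensity_Ioc hlam.le (hab _)]
    exact ENNReal.ofReal_ne_top
  · exact fun ω hω => ⟨hω.1, (hab _).trans_lt hω.2⟩

/-- Ordered rational boxes. -/
def orderedBox {n : ℕ} (q : (Fin (n + 1) → ℚ) × (Fin (n + 1) → ℚ)) : Set (Fin (n + 1) → ℝ) :=
  if 0 ≤ q.1 0 ∧ ∀ j : Fin n, q.2 j.castSucc ≤ q.1 j.succ then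
    univ.pi fun j => Ioc (q.1 j : ℝ) (q.2 j : ℝ) else ∅

/-- Rationals chosen between consecutive coordinates of an increasing tuple separate them. A
countable cover results, so an identity of measures may be checked box by box. -/
lemma iUnion_orderedBox (n : ℕ) :
    ⋃ q : (Fin (n + 1) → ℚ) × (Fin (n + 1) → ℚ), orderedBox q = increasingTuples n := by
  ext r
  simp only [mem_iUnion, orderedBox]
  constructor
  · rintro ⟨q, hq⟩
    split_ifs at hq with h
    · refine ⟨?_, Fin.strictMono_iff_lt_succ.2 fun j => ?_⟩
      · have h1 := (hq 0 (mem_univ _)).1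
        have h2 : (0 : ℝ) ≤ q.1 0 := by exact_mod_cast h.1
        linarith
      · have h1 := (hq j.castSucc (mem_univ _)).2
        have h2 := (hq j.succ (mem_univ _)).1
        have h3 : (q.2 j.castSucc : ℝ) ≤ q.1 j.succ := by exact_mod_cast h.2 j
        linarith
    · exact hq.elim
  · rintro ⟨h0, hr⟩
    have hgap : ∀ j : Fin n, ∃ c : ℚ, r j.castSucc < c ∧ (c : ℝ) < r j.succ := fun j =>
      exists_rat_btwn (hr (Fin.castSucc_lt_succ))
    choose c hc using hgap
    obtain ⟨d, hd⟩ := exists_rat_gt (r (Fin.last n))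
    refine ⟨⟨Fin.cons 0 c, Fin.snoc c d⟩, ?_⟩
    rw [if_pos ⟨by simp, fun j => by simp⟩]
    intro j _
    constructor
    · refine Fin.cases ?_ (fun i => ?_) j
      · simpa using h0
      · simpa using (hc i).2
    · refine Fin.lastCases ?_ (fun i => ?_) j
      · simpa using hd.le
      · simpa using (hc i).1.le

/-- Inside one ordered box every sub-box is again ordered, so `measure_firstNorms_box` applies to
all of them and uniqueness of product measures on the π-system of half-open boxes gives equality
there. The restriction is needed because unordered boxes carry no such product formula. -/
lemma IsHomogeneousPPP.restrict_map_firstNorms [IsFiniteMeasure μ]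
    (hX : IsHomogeneousPPP μ lam X) (hlam : 0 < lam)
    (hord : ∀ᵐ ω ∂μ, Monotone fun i => ‖X i ω‖) (n : ℕ) :
    (μ.map (firstNorms X n)).restrict (increasingTuples n) =
      (Measure.pi (tupleIntensity lam n)).restrict (increasingTuples n) := by
  rw [← iUnion_orderedBox, Measure.restrict_iUnion_congr]
  intro q
  unfold orderedBox
  split_ifs with hq
  swap
  · simp
  rw [Measure.restrict_pi_pi]
  have hfin : ∀ a b : ℝ, ∀ j, tupleIntensity lam n j (Ioc a b) < ∞ := by
    intro a b j
    unfold tupleIntensity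
    split_ifs
    · exact (measure_mono (subset_univ _)).trans_lt (by rw [nearestLaw_univ hlam]; simp)
    · rcases le_total a b with h | h
      · rw [radialIntensity_Ioc hlam.le h]; exact ENNReal.ofReal_lt_top
      · simp [h]
  symm
  refine Measure.pi_eq_generateFrom (C := fun _ => {S | ∃ l u : ℝ, l < u ∧ Ioc l u = S})
    (fun _ => ?_) (fun _ => isPiSystem_Ioc id id) (fun j => ?_) (fun s hs => ?_)
  · rw [← borel_eq_generateFrom_Ioc]; exact (BorelSpace.measurable_eq).symm
  · refine ⟨fun k => Ioc (-(k + 1 : ℝ)) (k + 1), fun k => ⟨_, _, ?_, rfl⟩, fun k => ?_, ?_⟩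
    · have : (0 : ℝ) ≤ k := k.cast_nonneg
      linarith
    · exact (Measure.restrict_apply_le _ _).trans_lt (hfin _ _ j)
    · refine eq_univ_of_forall fun x => mem_iUnion.2 ?_
      obtain ⟨k, hk⟩ := exists_nat_gt |x|
      have := abs_lt.1 hk
      exact ⟨k, by linarith, by linarith⟩
  · choose l u hlu hs' using hs
    obtain rfl : (fun j => Ioc (l j) (u j)) = s := funext hs'
    have hms : MeasurableSet (univ.pi fun j => Ioc (l j) (u j)) :=
      MeasurableSet.univ_pi fun _ => measurableSet_Ioc
    have hmq : MeasurableSet (univ.pi fun j => Ioc (q.1 j : ℝ) (q.2 j : ℝ)) :=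
      MeasurableSet.univ_pi fun _ => measurableSet_Ioc
    rw [Measure.restrict_apply hms, ← Set.pi_inter_distrib]
    simp only [Measure.restrict_apply measurableSet_Ioc, Ioc_inter_Ioc]
    rw [Measure.map_apply (hX.measurable_firstNorms n)
      (MeasurableSet.univ_pi fun _ => measurableSet_Ioc)]
    -- If some intersected interval is reversed, it is empty and both sides vanish.
    by_cases hne : ∀ j, l j ⊔ (q.1 j : ℝ) ≤ u j ⊓ (q.2 j : ℝ)
    · rw [← hX.measure_firstNorms_box hlam hord ?_ hne ?_]
      · congr 1
        ext ω
        simp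
      · have : (0 : ℝ) ≤ q.1 0 := by exact_mod_cast hq.1
        exact this.trans le_sup_right
      · intro j
        have : (q.2 j.castSucc : ℝ) ≤ q.1 j.succ := by exact_mod_cast hq.2 j
        exact inf_le_right.trans (this.trans le_sup_right)
    · push Not at hne
      obtain ⟨j, hj⟩ := hne
      have hempty : Ioc (l j ⊔ (q.1 j : ℝ)) (u j ⊓ (q.2 j : ℝ)) = ∅ := Ioc_eq_empty hj.not_gt
      rw [Finset.prod_eq_zero (Finset.mem_univ j) (by rw [hempty, measure_empty]),
        show (univ.pi fun i => Ioc (l i ⊔ (q.1 i : ℝ)) (u i ⊓ (q.2 i : ℝ))) = ∅ from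
          Set.univ_pi_eq_empty hempty]
      simp

end OrderedLaw

/-! ### The distances as a Markov chain -/

section Recursion

lemma lintegral_pi_snoc {n : ℕ} (ν : Fin (n + 1) → Measure ℝ) [∀ i, SigmaFinite (ν i)]
    {H : (Fin (n + 1) → ℝ) → ℝ≥0∞} (hH : Measurable H) :
    ∫⁻ r, H r ∂Measure.pi ν =
      ∫⁻ r, ∫⁻ u, H (Fin.snoc r u) ∂ν (Fin.last n) ∂Measure.pi fun j : Fin n => ν j.castSucc := by
  have h := measurePreserving_piFinSuccAbove ν (Fin.last n)
  have e := (h.symm _).lintegral_comp hH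
  rw [← e, lintegral_prod_symm _ (by fun_prop)]
  simp only [Fin.succAbove_last]
  refine lintegral_congr fun r => lintegral_congr fun u => ?_
  congr 1
  exact Fin.insertNth_last' u r

lemma measurable_snoc {n : ℕ} :
    Measurable fun p : (Fin (n + 1) → ℝ) × ℝ => (Fin.snoc p.1 p.2 : Fin (n + 2) → ℝ) := by
  refine measurable_pi_iff.2 fun j => ?_
  refine Fin.lastCases ?_ (fun i => ?_) j
  · simpa using measurable_snd
  · simp only [Fin.snoc_castSucc]
    fun_prop

lemma measurableSet_increasingTuples (n : ℕ) : MeasurableSet (increasingTuples n) := by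
  have h : increasingTuples n = {r | 0 < r 0} ∩ ⋂ j : Fin n, {r | r j.castSucc < r j.succ} := by
    ext r
    simp [increasingTuples, Fin.strictMono_iff_lt_succ]
  rw [h]
  exact (measurableSet_lt (by fun_prop) (by fun_prop)).inter
    (MeasurableSet.iInter fun j => measurableSet_lt (by fun_prop) (by fun_prop))

lemma snoc_mem_increasingTuples {n : ℕ} {r : Fin (n + 1) → ℝ} {u : ℝ} :
    (Fin.snoc r u : Fin (n + 2) → ℝ) ∈ increasingTuples (n + 1) ↔
      r ∈ increasingTuples n ∧ r (Fin.last n) < u := by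
  have h0 : (Fin.snoc r u : Fin (n + 2) → ℝ) 0 = r 0 := by
    rw [← Fin.castSucc_zero, Fin.snoc_castSucc]
  simp only [increasingTuples, mem_ofPred_eq, h0, and_assoc]
  refine and_congr_right fun _ => ?_
  rw [Fin.strictMono_iff_lt_succ, Fin.strictMono_iff_lt_succ, Fin.forall_fin_succ']
  simp only [Fin.snoc_castSucc, Fin.succ_last, Fin.snoc_last]
  refine and_congr_left fun _ => forall_congr' fun j => ?_
  rw [Fin.succ_castSucc, Fin.snoc_castSucc]

variable {lam : ℝ}

/-- The law of the `n + 1` smallest distances. -/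
noncomputable def tupleLaw (lam : ℝ) (n : ℕ) : Measure (Fin (n + 1) → ℝ) :=
  (Measure.pi (tupleIntensity lam n)).restrict (increasingTuples n)

lemma tupleIntensity_last (n : ℕ) : tupleIntensity lam n (Fin.last n) = nearestLaw lam := by
  simp [tupleIntensity]

lemma tupleIntensity_castSucc (n : ℕ) :
    (fun j : Fin n => tupleIntensity lam n j.castSucc) = fun _ => radialIntensity lam := by
  funext j
  rw [tupleIntensity, if_neg (Fin.castSucc_lt_last j).ne]

lemma lintegral_pi_tupleIntensity {n : ℕ} {W : (Fin (n + 1) → ℝ) → ℝ≥0∞} (hW : Measurable W) :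
    ∫⁻ r, W r ∂Measure.pi (tupleIntensity lam n) =
      ∫⁻ r, ENNReal.ofReal (Real.exp (-meanCount lam (r (Fin.last n)))) * W r
        ∂Measure.pi fun _ => radialIntensity lam := by
  rw [lintegral_pi_snoc _ hW, lintegral_pi_snoc _ (by fun_prop)]
  simp only [tupleIntensity_last, tupleIntensity_castSucc, Fin.snoc_last]
  refine lintegral_congr fun r => ?_
  refine lintegral_nearestLaw (hW.comp ?_)
  refine measurable_pi_iff.2 fun j => ?_
  refine Fin.lastCases ?_ (fun i => ?_) j
  · simp only [Fin.snoc_last]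
    fun_prop
  · simp

/-- Average over the next distance, given the first ones. -/
noncomputable def nextAverage (lam : ℝ) {n : ℕ} (H : (Fin (n + 2) → ℝ) → ℝ≥0∞)
    (r : Fin (n + 1) → ℝ) : ℝ≥0∞ :=
  ∫⁻ u in Ioi (r (Fin.last n)), H (Fin.snoc r u) *
    ENNReal.ofReal (Real.exp (meanCount lam (r (Fin.last n)) - meanCount lam u))
      ∂radialIntensity lam

lemma measurable_nextAverage {n : ℕ} {H : (Fin (n + 2) → ℝ) → ℝ≥0∞} (hH : Measurable H) :
    Measurable (nextAverage lam H) := by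
  have hF : Measurable ({p : (Fin (n + 1) → ℝ) × ℝ | p.1 (Fin.last n) < p.2}.indicator
      fun p => H (Fin.snoc p.1 p.2) *
        ENNReal.ofReal (Real.exp (meanCount lam (p.1 (Fin.last n)) - meanCount lam p.2))) :=
    ((hH.comp measurable_snoc).mul (by fun_prop)).indicator
      (measurableSet_lt (by fun_prop) (by fun_prop))
  have hW := hF.lintegral_prod_right' (ν := radialIntensity lam)
  convert hW using 2 with r
  rw [nextAverage, ← lintegral_indicator measurableSet_Ioi]
  rfl

/-- Factor exp(-Λ(u)) as exp(-Λ(r)) exp(Λ(r) - Λ(u)), with `r` the previous distance. The first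
factor is the weight in the shorter law, the second is the transition density. -/
lemma lintegral_tupleLaw_succ {n : ℕ} {H : (Fin (n + 2) → ℝ) → ℝ≥0∞} (hH : Measurable H) :
    ∫⁻ r, H r ∂tupleLaw lam (n + 1) = ∫⁻ r, nextAverage lam H r ∂tupleLaw lam n := by
  have hsn := @measurable_snoc n
  have hS1 := measurableSet_increasingTuples (n + 1)
  have hS0 := measurableSet_increasingTuples n
  rw [tupleLaw, tupleLaw, ← lintegral_indicator hS1, ← lintegral_indicator hS0,
    lintegral_pi_tupleIntensity ((measurable_nextAverage hH).indicator hS0),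
    lintegral_pi_snoc _ (hH.indicator hS1), tupleIntensity_last, tupleIntensity_castSucc]
  refine lintegral_congr fun r => ?_
  have hsr : Measurable fun u : ℝ => (Fin.snoc r u : Fin (n + 2) → ℝ) :=
    hsn.comp (measurable_const.prodMk measurable_id)
  have hHs : Measurable fun u : ℝ => H (Fin.snoc r u) := hH.comp hsr
  refine (lintegral_nearestLaw ((hH.indicator hS1).comp hsr)).trans ?_
  simp only [Function.comp_apply]
  by_cases hr : r ∈ increasingTuples n
  · rw [indicator_of_mem hr, nextAverage,
      ← lintegral_const_mul _ (by fun_prop),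
      ← lintegral_indicator measurableSet_Ioi]
    refine lintegral_congr fun u => ?_
    by_cases hu : u ∈ Ioi (r (Fin.last n))
    · rw [indicator_of_mem (snoc_mem_increasingTuples.2 ⟨hr, hu⟩), indicator_of_mem hu,
        mul_comm (H _), ← mul_assoc, ← ENNReal.ofReal_mul (Real.exp_pos _).le,
        ← Real.exp_add]
      congr 3
      ring
    · rw [indicator_of_notMem (fun h => hu (snoc_mem_increasingTuples.1 h).2),
        indicator_of_notMem hu, mul_zero]
  · rw [indicator_of_notMem hr, mul_zero]
    refine (lintegral_congr fun u => ?_).trans lintegral_zero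
    rw [indicator_of_notMem (fun h => hr (snoc_mem_increasingTuples.1 h).1), mul_zero]

lemma lintegral_tupleLaw_zero {H : (Fin 1 → ℝ) → ℝ≥0∞} (hH : Measurable H) :
    ∫⁻ r, H r ∂tupleLaw lam 0 =
      ∫⁻ u in Ioi 0, H (fun _ => u) * ENNReal.ofReal (Real.exp (-meanCount lam u))
          ∂radialIntensity lam := by
  have hS := measurableSet_increasingTuples 0
  have hconst : ∀ u : ℝ, (Fin.snoc (default : Fin 0 → ℝ) u : Fin 1 → ℝ) = fun _ => u := by
    intro u
    funext j
    obtain rfl : j = Fin.last 0 := Subsingleton.elim (α := Fin 1) _ _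
    rw [Fin.snoc_last]
  have hmem : ∀ u : ℝ, (Fin.snoc (default : Fin 0 → ℝ) u : Fin 1 → ℝ) ∈ increasingTuples 0 ↔
      u ∈ Ioi (0 : ℝ) := by
    intro u
    rw [hconst]
    simp [increasingTuples, Subsingleton.strictMono]
  rw [tupleLaw, ← lintegral_indicator hS, lintegral_pi_snoc _ (hH.indicator hS),
    tupleIntensity_last, Measure.pi_of_empty _ default, lintegral_dirac]
  have hc : Measurable fun u : ℝ => (fun _ : Fin 1 => u) := by fun_prop
  simp only [indicator, hmem]
  simp only [hconst]
  refine (lintegral_nearestLaw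
    (Measurable.ite measurableSet_Ioi (hH.comp hc) measurable_const)).trans ?_
  rw [← lintegral_indicator measurableSet_Ioi]
  refine lintegral_congr fun u => ?_
  by_cases hu : u ∈ Ioi (0 : ℝ)
  · rw [indicator_of_mem hu, if_pos (mem_Ioi.1 hu), mul_comm, Function.comp_apply]
  · rw [indicator_of_notMem hu, if_neg (fun h => hu (mem_Ioi.2 h)), mul_zero]

lemma ae_tupleLaw_mem (n : ℕ) : ∀ᵐ r ∂tupleLaw lam n, r ∈ increasingTuples n :=
  ae_restrict_mem (measurableSet_increasingTuples n)

lemma pos_of_mem_increasingTuples {n : ℕ} {r : Fin (n + 1) → ℝ} (hr : r ∈ increasingTuples n)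
    (j : Fin (n + 1)) : 0 < r j :=
  hr.1.trans_le (hr.2.monotone (Fin.zero_le _))

/-- Each transition kernel has mass one, so the mass is preserved along the recursion. This shows
that the ordered boxes already account for all the probability. -/
lemma tupleLaw_univ (hlam : 0 < lam) (n : ℕ) : tupleLaw lam n univ = 1 := by
  rw [← lintegral_one]
  induction n with
  | zero =>
    rw [lintegral_tupleLaw_zero measurable_const]
    simp only [one_mul]
    rw [lintegral_exp_neg_meanCount_Ioi hlam le_rfl, meanCount_of_nonpos le_rfl]
    simp
  | succ n ih =>
    rw [lintegral_tupleLaw_succ measurable_const]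
    refine Eq.trans ?_ ih
    refine lintegral_congr_ae ?_
    filter_upwards [ae_tupleLaw_mem n] with r hr
    simp only [nextAverage, one_mul, sub_eq_add_neg, Real.exp_add, ENNReal.ofReal_mul (Real.exp_pos _).le]
    rw [lintegral_const_mul _ (by fun_prop), lintegral_exp_neg_meanCount_Ioi hlam
      (pos_of_mem_increasingTuples hr _).le, ← ENNReal.ofReal_mul (Real.exp_pos _).le, ← Real.exp_add]
    simp

variable {Ω : Type*} [MeasurableSpace Ω] {μ : Measure Ω} {X : ℕ → Ω → Plane}

/-- The restriction of the law to increasing tuples already has mass one, so it is the whole law. In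
particular, almost surely the distances are positive and there are no ties, although `hord` only
gives weak monotonicity. -/
theorem IsHomogeneousPPP.map_firstNorms [IsProbabilityMeasure μ] (hX : IsHomogeneousPPP μ lam X)
    (hlam : 0 < lam) (hord : ∀ᵐ ω ∂μ, Monotone fun i => ‖X i ω‖) (n : ℕ) :
    μ.map (firstNorms X n) = tupleLaw lam n := by
  have hm := (hX.measurable_firstNorms n).aemeasurable (μ := μ)
  have : IsProbabilityMeasure (μ.map (firstNorms X n)) := Measure.isProbabilityMeasure_map hm
  have h := hX.restrict_map_firstNorms hlam hord n
  have hS := measurableSet_increasingTuples n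
  have h1 : μ.map (firstNorms X n) (increasingTuples n) = 1 := by
    rw [← Measure.restrict_apply_univ, h]
    exact tupleLaw_univ hlam n
  rw [tupleLaw, ← h, Measure.restrict_eq_self_of_ae_mem]
  exact (mem_ae_iff_prob_eq_one hS).2 h1

lemma IsHomogeneousPPP.ae_mem_increasingTuples [IsProbabilityMeasure μ]
    (hX : IsHomogeneousPPP μ lam X) (hlam : 0 < lam)
    (hord : ∀ᵐ ω ∂μ, Monotone fun i => ‖X i ω‖) (n : ℕ) :
    ∀ᵐ ω ∂μ, firstNorms X n ω ∈ increasingTuples n := by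
  refine ae_of_ae_map (hX.measurable_firstNorms n).aemeasurable ?_
  rw [hX.map_firstNorms hlam hord]
  exact ae_tupleLaw_mem n

theorem IsHomogeneousPPP.lintegral_firstNorms [IsProbabilityMeasure μ]
    (hX : IsHomogeneousPPP μ lam X) (hlam : 0 < lam)
    (hord : ∀ᵐ ω ∂μ, Monotone fun i => ‖X i ω‖) {n : ℕ} {H : (Fin (n + 1) → ℝ) → ℝ≥0∞}
    (hH : Measurable H) :
    ∫⁻ ω, H (firstNorms X n ω) ∂μ = ∫⁻ r, H r ∂tupleLaw lam n := by
  rw [← hX.map_firstNorms hlam hord, lintegral_map hH (hX.measurable_firstNorms n)]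

end Recursion

/-! ### The Laplace functional of the far interference -/

section Interference

/-- Laplace transform at `a * u ^ (-η)` of an exponential variable of mean one. -/
noncomputable def fadingFactor (η a u : ℝ) : ℝ := (1 + a * u ^ (-η))⁻¹

/-- Exponent of the Laplace functional of the interference from beyond distance `r`. -/
noncomputable def interferenceExponent (lam η a r : ℝ) : ℝ :=
  ∫ u in Ioi r, 2 * Real.pi * lam * u * (1 - fadingFactor η a u)

variable {lam η a r : ℝ}

lemma measurable_fadingFactor : Measurable fun p : ℝ × ℝ => fadingFactor η p.1 p.2 := by
  unfold fadingFactor; fun_prop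

lemma fadingFactor_pos (ha : 0 ≤ a) {u : ℝ} (hu : 0 ≤ u) : 0 < fadingFactor η a u := by
  have := Real.rpow_nonneg hu (-η)
  unfold fadingFactor; positivity

lemma fadingFactor_le_one (ha : 0 ≤ a) {u : ℝ} (hu : 0 ≤ u) : fadingFactor η a u ≤ 1 := by
  have := mul_nonneg ha (Real.rpow_nonneg hu (-η))
  exact inv_le_one_of_one_le₀ (by linarith)

lemma one_sub_fadingFactor (ha : 0 ≤ a) {u : ℝ} (hu : 0 ≤ u) :
    1 - fadingFactor η a u = a * u ^ (-η) * (1 + a * u ^ (-η))⁻¹ := by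
  have h := mul_nonneg ha (Real.rpow_nonneg hu (-η))
  have h1 : (0 : ℝ) < 1 + a * u ^ (-η) := by linarith
  unfold fadingFactor
  field_simp
  ring

lemma one_sub_fadingFactor_le (ha : 0 ≤ a) {u : ℝ} (hu : 0 ≤ u) :
    1 - fadingFactor η a u ≤ a * u ^ (-η) := by
  have h := mul_nonneg ha (Real.rpow_nonneg hu (-η))
  rw [one_sub_fadingFactor ha hu]
  exact mul_le_of_le_one_right h (inv_le_one_of_one_le₀ (by linarith))

lemma continuousAt_fadingFactor (ha : 0 ≤ a) {u : ℝ} (hu : 0 < u) :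
    ContinuousAt (fadingFactor η a) u := by
  have h := mul_nonneg ha (Real.rpow_nonneg hu.le (-η))
  refine ContinuousAt.inv₀ ?_ (by linarith)
  exact continuousAt_const.add (continuousAt_const.mul
    (Real.continuousAt_rpow_const _ _ (Or.inl hu.ne')))

/-- The integrand is dominated by a multiple of u^(1-η), which is integrable at infinity exactly
because η > 2. -/
lemma integrableOn_interference (hlam : 0 ≤ lam) (hη : 2 < η) (ha : 0 ≤ a) (hr : 0 < r) :
    IntegrableOn (fun u => 2 * Real.pi * lam * u * (1 - fadingFactor η a u)) (Ioi r) := by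
  have hpi := Real.pi_pos
  have h1 : IntegrableOn (fun u : ℝ => 2 * Real.pi * lam * a * u ^ (1 - η)) (Ioi r) :=
    (integrableOn_Ioi_rpow_of_lt (by linarith) hr).const_mul _
  refine Integrable.mono' h1 ?_ ?_
  · have := (measurable_fadingFactor (η := η)).comp
      ((measurable_const (a := a)).prodMk (measurable_id (α := ℝ)))
    have h2 : Measurable fun u => fadingFactor η a u := this
    exact Measurable.aestronglyMeasurable (by fun_prop)
  · refine (ae_restrict_iff' measurableSet_Ioi).2 (Filter.Eventually.of_forall fun u hu => ?_)
    have hu0 : 0 < u := hr.trans hu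
    have h2 := fadingFactor_le_one (η := η) ha hu0.le
    have h3 := one_sub_fadingFactor_le (η := η) ha hu0.le
    have h4 : 0 ≤ 1 - fadingFactor η a u := by linarith
    rw [Real.norm_of_nonneg (by positivity)]
    calc 2 * Real.pi * lam * u * (1 - fadingFactor η a u)
        ≤ 2 * Real.pi * lam * u * (a * u ^ (-η)) := by gcongr
      _ = 2 * Real.pi * lam * a * u ^ (1 - η) := by
        rw [sub_eq_add_neg, Real.rpow_add hu0, Real.rpow_one]; ring

lemma interferenceExponent_nonneg (hlam : 0 ≤ lam) (ha : 0 ≤ a) (hr : 0 ≤ r) :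
    0 ≤ interferenceExponent lam η a r := by
  refine setIntegral_nonneg measurableSet_Ioi fun u hu => ?_
  have hu0 : 0 < u := hr.trans_lt hu
  have h2 := fadingFactor_le_one (η := η) ha hu0.le
  have h4 : 0 ≤ 1 - fadingFactor η a u := by linarith
  have hpi := Real.pi_pos
  positivity

lemma hasDerivAt_interferenceExponent (hlam : 0 ≤ lam) (hη : 2 < η) (ha : 0 ≤ a) (hr : 0 < r) :
    HasDerivAt (interferenceExponent lam η a)
      (-(2 * Real.pi * lam * r * (1 - fadingFactor η a r))) r := by
  have hr2 : 0 < r / 2 := by linarith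
  have hint := integrableOn_interference (lam := lam) hlam hη ha hr2
  have hcont : ∀ u, 0 < u → ContinuousAt
      (fun u => 2 * Real.pi * lam * u * (1 - fadingFactor η a u)) u := fun u hu =>
    (by fun_prop : ContinuousAt (fun u => 2 * Real.pi * lam * u) u).mul
      (continuousAt_const.sub (continuousAt_fadingFactor ha hu))
  have hm : Measurable fun u => 2 * Real.pi * lam * u * (1 - fadingFactor η a u) := by
    have h2 : Measurable fun u => fadingFactor η a u := (measurable_fadingFactor (η := η)).comp
      ((measurable_const (a := a)).prodMk (measurable_id (α := ℝ)))
    fun_prop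
  have h := intervalIntegral.integral_hasDerivAt_right
    (f := fun u => 2 * Real.pi * lam * u * (1 - fadingFactor η a u)) (a := r / 2) (b := r)
    ((intervalIntegrable_iff_integrableOn_Ioc_of_le (by linarith)).2
      (hint.mono_set Ioc_subset_Ioi_self)) (hm.stronglyMeasurable.stronglyMeasurableAtFilter)
    (hcont r hr)
  have h' := h.const_sub (interferenceExponent lam η a (r / 2))
  refine h'.congr_of_eventuallyEq ?_
  filter_upwards [lt_mem_nhds (show r / 2 < r by linarith)] with t ht
  have := intervalIntegral.integral_Ioi_sub_Ioi hint ht.le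
  rw [← this, interferenceExponent, interferenceExponent]
  ring

lemma tendsto_interferenceExponent (hlam : 0 ≤ lam) (hη : 2 < η) (ha : 0 ≤ a) :
    Filter.Tendsto (interferenceExponent lam η a) Filter.atTop (nhds 0) := by
  have hint := integrableOn_interference (lam := lam) hlam hη ha one_pos
  have h := intervalIntegral_tendsto_integral_Ioi 1 hint Filter.tendsto_id
  have h' := h.const_sub (interferenceExponent lam η a 1)
  rw [interferenceExponent, sub_self] at h'
  refine h'.congr' ?_
  filter_upwards [Filter.eventually_ge_atTop 1] with t ht
  have := intervalIntegral.integral_Ioi_sub_Ioi hint ht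
  rw [id, ← this, interferenceExponent]
  ring

lemma measurable_interferenceExponent :
    Measurable fun p : ℝ × ℝ => interferenceExponent lam η p.1 p.2 := by
  have h2 : Measurable fun q : (ℝ × ℝ) × ℝ => fadingFactor η q.1.1 q.2 :=
    (measurable_fadingFactor (η := η)).comp (by fun_prop : Measurable fun q : (ℝ × ℝ) × ℝ =>
      (q.1.1, q.2))
  have h3 : Measurable ({q : (ℝ × ℝ) × ℝ | q.1.2 < q.2}.indicator fun q =>
      2 * Real.pi * lam * q.2 * (1 - fadingFactor η q.1.1 q.2)) :=
    Measurable.indicator (by fun_prop) (measurableSet_lt (by fun_prop) (by fun_prop))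
  have h4 := (h3.stronglyMeasurable.integral_prod_right' (ν := (volume : Measure ℝ))).measurable
  convert h4 using 2 with p
  rw [interferenceExponent, ← integral_indicator measurableSet_Ioi]
  rfl

/-- The Laplace functional of the interference is a fixed point of the averaging over the next
point. -/
lemma lintegral_fadingFactor_mul_exp (hlam : 0 < lam) (hη : 2 < η) (ha : 0 ≤ a) (hr : 0 < r) :
    ∫⁻ u in Ioi r, ENNReal.ofReal (fadingFactor η a u *
        Real.exp (-interferenceExponent lam η a u) *
        Real.exp (meanCount lam r - meanCount lam u)) ∂radialIntensity lam =
      ENNReal.ofReal (Real.exp (-interferenceExponent lam η a r)) := by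
  have h2 : Measurable fun u => fadingFactor η a u := (measurable_fadingFactor (η := η)).comp
      ((measurable_const (a := a)).prodMk (measurable_id (α := ℝ)))
  have h3 : Measurable fun u => interferenceExponent lam η a u :=
    (measurable_interferenceExponent (η := η)).comp
      ((measurable_const (a := a)).prodMk (measurable_id (α := ℝ)))
  -- The integrand against the intensity is an exact derivative: Λ contributes the rate 2πλu and J
  -- contributes -2πλu(1 - φ), so only the rate 2πλu φ survives.
  have hder : ∀ u, 0 < u → HasDerivAt
      (fun u => Real.exp (meanCount lam r - meanCount lam u - interferenceExponent lam η a u))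
      (-(2 * Real.pi * lam * u * (fadingFactor η a u *
        Real.exp (-interferenceExponent lam η a u) *
        Real.exp (meanCount lam r - meanCount lam u)))) u := by
    intro u hu
    have := (((hasDerivAt_meanCount (lam := lam) hu).const_sub (meanCount lam r)).fun_sub
      (hasDerivAt_interferenceExponent hlam.le hη ha hu)).exp
    refine this.congr_deriv ?_
    rw [sub_eq_add_neg _ (interferenceExponent lam η a u), Real.exp_add]
    ring
  rw [setLIntegral_radialIntensity_of_hasDerivAt hlam hr.le (by fun_prop)
    (hder r hr).continuousAt.continuousWithinAt (fun u hu => hder u (hr.trans hu)) ?_ ?_]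
  · simp
  · intro u hu
    have := fadingFactor_pos (η := η) ha (hr.trans hu).le
    positivity
  · have h4 := (tendsto_exp_neg_meanCount hlam).mul
      ((tendsto_interferenceExponent hlam.le hη ha).neg.rexp)
    have h5 := h4.const_mul (Real.exp (meanCount lam r))
    simp only [zero_mul, mul_zero] at h5
    refine h5.congr fun u => ?_
    rw [← Real.exp_add, ← Real.exp_add]
    congr 1; ring

variable {Ω : Type*} [MeasurableSpace Ω] {μ : Measure Ω} {X : ℕ → Ω → Plane}

/-- Averaging over the next distance given the earlier ones absorbs one fading factor, by the fixed
point property. The parameter `b` may depend on the earlier distances, because it stays constant in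
this average. -/
lemma IsHomogeneousPPP.lintegral_step [IsProbabilityMeasure μ] (hX : IsHomogeneousPPP μ lam X)
    (hlam : 0 < lam) (hord : ∀ᵐ ω ∂μ, Monotone fun i => ‖X i ω‖) (hη : 2 < η) {n : ℕ}
    {W : (Fin (n + 1) → ℝ) → ℝ≥0∞} (hW : Measurable W) {b : (Fin (n + 1) → ℝ) → ℝ}
    (hb : Measurable b) (hb0 : ∀ r, 0 ≤ b r) :
    ∫⁻ ω, W (firstNorms X n ω) *
      ENNReal.ofReal (fadingFactor η (b (firstNorms X n ω)) ‖X (n + 1) ω‖) *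
      ENNReal.ofReal (Real.exp (-interferenceExponent lam η (b (firstNorms X n ω))
        ‖X (n + 1) ω‖)) ∂μ =
    ∫⁻ ω, W (firstNorms X n ω) *
      ENNReal.ofReal (Real.exp (-interferenceExponent lam η (b (firstNorms X n ω)) ‖X n ω‖)) ∂μ := by
  have hinit : Measurable fun r : Fin (n + 2) → ℝ => (Fin.init r : Fin (n + 1) → ℝ) :=
    measurable_pi_iff.2 fun j => measurable_pi_apply _
  have hbi := hb.comp hinit
  have hm : Measurable fun r : Fin (n + 2) → ℝ => W (Fin.init r) *
      ENNReal.ofReal (fadingFactor η (b (Fin.init r)) (r (Fin.last (n + 1)))) *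
      ENNReal.ofReal (Real.exp (-interferenceExponent lam η (b (Fin.init r))
        (r (Fin.last (n + 1))))) :=
    ((hW.comp hinit).mul (measurable_fadingFactor.comp
      (hbi.prodMk (measurable_pi_apply _))).ennreal_ofReal).mul
      (measurable_interferenceExponent.comp
      (hbi.prodMk (measurable_pi_apply _))).neg.exp.ennreal_ofReal
  have hm' : Measurable fun r : Fin (n + 1) → ℝ => W r *
      ENNReal.ofReal (Real.exp (-interferenceExponent lam η (b r) (r (Fin.last n)))) :=
    hW.mul (measurable_interferenceExponent.comp
      (hb.prodMk (measurable_pi_apply _))).neg.exp.ennreal_ofReal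
  refine (hX.lintegral_firstNorms hlam hord hm).trans (Eq.trans ?_
    (hX.lintegral_firstNorms hlam hord hm').symm)
  rw [lintegral_tupleLaw_succ hm]
  refine lintegral_congr_ae ?_
  filter_upwards [ae_tupleLaw_mem n] with r hr
  have hr0 := pos_of_mem_increasingTuples hr (Fin.last n)
  simp only [nextAverage, Fin.init_snoc, Fin.snoc_last]
  rw [← lintegral_fadingFactor_mul_exp hlam hη (hb0 r) hr0, ← lintegral_const_mul]
  · refine setLIntegral_congr_fun measurableSet_Ioi fun u hu => ?_
    have := (fadingFactor_pos (η := η) (hb0 r) (hr0.trans hu).le).le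
    rw [mul_assoc, mul_assoc, ENNReal.ofReal_mul (by positivity), ENNReal.ofReal_mul this, mul_assoc]
  · have h1 := measurable_fadingFactor (η := η)
    have h2 := measurable_interferenceExponent (lam := lam) (η := η)
    have h3 := h1.comp ((measurable_const (a := b r)).prodMk (measurable_id (α := ℝ)))
    have h4 := h2.comp ((measurable_const (a := b r)).prodMk (measurable_id (α := ℝ)))
    exact ((h3.mul h4.neg.exp).mul (by fun_prop)).ennreal_ofReal

/-- The partial product `f m` times the correction `g m` = exp(-J) has an integral independent of
`m`, by `lintegral_step`. Since `g m` tends to one almost surely, dominated convergence shows that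
the integrals of `f m` and of `f m * g m` have the same limit, which is the value at `m = 0`. -/
theorem IsHomogeneousPPP.tendsto_lintegral_prod_fadingFactor [IsProbabilityMeasure μ]
    (hX : IsHomogeneousPPP μ lam X) (hlam : 0 < lam)
    (hord : ∀ᵐ ω ∂μ, Monotone fun i => ‖X i ω‖) (hη : 2 < η) {k : ℕ}
    {F : (Fin (k + 1) → ℝ) → ℝ≥0∞} (hF : Measurable F) (hF1 : ∀ r, F r ≤ 1)
    {b : (Fin (k + 1) → ℝ) → ℝ} (hb : Measurable b) (hb0 : ∀ r, 0 ≤ b r) :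
    Filter.Tendsto (fun m => ∫⁻ ω, F (firstNorms X k ω) *
      ∏ j ∈ Finset.range m, ENNReal.ofReal
        (fadingFactor η (b (firstNorms X k ω)) ‖X (k + 1 + j) ω‖) ∂μ) Filter.atTop
      (nhds (∫⁻ ω, F (firstNorms X k ω) * ENNReal.ofReal
        (Real.exp (-interferenceExponent lam η (b (firstNorms X k ω)) ‖X k ω‖)) ∂μ)) := by
  set f : ℕ → Ω → ℝ≥0∞ := fun m ω => F (firstNorms X k ω) *
      ∏ j ∈ Finset.range m, ENNReal.ofReal
        (fadingFactor η (b (firstNorms X k ω)) ‖X (k + 1 + j) ω‖) with hf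
  set g : ℕ → Ω → ℝ≥0∞ := fun m ω => ENNReal.ofReal
        (Real.exp (-interferenceExponent lam η (b (firstNorms X k ω)) ‖X (k + m) ω‖)) with hg
  have hfirst := hX.measurable_firstNorms k
  have hfm : ∀ m, Measurable (f m) := by
    intro m
    refine (hF.comp hfirst).mul (Finset.measurable_prod _ fun j _ => ?_)
    exact (measurable_fadingFactor.comp
      ((hb.comp hfirst).prodMk (hX.measurable _).norm)).ennreal_ofReal
  have hgm : ∀ m, Measurable (g m) := fun m => (measurable_interferenceExponent.comp
      ((hb.comp hfirst).prodMk (hX.measurable _).norm)).neg.exp.ennreal_ofReal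
  have hconst : ∀ m, ∫⁻ ω, f m ω * g m ω ∂μ = ∫⁻ ω, f 0 ω * g 0 ω ∂μ := by
    intro m
    induction m with
    | zero => rfl
    | succ m ih =>
      rw [← ih]
      -- `F` and `b` see only the first `k + 1` distances; `tr` forgets the others, so that the
      -- one-step lemma applies at length `k + m + 1`.
      let tr : (Fin (k + m + 1) → ℝ) → Fin (k + 1) → ℝ := fun r j => r ⟨j, by omega⟩
      have htr : Measurable tr := measurable_pi_iff.2 fun j => measurable_pi_apply _
      let W : (Fin (k + m + 1) → ℝ) → ℝ≥0∞ := fun r => F (tr r) *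
        ∏ j : Fin m, ENNReal.ofReal (fadingFactor η (b (tr r)) (r ⟨k + 1 + j, by omega⟩))
      have hW : Measurable W := by
        refine (hF.comp htr).mul (Finset.measurable_prod _ fun j _ => ?_)
        exact (measurable_fadingFactor.comp
          ((hb.comp htr).prodMk (measurable_pi_apply _))).ennreal_ofReal
      have hstep := hX.lintegral_step hlam hord hη hW (hb.comp htr) (fun r => hb0 _)
      have e1 : ∀ ω, tr (firstNorms X (k + m) ω) = firstNorms X k ω := fun ω => rfl
      have e2 : ∀ ω, W (firstNorms X (k + m) ω) = f m ω := by
        intro ω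
        simp only [W, e1, hf]
        rw [Finset.prod_range]
        rfl
      simp only [e2, Function.comp_apply, e1] at hstep
      refine Eq.trans ?_ hstep
      refine lintegral_congr fun ω => ?_
      simp only [hf, hg]
      rw [Finset.prod_range_succ, ← mul_assoc, show k + 1 + m = k + m + 1 by ring]
      rfl
  have hle : ∀ m ω, f m ω ≤ 1 := by
    intro m ω
    refine mul_le_one' (hF1 _) (Finset.prod_le_one' fun j _ => ?_)
    exact ENNReal.ofReal_le_one.2 (fadingFactor_le_one (hb0 _) (norm_nonneg _))
  have hgle : ∀ m ω, g m ω ≤ 1 := by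
    intro m ω
    refine ENNReal.ofReal_le_one.2 (Real.exp_le_one_iff.2 ?_)
    have := interferenceExponent_nonneg (η := η) hlam.le (hb0 (firstNorms X k ω))
      (norm_nonneg (X (k + m) ω))
    linarith
  have hanti : ∀ ω, Antitone fun m => f m ω := by
    intro ω
    refine antitone_nat_of_succ_le fun m => ?_
    simp only [hf]
    rw [Finset.prod_range_succ, ← mul_assoc]
    exact mul_le_of_le_one_right' (ENNReal.ofReal_le_one.2
      (fadingFactor_le_one (hb0 _) (norm_nonneg _)))
  -- Every factor is at most one, so the partial products decrease and have a pointwise limit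
  -- without any convergence argument.
  have hlim : ∀ ω, Filter.Tendsto (fun m => f m ω) Filter.atTop (nhds (⨅ m, f m ω)) :=
    fun ω => tendsto_atTop_iInf (hanti ω)
  have h1 : Filter.Tendsto (fun m => ∫⁻ ω, f m ω ∂μ) Filter.atTop
      (nhds (∫⁻ ω, ⨅ m, f m ω ∂μ)) :=
    tendsto_lintegral_of_dominated_convergence (fun _ => 1) hfm
      (fun m => Filter.Eventually.of_forall (hle m)) (by simp)
      (Filter.Eventually.of_forall hlim)
  have h2 : Filter.Tendsto (fun m => ∫⁻ ω, f m ω * g m ω ∂μ) Filter.atTop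
      (nhds (∫⁻ ω, ⨅ m, f m ω ∂μ)) := by
    refine tendsto_lintegral_of_dominated_convergence (fun _ => 1)
      (fun m => (hfm m).mul (hgm m))
      (fun m => Filter.Eventually.of_forall fun ω => mul_le_one' (hle m ω) (hgle m ω)) (by simp) ?_
    filter_upwards [hX.ae_tendsto_norm] with ω hω
    have hg1 : Filter.Tendsto (fun m => g m ω) Filter.atTop (nhds 1) := by
      have h3 := ((tendsto_interferenceExponent hlam.le hη (hb0 (firstNorms X k ω))).comp
        (hω.comp (Filter.tendsto_add_atTop_nat k))).neg.rexp
      rw [neg_zero, Real.exp_zero] at h3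
      have h4 := ENNReal.tendsto_ofReal h3
      rw [ENNReal.ofReal_one] at h4
      refine h4.congr fun m => ?_
      simp only [hg, Function.comp_apply, add_comm k m]
    have := ENNReal.Tendsto.mul (hlim ω) (Or.inr ENNReal.one_ne_top) hg1
      (Or.inr (ne_top_of_le_ne_top ENNReal.one_ne_top ((iInf_le _ 0).trans (hle 0 ω))))
    rwa [mul_one] at this
  simp only [hconst] at h2
  have h5 := tendsto_nhds_unique h2 tendsto_const_nhds
  rw [h5] at h1
  simpa [hf, hg] using h1

end Interference

/-! ### Complex Gaussian fading and exponential power -/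

section Gaussian

lemma gaussianPDF_mul_gaussianPDF_half (x y : ℝ) :
    gaussianPDF 0 (1 / 2) x * gaussianPDF 0 (1 / 2) y =
      ENNReal.ofReal (Real.pi⁻¹ * Real.exp (-(x ^ 2 + y ^ 2))) := by
  rw [gaussianPDF, gaussianPDF, ← ENNReal.ofReal_mul (gaussianPDFReal_nonneg _ _ _)]
  congr 1
  have hpi := Real.pi_pos
  rw [gaussianPDFReal, gaussianPDFReal]
  have h1 : (2 : ℝ) * Real.pi * ((1 / 2 : ℝ≥0) : ℝ) = Real.pi := by push_cast; ring
  have h2 : (2 : ℝ) * ((1 / 2 : ℝ≥0) : ℝ) = 1 := by push_cast; ring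
  rw [h1, h2, mul_mul_mul_comm, ← Real.exp_add, ← mul_inv, Real.mul_self_sqrt hpi.le]
  congr 2
  ring

/-- Polar coordinates: the Gaussian density π⁻¹ exp(-r²) is radial, and the angle integrates to 2π.
-/
lemma lintegral_stdComplexGaussian_normSq {f : ℝ → ℝ≥0∞} (hf : Measurable f) :
    ∫⁻ z, f (‖z‖ ^ 2) ∂stdComplexGaussian =
      ∫⁻ r in Ioi 0, ENNReal.ofReal (2 * r * Real.exp (-r ^ 2)) * f (r ^ 2) := by
  have hpi := Real.pi_pos
  have hnorm : ∀ p : ℝ × ℝ, ‖Complex.measurableEquivRealProd.symm p‖ ^ 2 = p.1 ^ 2 + p.2 ^ 2 := by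
    intro p
    rw [Complex.sq_norm, Complex.normSq_apply]
    simp [Complex.measurableEquivRealProd_symm_apply]
    ring
  have hpdf : Measurable (gaussianPDF 0 (1 / 2)) := measurable_gaussianPDF _ _
  rw [stdComplexGaussian, lintegral_map_equiv, gaussianReal_of_var_ne_zero _ (by norm_num),
    prod_withDensity hpdf hpdf, lintegral_withDensity_eq_lintegral_mul _ (by fun_prop)
    (by fun_prop)]
  simp only [Pi.mul_apply, hnorm, gaussianPDF_mul_gaussianPDF_half]
  rw [← Measure.volume_eq_prod, ← lintegral_comp_polarCoord_symm]
  have hsq : ∀ p : ℝ × ℝ, (polarCoord.symm p).1 ^ 2 + (polarCoord.symm p).2 ^ 2 = p.1 ^ 2 := by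
    intro p
    simp only [polarCoord_symm_apply]
    linear_combination p.1 ^ 2 * Real.cos_sq_add_sin_sq p.2
  simp only [hsq, smul_eq_mul]
  rw [polarCoord_target, Measure.volume_eq_prod, ← Measure.prod_restrict,
    lintegral_prod _ (by fun_prop)]
  refine setLIntegral_congr_fun measurableSet_Ioi fun r hr => ?_
  have hr0 : (0 : ℝ) < r := hr
  simp only [lintegral_const, Measure.restrict_apply_univ, Real.volume_Ioo]
  rw [mul_comm, ← mul_assoc, ← mul_assoc, ← ENNReal.ofReal_mul (by linarith),
    ← ENNReal.ofReal_mul (by nlinarith)]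
  congr 2
  field_simp
  ring

lemma lintegral_mul_exp_neg_mul_sq {c b : ℝ} (hc : 0 < c) (hb : 0 ≤ b) :
    ∫⁻ r in Ioi b, ENNReal.ofReal (2 * r * Real.exp (-c * r ^ 2)) =
      ENNReal.ofReal (Real.exp (-c * b ^ 2) / c) := by
  have hder : ∀ r ∈ Ioi b, HasDerivAt (fun r => -(Real.exp (-c * r ^ 2) / c))
      (2 * r * Real.exp (-c * r ^ 2)) r := by
    intro r _
    have h := ((((hasDerivAt_pow 2 r).const_mul (-c)).exp).div_const c).fun_neg
    refine h.congr_deriv ?_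
    field_simp
    push_cast
    ring
  have hpos : ∀ r ∈ Ioi b, 0 ≤ 2 * r * Real.exp (-c * r ^ 2) := by
    intro r hr
    have : 0 < r := hb.trans_lt hr
    positivity
  have hlim : Filter.Tendsto (fun r : ℝ => -(Real.exp (-c * r ^ 2) / c)) Filter.atTop (nhds 0) := by
    have h1 : Filter.Tendsto (fun r : ℝ => c * r ^ 2) Filter.atTop Filter.atTop :=
      (Filter.tendsto_pow_atTop two_ne_zero).const_mul_atTop hc
    have h2 := ((Real.tendsto_exp_neg_atTop_nhds_zero.comp h1).div_const c).neg
    rw [zero_div, neg_zero] at h2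
    refine h2.congr fun r => ?_
    simp
  have hcont : ContinuousWithinAt (fun r : ℝ => -(Real.exp (-c * r ^ 2) / c)) (Ici b) b :=
    Continuous.continuousWithinAt (by fun_prop)
  have hint := integrableOn_Ioi_deriv_of_nonneg hcont hder hpos hlim
  have hval := integral_Ioi_of_hasDerivAt_of_tendsto hcont hder hint hlim
  rw [sub_neg_eq_add, zero_add] at hval
  rw [← hval, ofReal_integral_eq_lintegral_ofReal hint
    ((ae_restrict_iff' measurableSet_Ioi).2 (Filter.Eventually.of_forall hpos))]

lemma stdComplexGaussian_normSq_gt {y : ℝ} (hy : 0 ≤ y) :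
    stdComplexGaussian {z | y < ‖z‖ ^ 2} = ENNReal.ofReal (Real.exp (-y)) := by
  have hm : MeasurableSet {z : ℂ | y < ‖z‖ ^ 2} := measurableSet_lt (by fun_prop) (by fun_prop)
  have h := lintegral_stdComplexGaussian_normSq (f := (Ioi y).indicator 1)
    (measurable_one.indicator measurableSet_Ioi)
  have h1 : ∫⁻ z, (Ioi y).indicator 1 (‖z‖ ^ 2) ∂stdComplexGaussian =
      stdComplexGaussian {z | y < ‖z‖ ^ 2} := by
    rw [← lintegral_indicator_one hm]
    rfl
  have h2 := lintegral_mul_exp_neg_mul_sq one_pos (Real.sqrt_nonneg y)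
  rw [Real.sq_sqrt hy] at h2
  simp only [neg_mul, one_mul, div_one] at h2
  rw [← h1, h, ← h2, ← lintegral_indicator measurableSet_Ioi, ← lintegral_indicator measurableSet_Ioi]
  refine lintegral_congr fun r => ?_
  by_cases hr : √y < r
  · have h0 : 0 < r := (Real.sqrt_nonneg y).trans_lt hr
    have h3 : y < r ^ 2 := (Real.sqrt_lt' h0).1 hr
    simp [h0, h3, hr]
  · rw [indicator_of_notMem (show r ∉ Ioi √y from hr)]
    by_cases h0 : 0 < r
    · have h3 : ¬ y < r ^ 2 := fun h => hr ((Real.sqrt_lt' h0).2 h)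
      simp [h0, h3]
    · simp [h0]

lemma lintegral_stdComplexGaussian_exp_neg {s : ℝ} (hs : 0 ≤ s) :
    ∫⁻ z, ENNReal.ofReal (Real.exp (-(s * ‖z‖ ^ 2))) ∂stdComplexGaussian =
      ENNReal.ofReal (1 + s)⁻¹ := by
  rw [lintegral_stdComplexGaussian_normSq (f := fun v => ENNReal.ofReal (Real.exp (-(s * v))))
    (by fun_prop)]
  have h2 := lintegral_mul_exp_neg_mul_sq (c := 1 + s) (by linarith) le_rfl
  rw [zero_pow two_ne_zero, mul_zero, Real.exp_zero, one_div] at h2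
  rw [← h2]
  refine setLIntegral_congr_fun measurableSet_Ioi fun r hr => ?_
  have hr0 : (0 : ℝ) < r := hr
  rw [← ENNReal.ofReal_mul (by positivity), mul_assoc, ← Real.exp_add]
  congr 3
  ring

instance : IsProbabilityMeasure stdComplexGaussian := by
  unfold stdComplexGaussian
  exact Measure.isProbabilityMeasure_map (by fun_prop)

/-- The denominator 4 comes from the variance 1/2 of each real component. -/
lemma charFun_stdComplexGaussian (t : ℂ) :
    charFun stdComplexGaussian t = Complex.exp (-(‖t‖ ^ 2 : ℝ) / 4) := by
  rw [charFun_apply, stdComplexGaussian, integral_map_equiv]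
  have h : ∀ p : ℝ × ℝ, Complex.exp ((inner ℝ (Complex.measurableEquivRealProd.symm p) t : ℝ) *
      Complex.I) = Complex.exp (p.1 * t.re * Complex.I) * Complex.exp (p.2 * t.im * Complex.I) := by
    intro p
    rw [← Complex.exp_add]
    congr 1
    rw [Complex.inner]
    simp [Complex.measurableEquivRealProd_symm_apply]
    ring
  simp only [h]
  rw [integral_prod_mul (fun x : ℝ => Complex.exp (x * t.re * Complex.I))
    (fun x : ℝ => Complex.exp (x * t.im * Complex.I))]
  have h1 : ∀ u : ℝ, ∫ x : ℝ, Complex.exp (x * u * Complex.I) ∂gaussianReal 0 (1 / 2) =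
      Complex.exp (-(u : ℂ) ^ 2 / 4) := by
    intro u
    have := charFun_gaussianReal (μ := 0) (v := 1 / 2) u
    rw [charFun_apply_real] at this
    refine Eq.trans ?_ (this.trans ?_)
    · congr 1
      ext x
      congr 2
      ring
    · congr 1
      push_cast
      ring
  rw [h1, h1, ← Complex.exp_add, Complex.sq_norm, Complex.normSq_apply]
  congr 1
  push_cast
  ring

variable {Ω : Type*} [MeasurableSpace Ω] {μ : Measure Ω} [IsProbabilityMeasure μ]

/-- Characteristic functions multiply under independence, so the exponents add and α², β² combine
into α² + β². This is why the non-coherent sum is again Rayleigh. -/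
lemma map_add_stdComplexGaussian {g₁ g₂ : Ω → ℂ} (hm₁ : Measurable g₁) (hm₂ : Measurable g₂)
    (h₁ : μ.map g₁ = stdComplexGaussian) (h₂ : μ.map g₂ = stdComplexGaussian)
    (hi : IndepFun g₁ g₂ μ) (α β : ℝ) :
    μ.map (fun ω => (α : ℂ) * g₁ ω + (β : ℂ) * g₂ ω) =
      stdComplexGaussian.map (fun z => √(α ^ 2 + β ^ 2) • z) := by
  have : IsProbabilityMeasure (stdComplexGaussian.map (fun z : ℂ => √(α ^ 2 + β ^ 2) • z)) :=
    Measure.isProbabilityMeasure_map (by fun_prop)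
  have : IsProbabilityMeasure (μ.map (fun ω => (α : ℂ) * g₁ ω + (β : ℂ) * g₂ ω)) :=
    Measure.isProbabilityMeasure_map (by fun_prop)
  refine Measure.ext_of_charFun (funext fun t => ?_)
  have hadd := IndepFun.charFun_map_add_eq_mul (P := μ)
    (X := fun ω => α • g₁ ω) (Y := fun ω => β • g₂ ω)
    (by fun_prop) (by fun_prop)
    (hi.comp (φ := fun z : ℂ => α • z) (ψ := fun z : ℂ => β • z) (by fun_prop) (by fun_prop))
  have e1 : μ.map (fun ω => α • g₁ ω) = stdComplexGaussian.map (fun z => α • z) := by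
    rw [← h₁, Measure.map_map (by fun_prop) hm₁]; rfl
  have e2 : μ.map (fun ω => β • g₂ ω) = stdComplexGaussian.map (fun z => β • z) := by
    rw [← h₂, Measure.map_map (by fun_prop) hm₂]; rfl
  have e3 : (fun ω => (α : ℂ) * g₁ ω + (β : ℂ) * g₂ ω) =
      (fun ω => α • g₁ ω) + fun ω => β • g₂ ω := by
    funext ω
    simp
  rw [e3, hadd, e1, e2, Pi.mul_apply, charFun_map_smul, charFun_map_smul, charFun_map_smul,
    charFun_stdComplexGaussian, charFun_stdComplexGaussian, charFun_stdComplexGaussian,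
    ← Complex.exp_add]
  congr 1
  simp only [norm_smul, Real.norm_eq_abs, mul_pow, sq_abs, Real.sq_sqrt (by positivity : 0 ≤ α ^ 2 + β ^ 2)]
  push_cast
  ring

lemma measure_normSq_add_gt {g₁ g₂ : Ω → ℂ} (hm₁ : Measurable g₁) (hm₂ : Measurable g₂)
    (h₁ : μ.map g₁ = stdComplexGaussian) (h₂ : μ.map g₂ = stdComplexGaussian)
    (hi : IndepFun g₁ g₂ μ) {α β y : ℝ} (hα : 0 < α) (hy : 0 ≤ y) :
    μ {ω | y < ‖(α : ℂ) * g₁ ω + (β : ℂ) * g₂ ω‖ ^ 2} =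
      ENNReal.ofReal (Real.exp (-(y / (α ^ 2 + β ^ 2)))) := by
  have hm : MeasurableSet {z : ℂ | y < ‖z‖ ^ 2} := measurableSet_lt (by fun_prop) (by fun_prop)
  have hpos : 0 < α ^ 2 + β ^ 2 := by positivity
  have h3 : μ {ω | y < ‖(α : ℂ) * g₁ ω + (β : ℂ) * g₂ ω‖ ^ 2} =
      μ.map (fun ω => (α : ℂ) * g₁ ω + (β : ℂ) * g₂ ω) {z : ℂ | y < ‖z‖ ^ 2} := by
    rw [Measure.map_apply (by fun_prop) hm]; rfl
  rw [h3, map_add_stdComplexGaussian hm₁ hm₂ h₁ h₂ hi, Measure.map_apply (by fun_prop) hm,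
    ← stdComplexGaussian_normSq_gt (by positivity)]
  congr 1
  ext z
  simp only [mem_preimage, mem_ofPred_eq, norm_smul, mul_pow, Real.norm_eq_abs, sq_abs,
    Real.sq_sqrt hpos.le]
  rw [div_lt_iff₀' hpos]

end Gaussian

/-! ### The negative exponential on extended nonnegative reals -/

section ExpNeg

/-- `exp (-z)`, with value `0` at `∞`. -/
noncomputable def expNeg (z : ℝ≥0∞) : ℝ≥0∞ := EReal.exp (-(z : EReal))

lemma continuous_expNeg : Continuous expNeg :=
  ENNReal.continuous_exp.comp (continuous_neg.comp continuous_coe_ennreal_ereal)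

@[fun_prop]
lemma measurable_expNeg : Measurable expNeg := continuous_expNeg.measurable

lemma expNeg_ofReal {x : ℝ} (hx : 0 ≤ x) :
    expNeg (ENNReal.ofReal x) = ENNReal.ofReal (Real.exp (-x)) := by
  rw [expNeg, EReal.coe_ennreal_ofReal, max_eq_left hx, ← EReal.coe_neg, EReal.exp_coe]

lemma expNeg_top : expNeg ∞ = 0 := by simp [expNeg]

lemma expNeg_add (x y : ℝ≥0∞) : expNeg (x + y) = expNeg x * expNeg y := by
  rw [expNeg, expNeg, expNeg, ← EReal.exp_add, EReal.coe_ennreal_add, EReal.neg_add]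
  · rfl
  · exact Or.inl (EReal.coe_ennreal_ne_bot x)
  · exact Or.inr (EReal.coe_ennreal_ne_bot y)

lemma expNeg_zero : expNeg 0 = 1 := by simp [expNeg]

lemma expNeg_sum {ι : Type*} (s : Finset ι) (f : ι → ℝ≥0∞) :
    expNeg (∑ i ∈ s, f i) = ∏ i ∈ s, expNeg (f i) := by
  induction s using Finset.cons_induction with
  | empty => simp [expNeg_zero]
  | cons j s hj ih => rw [Finset.sum_cons, Finset.prod_cons, expNeg_add, ih]

lemma expNeg_le_one (z : ℝ≥0∞) : expNeg z ≤ 1 := by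
  rcases eq_or_ne z ∞ with rfl | hz
  · simp [expNeg_top]
  · rw [← ENNReal.ofReal_toReal hz, expNeg_ofReal ENNReal.toReal_nonneg]
    exact ENNReal.ofReal_le_one.2 (Real.exp_le_one_iff.2 (by simp))

end ExpNeg

/-! ### Conditioning on independent variables -/

section Independence

variable {Ω α β : Type*} [MeasurableSpace Ω] [MeasurableSpace α] [MeasurableSpace β]
  {μ : Measure Ω} [IsProbabilityMeasure μ]

lemma ProbabilityTheory.IndepFun.measure_mem_eq_lintegral {A : Ω → α} {B : Ω → β}
    (h : IndepFun A B μ) (hA : Measurable A) (hB : Measurable B) {S : Set (β × α)}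
    (hS : MeasurableSet S) :
    μ {ω | (B ω, A ω) ∈ S} = ∫⁻ ω, μ {ω' | (B ω, A ω') ∈ S} ∂μ := by
  have h1 := (indepFun_iff_map_prod_eq_prod_map_map hB.aemeasurable hA.aemeasurable).1 h.symm
  have h2 : μ {ω | (B ω, A ω) ∈ S} = μ.map (fun ω => (B ω, A ω)) S := by
    rw [Measure.map_apply (hB.prodMk hA) hS]; rfl
  have : IsProbabilityMeasure (μ.map A) := Measure.isProbabilityMeasure_map hA.aemeasurable
  rw [h2, h1, Measure.prod_apply hS, lintegral_map (measurable_measure_prodMk_left hS) hB]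
  refine lintegral_congr fun ω => ?_
  rw [Measure.map_apply hA (measurable_prodMk_left hS)]
  rfl

/-- An exponential variable exceeds an independent variable with probability the Laplace transform
of the latter. -/
lemma measure_mul_lt_ofReal {W : Ω → ℝ} {Z : Ω → ℝ≥0∞} (hW : Measurable W) (hZ : Measurable Z)
    (h : IndepFun W Z μ) {T s : ℝ} (hT : 0 < T) (hs : 0 ≤ s)
    (hlaw : ∀ y, 0 ≤ y → μ {ω | T * y < W ω} = ENNReal.ofReal (Real.exp (-(s * y))))
    (hZs : s = 0 → ∀ ω, Z ω ≠ ∞) :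
    μ {ω | ENNReal.ofReal T * Z ω < ENNReal.ofReal (W ω)} =
      ∫⁻ ω, expNeg (ENNReal.ofReal s * Z ω) ∂μ := by
  have hS : MeasurableSet {p : ℝ≥0∞ × ℝ | ENNReal.ofReal T * p.1 < ENNReal.ofReal p.2} :=
    measurableSet_lt (by fun_prop) (by fun_prop)
  refine (h.measure_mem_eq_lintegral hW hZ hS).trans (lintegral_congr fun ω => ?_)
  simp only [mem_ofPred_eq]
  -- When `Z ω = ∞` both sides are zero provided s > 0; for s = 0 the right side would be one, which
  -- is why `hZs` rules this case out.
  rcases eq_or_ne (Z ω) ∞ with hz | hz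
  · have hs' : s ≠ 0 := fun h0 => hZs h0 ω hz
    have hs0 : 0 < s := lt_of_le_of_ne hs hs'.symm
    rw [hz, ENNReal.mul_top (by simpa using hT), ENNReal.mul_top (by simpa using hs0), expNeg_top]
    simp
  · rw [← ENNReal.ofReal_toReal hz, ← ENNReal.ofReal_mul hT.le, ← ENNReal.ofReal_mul hs,
      expNeg_ofReal (mul_nonneg hs ENNReal.toReal_nonneg), ← hlaw _ ENNReal.toReal_nonneg]
    congr 1
    ext ω'
    simp only [mem_ofPred_eq]
    exact ENNReal.ofReal_lt_ofReal_iff_of_nonneg (by positivity)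

/-- Independence of the two infinite families is tested on finite subfamilies. It is needed in this
form because the interference depends on infinitely many coefficients. -/
lemma ProbabilityTheory.iIndepFun.indepFun_compl {E : Type*} [MeasurableSpace E] {g : ℕ → Ω → E}
    (hg : iIndepFun g μ) (hm : ∀ i, Measurable (g i)) (J : Set ℕ) :
    IndepFun (fun ω (i : J) => g i ω) (fun ω (i : (Jᶜ : Set ℕ)) => g i ω) μ := by
  refine IndepFun.process_indepFun_process (X := fun i : J => g i)
    (Y := fun i : (Jᶜ : Set ℕ) => g i) (fun i => hm i) (fun i => hm i) fun I K => ?_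
  have hdisj : Disjoint (I.map (Function.Embedding.subtype _))
      (K.map (Function.Embedding.subtype _)) := by
    rw [Finset.disjoint_left]
    intro i hi hk
    simp only [Finset.mem_map, Function.Embedding.subtype_apply] at hi hk
    obtain ⟨a, _, rfl⟩ := hi
    obtain ⟨b, _, hb⟩ := hk
    exact b.2 (hb ▸ a.2)
  have h := hg.indepFun_finset _ _ hdisj hm
  exact h.comp
    (φ := fun f (i : I) => f ⟨i, Finset.mem_map.2 ⟨i, i.2, rfl⟩⟩)
    (ψ := fun f (i : K) => f ⟨i, Finset.mem_map.2 ⟨i, i.2, rfl⟩⟩)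
    (measurable_pi_iff.2 fun i => measurable_pi_apply _)
    (measurable_pi_iff.2 fun i => measurable_pi_apply _)

end Independence

/-! ### Laplace transform of the interference for fixed positions -/

section Conditional

/-- Positions and channel coefficients. -/
abbrev Config : Type := (ℕ → Plane) × (ℕ → ℂ)

/-- Position of the `i`-th BS of a configuration. -/
def Config.pos (i : ℕ) (p : Config) : Plane := p.1 i

/-- Channel coefficient of the `i`-th BS of a configuration. -/
def Config.chan (i : ℕ) (p : Config) : ℂ := p.2 i

@[fun_prop]
lemma Config.measurable_pos (i : ℕ) : Measurable (Config.pos i) :=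
  (measurable_pi_apply i).comp measurable_fst

@[fun_prop]
lemma Config.measurable_chan (i : ℕ) : Measurable (Config.chan i) :=
  (measurable_pi_apply i).comp measurable_snd

@[fun_prop]
lemma measurable_rxPower (P η : ℝ) (i : ℕ) :
    Measurable (rxPower P η Config.pos Config.chan i) := by
  unfold rxPower; fun_prop

/-- Interference plus noise, when the BSs in `S` and those after the `k`-th interfere. -/
noncomputable def interferencePlusNoise (P η σ : ℝ) {k : ℕ} (S : Finset (Fin (k + 1)))
    (p : Config) : ℝ≥0∞ :=
  ∑ i ∈ S, rxPower P η Config.pos Config.chan i p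
    + interferenceFrom (k + 1) P η Config.pos Config.chan p + ENNReal.ofReal (σ ^ 2)

lemma measurable_interferencePlusNoise (P η σ : ℝ) {k : ℕ} (S : Finset (Fin (k + 1))) :
    Measurable (interferencePlusNoise P η σ S) := by
  unfold interferencePlusNoise interferenceFrom
  have := measurable_rxPower P η
  fun_prop

variable {Ω : Type*} [MeasurableSpace Ω] {μ : Measure Ω} {g : ℕ → Ω → ℂ}

lemma lintegral_expNeg_rxPower {P η s : ℝ} (hP : 0 ≤ P) (hs : 0 ≤ s)
    (hm : ∀ i, Measurable (g i)) (hlaw : ∀ i, μ.map (g i) = stdComplexGaussian)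
    (x : ℕ → Plane) (i : ℕ) :
    ∫⁻ ω, expNeg (ENNReal.ofReal s * rxPower P η Config.pos Config.chan i
        (x, fun j => g j ω)) ∂μ = ENNReal.ofReal (fadingFactor η (s * P) ‖x i‖) := by
  have hx := Real.rpow_nonneg (norm_nonneg (x i)) (-η)
  have h1 : ∀ ω, expNeg (ENNReal.ofReal s * rxPower P η Config.pos Config.chan i
      (x, fun j => g j ω)) =
      ENNReal.ofReal (Real.exp (-(s * P * ‖x i‖ ^ (-η) * ‖g i ω‖ ^ 2))) := by
    intro ω
    rw [rxPower, ← ENNReal.ofReal_mul hs]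
    simp only [Config.pos, Config.chan]
    rw [expNeg_ofReal (by positivity)]
    congr 3
    ring
  simp only [h1]
  rw [fadingFactor, ← lintegral_stdComplexGaussian_exp_neg (by positivity), ← hlaw i,
    lintegral_map (by fun_prop) (hm i)]

/-- Truncate to finitely many interferers, where independence gives an exact product, and pass to
the limit by dominated convergence. Continuity of `expNeg` at ∞ allows the interference series to
diverge. -/
lemma tendsto_prod_fadingFactor [IsProbabilityMeasure μ] {P η σ s : ℝ} (hP : 0 ≤ P) (hs : 0 ≤ s)
    (hm : ∀ i, Measurable (g i)) (hlaw : ∀ i, μ.map (g i) = stdComplexGaussian)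
    (hi : iIndepFun g μ) {k : ℕ} (S : Finset (Fin (k + 1))) (x : ℕ → Plane) :
    Filter.Tendsto (fun m => ENNReal.ofReal (Real.exp (-(s * σ ^ 2))) *
        (∏ i ∈ S, ENNReal.ofReal (fadingFactor η (s * P) ‖x i‖)) *
        ∏ j ∈ Finset.range m, ENNReal.ofReal (fadingFactor η (s * P) ‖x (k + 1 + j)‖))
      Filter.atTop (nhds (∫⁻ ω, expNeg (ENNReal.ofReal s *
        interferencePlusNoise P η σ S (x, fun j => g j ω)) ∂μ)) := by
  set rx : ℕ → Ω → ℝ≥0∞ := fun i ω => rxPower P η Config.pos Config.chan i (x, fun j => g j ω)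
    with hrx
  have hrxm : ∀ i, Measurable (rx i) := fun i =>
    (measurable_rxPower P η i).comp (measurable_const.prodMk (measurable_pi_iff.2 hm))
  set D : ℕ → Ω → ℝ≥0∞ := fun m ω => ∑ i ∈ S, rx i ω + ∑ j ∈ Finset.range m, rx (k + 1 + j) ω
    + ENNReal.ofReal (σ ^ 2) with hD
  have hDm : ∀ m, Measurable (D m) := fun m => by fun_prop
  have hval : ∀ m, ∫⁻ ω, expNeg (ENNReal.ofReal s * D m ω) ∂μ =
      ENNReal.ofReal (Real.exp (-(s * σ ^ 2))) *
        (∏ i ∈ S, ENNReal.ofReal (fadingFactor η (s * P) ‖x i‖)) *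
        ∏ j ∈ Finset.range m, ENNReal.ofReal (fadingFactor η (s * P) ‖x (k + 1 + j)‖) := by
    intro m
    -- Near and far interferers are merged into one finite index set, disjoint since `S` only
    -- contains indices at most `k`, so independence is used once.
    let U : Finset ℕ := S.map Fin.valEmbedding ∪ (Finset.range m).map (addLeftEmbedding (k + 1))
    have hdisj : Disjoint (S.map Fin.valEmbedding)
        ((Finset.range m).map (addLeftEmbedding (k + 1))) := by
      rw [Finset.disjoint_left]
      intro i h1 h2
      simp only [Finset.mem_map, Fin.valEmbedding_apply, addLeftEmbedding_apply] at h1 h2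
      obtain ⟨a, _, rfl⟩ := h1
      obtain ⟨b, _, hb⟩ := h2
      omega
    have hprod : ∀ f : ℕ → ℝ≥0∞, ∏ i ∈ U, f i =
        (∏ i ∈ S, f i) * ∏ j ∈ Finset.range m, f (k + 1 + j) := by
      intro f
      rw [Finset.prod_union hdisj, Finset.prod_map, Finset.prod_map]
      rfl
    have h1 : ∀ ω, expNeg (ENNReal.ofReal s * D m ω) =
        ENNReal.ofReal (Real.exp (-(s * σ ^ 2))) *
          ∏ i ∈ U, expNeg (ENNReal.ofReal s * rx i ω) := by
      intro ω
      rw [hprod, hD]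
      simp only
      rw [mul_add, mul_add, expNeg_add, expNeg_add, Finset.mul_sum, Finset.mul_sum, expNeg_sum,
        expNeg_sum, ← ENNReal.ofReal_mul hs, expNeg_ofReal (by positivity), mul_comm]
    have hind : iIndepFun (fun i ω => expNeg (ENNReal.ofReal s * rx i ω)) μ := by
      have h2 := hi.comp (fun i z => expNeg (ENNReal.ofReal s *
        ENNReal.ofReal (P * ‖z‖ ^ 2 * ‖x i‖ ^ (-η)))) (fun i => by fun_prop)
      exact h2
    simp only [h1]
    rw [lintegral_const_mul _ (Finset.measurable_prod _ fun i _ => by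
        have := hrxm i; fun_prop),
      lintegral_prod_eq_prod_lintegral_of_indepFun U _ hind (fun i => by
        have := hrxm i; fun_prop), hprod, mul_assoc]
    simp only [hrx, lintegral_expNeg_rxPower hP hs hm hlaw]
  simp only [← hval]
  refine tendsto_lintegral_of_dominated_convergence (fun _ => 1) (fun m => by
    have := hDm m; fun_prop) (fun m => Filter.Eventually.of_forall fun ω => expNeg_le_one _)
    (by simp) (Filter.Eventually.of_forall fun ω => ?_)
  refine (continuous_expNeg.tendsto _).comp (ENNReal.Tendsto.const_mul ?_
    (Or.inr ENNReal.ofReal_ne_top))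
  refine Filter.Tendsto.add (Filter.Tendsto.add tendsto_const_nhds ?_) tendsto_const_nhds
  exact ENNReal.tendsto_nat_tsum fun j => rx (k + 1 + j) ω

end Conditional

/-! ### The general coverage formula -/

section Coverage

variable {Ω : Type*} [MeasurableSpace Ω] {μ : Measure Ω} [IsProbabilityMeasure μ]
  {X : ℕ → Ω → Plane} {g : ℕ → Ω → ℂ} {lam P η σ T : ℝ}

/-- Coverage probability given the distances `r` of the nearest BSs, when the BSs in `S` and those
beyond the last given one interfere and the signal power has mean `T / s r`. -/
noncomputable def conditionalCoverage (lam P η σ : ℝ) {k : ℕ} (S : Finset (Fin (k + 1)))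
    (s : (Fin (k + 1) → ℝ) → ℝ) (r : Fin (k + 1) → ℝ) : ℝ≥0∞ :=
  ENNReal.ofReal (Real.exp (-(s r * σ ^ 2))) *
    (∏ i ∈ S, ENNReal.ofReal (fadingFactor η (s r * P) (r i))) *
    ENNReal.ofReal (Real.exp (-interferenceExponent lam η (s r * P) (r (Fin.last k))))

lemma measurable_conditionalCoverage {k : ℕ} (S : Finset (Fin (k + 1)))
    {s : (Fin (k + 1) → ℝ) → ℝ} (hs : Measurable s) :
    Measurable (conditionalCoverage lam P η σ S s) := by
  have hsP : Measurable fun r => s r * P := hs.mul_const P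
  refine (Measurable.mul (by fun_prop) (Finset.measurable_prod _ fun i _ => ?_)).mul ?_
  · exact (measurable_fadingFactor.comp (hsP.prodMk (measurable_pi_apply i))).ennreal_ofReal
  · exact (measurable_interferenceExponent.comp
      (hsP.prodMk (measurable_pi_apply _))).neg.exp.ennreal_ofReal

/-- One sequence of expectations of truncated products has two limits: conditioning on the positions
identifies it with the coverage probability, the Markov chain of distances with the integral of
`conditionalCoverage`. The signal enters only through its exponential tail and its independence of
the interference, so all three ways of serving the user are covered. -/
theorem measure_coverage_eq (hlam : 0 < lam) (hP : 0 < P) (hη : 2 < η) (hT : 0 < T)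
    (hX : IsHomogeneousPPP μ lam X) (hord : ∀ᵐ ω ∂μ, Monotone fun i => ‖X i ω‖)
    (hg : IsRayleighFading μ X g) (hgm : ∀ i, Measurable (g i)) {k : ℕ}
    (S : Finset (Fin (k + 1))) {sig : Config → ℝ} (hsig : Measurable sig)
    {s : (Fin (k + 1) → ℝ) → ℝ} (hs : Measurable s) (hs0 : ∀ r, 0 ≤ s r)
    (hspos : ∀ r ∈ increasingTuples k, 0 < s r)
    (hlaw : ∀ x : ℕ → Plane, (fun j : Fin (k + 1) => ‖x j‖) ∈ increasingTuples k → ∀ y, 0 ≤ y →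
      μ {ω | T * y < sig (x, fun j => g j ω)} =
        ENNReal.ofReal (Real.exp (-(s (fun j : Fin (k + 1) => ‖x j‖) * y))))
    (hind : ∀ x : ℕ → Plane, IndepFun (fun ω => sig (x, fun j => g j ω))
      (fun ω => interferencePlusNoise P η σ S (x, fun j => g j ω)) μ) :
    μ {ω | ENNReal.ofReal T < ENNReal.ofReal (sig (fun j => X j ω, fun j => g j ω)) /
        interferencePlusNoise P η σ S (fun j => X j ω, fun j => g j ω)} =
      ∫⁻ r, conditionalCoverage lam P η σ S s r ∂tupleLaw lam k := by
  have hD := measurable_interferencePlusNoise P η σ S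
  have hgm' : Measurable fun ω j => g j ω := measurable_pi_iff.2 hgm
  have hXm' : Measurable fun ω j => X j ω := measurable_pi_iff.2 hX.measurable
  have hglaw : ∀ i, μ.map (g i) = stdComplexGaussian := fun i => (hg.law i).map_eq
  have hset : {ω | ENNReal.ofReal T < ENNReal.ofReal (sig (fun j => X j ω, fun j => g j ω)) /
        interferencePlusNoise P η σ S (fun j => X j ω, fun j => g j ω)} =
      {ω | ((fun j => X j ω, fun j => g j ω) : Config) ∈ {p : Config | ENNReal.ofReal T *
        interferencePlusNoise P η σ S p < ENNReal.ofReal (sig p)}} := by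
    ext ω
    simp only [mem_ofPred_eq]
    exact ENNReal.lt_div_iff_mul_lt (Or.inr ENNReal.ofReal_ne_top)
      (Or.inr (by simpa using hT))
  have hmeas : MeasurableSet {p : Config | ENNReal.ofReal T *
        interferencePlusNoise P η σ S p < ENNReal.ofReal (sig p)} :=
    measurableSet_lt (by fun_prop) (by fun_prop)
  rw [hset, hg.indep_positions.measure_mem_eq_lintegral hgm' hXm' hmeas]
  -- The absolute values make `F ≤ 1` hold for all real tuples, as the limit theorem requires; on
  -- increasing tuples they change nothing.
  set F : (Fin (k + 1) → ℝ) → ℝ≥0∞ := fun r => ENNReal.ofReal (Real.exp (-(s r * σ ^ 2))) *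
        (∏ i ∈ S, ENNReal.ofReal (fadingFactor η |s r * P| |r i|)) with hFdef
  have hFm : Measurable F := by
    have h1 : ∀ i, Measurable fun r : Fin (k + 1) → ℝ => fadingFactor η |s r * P| |r i| := by
      intro i
      unfold fadingFactor
      fun_prop
    fun_prop
  have hF1 : ∀ r, F r ≤ 1 := by
    intro r
    refine mul_le_one' (ENNReal.ofReal_le_one.2 (Real.exp_le_one_iff.2 ?_))
      (Finset.prod_le_one' fun i _ => ENNReal.ofReal_le_one.2
        (fadingFactor_le_one (abs_nonneg _) (abs_nonneg _)))
    have := mul_nonneg (hs0 r) (sq_nonneg σ)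
    linarith
  have hFeq : ∀ ω, F (firstNorms X k ω) =
      ENNReal.ofReal (Real.exp (-(s (firstNorms X k ω) * σ ^ 2))) *
        (∏ i ∈ S, ENNReal.ofReal (fadingFactor η (s (firstNorms X k ω) * P) ‖X i ω‖)) := by
    intro ω
    simp only [hFdef, firstNorms, abs_norm, abs_of_nonneg (mul_nonneg (hs0 _) hP.le)]
  have hsP : Measurable fun r => s r * P := hs.mul_const P
  have hsP0 : ∀ r, 0 ≤ s r * P := fun r => mul_nonneg (hs0 r) hP.le
  have hlim1 := hX.tendsto_lintegral_prod_fadingFactor hlam hord hη hFm hF1 hsP hsP0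
  have hfirst := hX.measurable_firstNorms k
  have hlim2 : Filter.Tendsto (fun m => ∫⁻ ω, F (firstNorms X k ω) *
      ∏ j ∈ Finset.range m, ENNReal.ofReal
        (fadingFactor η (s (firstNorms X k ω) * P) ‖X (k + 1 + j) ω‖) ∂μ) Filter.atTop
      (nhds (∫⁻ ω, μ {ω' | ((fun j => X j ω, fun j => g j ω') : Config) ∈
        {p : Config | ENNReal.ofReal T *
        interferencePlusNoise P η σ S p < ENNReal.ofReal (sig p)}} ∂μ)) := by
    refine tendsto_lintegral_of_dominated_convergence (fun _ => 1) (fun m => ?_)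
      (fun m => Filter.Eventually.of_forall fun ω => ?_) (by simp) ?_
    · refine (hFm.comp hfirst).mul (Finset.measurable_prod _ fun j _ => ?_)
      exact (measurable_fadingFactor.comp
        ((hsP.comp hfirst).prodMk (hX.measurable _).norm)).ennreal_ofReal
    · exact mul_le_one' (hF1 _) (Finset.prod_le_one' fun i _ => ENNReal.ofReal_le_one.2
        (fadingFactor_le_one (hsP0 _) (norm_nonneg _)))
    · filter_upwards [hX.ae_mem_increasingTuples hlam hord k] with ω hω
      have hpair : Measurable fun ω' => ((fun j => X j ω, fun j => g j ω') : Config) :=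
        measurable_const.prodMk hgm'
      have h1 := measure_mul_lt_ofReal (hsig.comp hpair) (hD.comp hpair) (hind fun j => X j ω)
        hT (hs0 _) (hlaw (fun j => X j ω) hω) (fun h0 => absurd h0 (hspos _ hω).ne')
      have h2 := tendsto_prod_fadingFactor (η := η) (σ := σ) hP.le (hs0 (firstNorms X k ω)) hgm hglaw
        hg.iIndep S (fun j => X j ω)
      simp only [hFeq]
      refine h2.trans (le_of_eq (congrArg nhds ?_))
      exact h1.symm
  rw [tendsto_nhds_unique hlim2 hlim1]
  have hIm : Measurable fun r : Fin (k + 1) → ℝ => F r * ENNReal.ofReal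
      (Real.exp (-interferenceExponent lam η (s r * P) (r (Fin.last k)))) :=
    hFm.mul (measurable_interferenceExponent.comp
      (hsP.prodMk (measurable_pi_apply _))).neg.exp.ennreal_ofReal
  refine (hX.lintegral_firstNorms hlam hord hIm).trans (lintegral_congr_ae ?_)
  filter_upwards [ae_tupleLaw_mem k] with r hr
  simp only [hFdef, conditionalCoverage, abs_of_nonneg (hsP0 r), abs_of_pos (pos_of_mem_increasingTuples hr _)]

end Coverage

/-! ### Closed forms of the interference exponent -/

section ClosedForms

variable {lam η a r : ℝ}

lemma gaussHypergeometric_one_neg {b z : ℝ} (hb : 0 < b) :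
    gaussHypergeometric 1 b (b + 1) (-z) =
      b * ∫ t in Ioo (0 : ℝ) 1, t ^ (b - 1) * (1 + z * t)⁻¹ := by
  have hG : Real.Gamma b ≠ 0 := (Real.Gamma_pos_of_pos hb).ne'
  have h1 : b + 1 - b = 1 := by ring
  rw [gaussHypergeometric, h1, Real.Gamma_one, mul_one, Real.Gamma_add_one hb.ne',
    mul_div_cancel_right₀ _ hG, intervalIntegral.integral_of_le zero_le_one,
    integral_Ioc_eq_integral_Ioo]
  simp [Real.rpow_neg_one]

/-- The substitution u = r t^(-1/η), for which a u^(-η) = a r^(-η) t, maps (0, 1) onto (r, ∞) and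
turns the exponent into Euler's integral. -/
lemma interferenceExponent_eq_hypergeometric (hη : 2 < η) (ha : 0 ≤ a) (hr : 0 < r) :
    interferenceExponent lam η a r = Real.pi * lam * r ^ 2 * (2 * (a * r ^ (-η)) / (η - 2) *
      gaussHypergeometric 1 (1 - 2 / η) (2 - 2 / η) (-(a * r ^ (-η)))) := by
  have hη0 : 0 < η := by linarith
  have hη2 : η - 2 ≠ 0 := by linarith
  have hb : 0 < 1 - 2 / η := by
    rw [sub_pos, div_lt_one hη0]; exact hη
  have himg : (fun t : ℝ => r * t ^ (-1 / η)) '' Ioo 0 1 = Ioi r := by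
    ext u
    constructor
    · rintro ⟨t, ⟨h0, h1⟩, rfl⟩
      have : 1 < t ^ (-1 / η) :=
        Real.one_lt_rpow_of_pos_of_lt_one_of_neg h0 h1 (by
          rw [neg_div]; exact neg_neg_of_pos (by positivity))
      simpa using lt_mul_of_one_lt_right hr this
    · intro hu
      have hu0 : 0 < u := hr.trans hu
      have h1 : 1 < u / r := (one_lt_div hr).2 hu
      refine ⟨(u / r) ^ (-η), ⟨by positivity, Real.rpow_lt_one_of_one_lt_of_neg h1 (by linarith)⟩, ?_⟩
      simp only
      rw [← Real.rpow_mul (by positivity), show -η * (-1 / η) = 1 by field_simp, Real.rpow_one]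
      field_simp
  have hder : ∀ t ∈ Ioo (0 : ℝ) 1, HasDerivWithinAt (fun t : ℝ => r * t ^ (-1 / η))
      (r * ((-1 / η) * t ^ (-1 / η - 1))) (Ioo 0 1) t := fun t ht =>
    ((Real.hasDerivAt_rpow_const (Or.inl ht.1.ne')).const_mul r).hasDerivWithinAt
  have hinj : InjOn (fun t : ℝ => r * t ^ (-1 / η)) (Ioo 0 1) := by
    intro t ht t' ht' h
    have h1 : t ^ (-1 / η) = t' ^ (-1 / η) := mul_left_cancel₀ hr.ne' h
    exact (Real.rpow_left_inj ht.1.le ht'.1.le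
      (div_ne_zero (by norm_num) hη0.ne')).1 h1
  rw [interferenceExponent, ← himg, integral_image_eq_integral_abs_deriv_smul measurableSet_Ioo
    hder hinj, show 2 - 2 / η = (1 - 2 / η) + 1 by ring, gaussHypergeometric_one_neg hb,
    show Real.pi * lam * r ^ 2 * (2 * (a * r ^ (-η)) / (η - 2) * ((1 - 2 / η) *
      ∫ t in Ioo (0 : ℝ) 1, t ^ (1 - 2 / η - 1) * (1 + a * r ^ (-η) * t)⁻¹)) =
      (2 * Real.pi * lam * r ^ 2 * (a * r ^ (-η)) / η) *
      ∫ t in Ioo (0 : ℝ) 1, t ^ (1 - 2 / η - 1) * (1 + a * r ^ (-η) * t)⁻¹ by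
        field_simp, ← integral_const_mul]
  refine setIntegral_congr_fun measurableSet_Ioo fun t ht => ?_
  have ht0 : 0 < t := ht.1
  have hf : 0 ≤ r * t ^ (-1 / η) := by positivity
  have hpow : (r * t ^ (-1 / η)) ^ (-η) = r ^ (-η) * t := by
    rw [Real.mul_rpow hr.le (by positivity), ← Real.rpow_mul ht0.le,
      show -1 / η * -η = 1 by field_simp, Real.rpow_one]
  have habs : |r * ((-1 / η) * t ^ (-1 / η - 1))| = r / η * t ^ (-1 / η - 1) := by
    rw [show r * ((-1 / η) * t ^ (-1 / η - 1)) = -(r / η * t ^ (-1 / η - 1)) by ring, abs_neg,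
      abs_of_pos (by positivity)]
  have hexp : t ^ (1 - 2 / η - 1) = t ^ (-1 / η) * t ^ (-1 / η - 1) * t := by
    rw [← Real.rpow_add ht0, ← Real.rpow_add_one ht0.ne']
    congr 1
    ring
  simp only [smul_eq_mul]
  rw [habs, one_sub_fadingFactor ha hf, hpow, hexp]
  ring

/-- The substitution u = x T^(1/η) √w makes T x^η u^(-η) equal to w^(-η/2), and u = x corresponds to
w = T^(-2/η). -/
lemma interferenceExponent_nearest {T x : ℝ} (hη : 2 < η) (hT : 0 < T) (hx : 0 < x) :
    interferenceExponent lam η (T * x ^ η) x = Real.pi * lam * x ^ 2 *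
      (T ^ (2 / η) * ∫ w in Ioi (T ^ (-2 / η)), 1 / (1 + w ^ (η / 2))) := by
  have hη0 : 0 < η := by linarith
  set c : ℝ := x * T ^ (1 / η) with hc
  have hc0 : 0 < c := by positivity
  set w₀ : ℝ := T ^ (-2 / η) with hw
  have hw0 : 0 < w₀ := by positivity
  have hcw : c * √w₀ = x := by
    rw [hc, hw, Real.sqrt_eq_rpow, ← Real.rpow_mul hT.le, mul_assoc, ← Real.rpow_add hT,
      show 1 / η + -2 / η * (1 / 2) = 0 by ring, Real.rpow_zero, mul_one]
  have himg : (fun w : ℝ => c * √w) '' Ioi w₀ = Ioi x := by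
    ext u
    constructor
    · rintro ⟨w, hw, rfl⟩
      rw [mem_Ioi, ← hcw]
      exact mul_lt_mul_of_pos_left (Real.sqrt_lt_sqrt hw0.le hw) hc0
    · intro hu
      have hu0 : 0 < u := hx.trans hu
      refine ⟨(u / c) ^ 2, ?_, ?_⟩
      · rw [mem_Ioi, ← Real.sqrt_lt' (by positivity), lt_div_iff₀' hc0, hcw]
        exact hu
      · simp only
        rw [Real.sqrt_sq (by positivity)]
        field_simp
  have hder : ∀ w ∈ Ioi w₀, HasDerivWithinAt (fun w : ℝ => c * √w)
      (c * (1 / (2 * √w))) (Ioi w₀) w := fun w hw =>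
    ((Real.hasDerivAt_sqrt (hw0.trans hw).ne').const_mul c).hasDerivWithinAt
  have hinj : InjOn (fun w : ℝ => c * √w) (Ioi w₀) := by
    intro w hw w' hw' h
    exact (Real.sqrt_inj (hw0.trans hw).le (hw0.trans hw').le).1 (mul_left_cancel₀ hc0.ne' h)
  rw [interferenceExponent, ← himg, integral_image_eq_integral_abs_deriv_smul measurableSet_Ioi
    hder hinj, ← mul_assoc, ← integral_const_mul]
  refine setIntegral_congr_fun measurableSet_Ioi fun w hww => ?_
  have hwp : 0 < w := hw0.trans hww
  have hsq : 0 < √w := Real.sqrt_pos.2 hwp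
  have hpow : T * x ^ η * (c * √w) ^ (-η) = (w ^ (η / 2))⁻¹ := by
    rw [hc, Real.mul_rpow (by positivity) hsq.le, Real.mul_rpow hx.le (by positivity),
      ← Real.rpow_mul hT.le, Real.sqrt_eq_rpow, ← Real.rpow_mul hwp.le,
      show 1 / η * -η = -1 by field_simp, show 1 / 2 * -η = -(η / 2) by ring, Real.rpow_neg hx.le,
      Real.rpow_neg_one, Real.rpow_neg hwp.le]
    have : x ^ η ≠ 0 := (Real.rpow_pos_of_pos hx _).ne'
    field_simp
  have hcsq : c ^ 2 = x ^ 2 * T ^ (2 / η) := by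
    rw [hc, mul_pow, ← Real.rpow_natCast (T ^ (1 / η)), ← Real.rpow_mul hT.le]
    congr 2
    push_cast
    ring
  have hwη : 0 < w ^ (η / 2) := Real.rpow_pos_of_pos hwp _
  simp only [smul_eq_mul]
  rw [abs_of_pos (by positivity), one_sub_fadingFactor (by positivity) (by positivity), hpow,
    mul_assoc (Real.pi * lam), ← hcsq]
  field_simp
  ring

/-- For η = 4 the integrand is a multiple of a u/(u⁴ + a), whose antiderivative is an arctangent of
√a/u² that vanishes at infinity. -/
lemma interferenceExponent_four (hlam : 0 ≤ lam) (ha : 0 ≤ a) (hr : 0 < r) :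
    interferenceExponent lam 4 a r = Real.pi * lam * (√a * Real.arctan (√a / r ^ 2)) := by
  have hpi := Real.pi_pos
  have hpow : ∀ u : ℝ, 0 < u → u ^ (-4 : ℝ) = (u ^ 4)⁻¹ := by
    intro u hu
    rw [Real.rpow_neg hu.le]
    norm_cast
  have hder : ∀ u, 0 < u → HasDerivAt
      (fun u => -(Real.pi * lam * (√a * Real.arctan (√a / u ^ 2))))
      (2 * Real.pi * lam * u * (1 - fadingFactor 4 a u)) u := by
    intro u hu
    have h1 : HasDerivAt (fun u : ℝ => √a / u ^ 2) (√a * (-(2 * u) / (u ^ 2) ^ 2)) u := by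
      have h := ((hasDerivAt_pow 2 u).fun_inv (by positivity)).const_mul √a
      refine (h.congr_deriv ?_)
      norm_num
    have h2 := ((h1.arctan.const_mul √a).const_mul (Real.pi * lam)).fun_neg
    refine h2.congr_deriv ?_
    have hsa : √a ^ 2 = a := Real.sq_sqrt ha
    rw [one_sub_fadingFactor ha hu.le, hpow u hu, div_pow, hsa]
    have e : 0 < u ^ 4 + a := by positivity
    field_simp
    rw [hsa]
  have hlim : Filter.Tendsto (fun u => -(Real.pi * lam * (√a * Real.arctan (√a / u ^ 2))))
      Filter.atTop (nhds 0) := by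
    have h1 : Filter.Tendsto (fun u : ℝ => √a / u ^ 2) Filter.atTop (nhds 0) :=
      Filter.Tendsto.const_div_atTop (Filter.tendsto_pow_atTop two_ne_zero) _
    have h2 := (((Real.continuous_arctan.tendsto 0).comp h1).const_mul √a).const_mul
      (Real.pi * lam) |>.neg
    simpa using h2
  have h := integral_Ioi_of_hasDerivAt_of_tendsto (hder r hr).continuousAt.continuousWithinAt
    (fun u hu => hder u (hr.trans hu)) (integrableOn_interference hlam (by norm_num) ha hr) hlim
  rw [interferenceExponent, h]
  ring

lemma integral_div_one_add_four {y : ℝ} (ha : 0 < a) (hy : 0 ≤ y) :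
    ∫ x in (0 : ℝ)..y, x / (1 + a * x ^ (-4 : ℝ)) =
      (y ^ 2 - √a * Real.arctan (y ^ 2 / √a)) / 2 := by
  have hsa : √a ^ 2 = a := Real.sq_sqrt ha.le
  have hsp : 0 < √a := Real.sqrt_pos.2 ha
  have hder : ∀ x ∈ uIcc 0 y, HasDerivAt
      (fun x => (x ^ 2 - √a * Real.arctan (x ^ 2 / √a)) / 2) (x ^ 5 / (x ^ 4 + a)) x := by
    intro x _
    have h1 : HasDerivAt (fun x : ℝ => x ^ 2 / √a) (2 * x / √a) x := by
      refine ((hasDerivAt_pow 2 x).div_const √a).congr_deriv ?_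
      norm_num
    have h2 := ((hasDerivAt_pow 2 x).fun_sub (h1.arctan.const_mul √a)).div_const 2
    refine h2.congr_deriv ?_
    have e : 0 < x ^ 4 + a := by positivity
    have e' : 0 < a + x ^ 4 := by positivity
    rw [div_pow, hsa]
    push_cast
    field_simp
    ring
  have hcongr : ∫ x in (0 : ℝ)..y, x / (1 + a * x ^ (-4 : ℝ)) =
      ∫ x in (0 : ℝ)..y, x ^ 5 / (x ^ 4 + a) := by
    refine intervalIntegral.integral_congr fun x hx => ?_
    rw [uIcc_of_le hy] at hx
    -- At x = 0 both integrands vanish through their numerators, whatever value the negative power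
    -- takes there.
    rcases hx.1.eq_or_lt with h0 | h0
    · simp [← h0]
    · have hpow : x ^ (-4 : ℝ) = (x ^ 4)⁻¹ := by
        rw [Real.rpow_neg h0.le]
        norm_cast
      have e : 0 < x ^ 4 + a := by positivity
      rw [hpow]
      field_simp
  rw [hcongr, intervalIntegral.integral_eq_sub_of_hasDerivAt hder]
  · simp
  · refine Continuous.intervalIntegrable ?_ _ _
    refine Continuous.div (by fun_prop) (by fun_prop) fun x => ?_
    positivity

end ClosedForms

/-! ### Iterated integrals over ordered distances -/

section Tonelli

lemma measurable_setLIntegral_Ioo {β : Type*} [MeasurableSpace β] {ν : Measure ℝ} [SFinite ν]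
    {h : β → ℝ → ℝ≥0∞} (hh : Measurable (Function.uncurry h)) {c : β → ℝ} (hc : Measurable c) :
    Measurable fun b => ∫⁻ x in Ioo 0 (c b), h b x ∂ν := by
  have h1 : MeasurableSet {p : β × ℝ | 0 < p.2} := measurableSet_lt (by fun_prop) (by fun_prop)
  have h2 : MeasurableSet {p : β × ℝ | p.2 < c p.1} :=
    measurableSet_lt (by fun_prop) (by fun_prop)
  have hF : Measurable ({p : β × ℝ | 0 < p.2 ∧ p.2 < c p.1}.indicator (Function.uncurry h)) :=
    hh.indicator (h1.inter h2)
  have hW := hF.lintegral_prod_right' (ν := ν)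
  convert hW using 2 with b
  rw [← lintegral_indicator measurableSet_Ioo]
  rfl

lemma measurable_setLIntegral_Ioi {β : Type*} [MeasurableSpace β] {ν : Measure ℝ} [SFinite ν]
    {h : β → ℝ → ℝ≥0∞} (hh : Measurable (Function.uncurry h)) {c : β → ℝ} (hc : Measurable c) :
    Measurable fun b => ∫⁻ x in Ioi (c b), h b x ∂ν := by
  have hF : Measurable ({p : β × ℝ | c p.1 < p.2}.indicator (Function.uncurry h)) :=
    hh.indicator (measurableSet_lt (by fun_prop) (by fun_prop))
  have hW := hF.lintegral_prod_right' (ν := ν)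
  convert hW using 2 with b
  rw [← lintegral_indicator measurableSet_Ioi]
  rfl

lemma measurableSet_increasingPairs : MeasurableSet {p : ℝ × ℝ | 0 < p.1 ∧ p.1 < p.2} := by
  have h1 : MeasurableSet {p : ℝ × ℝ | 0 < p.1} := measurableSet_lt (by fun_prop) (by fun_prop)
  have h2 : MeasurableSet {p : ℝ × ℝ | p.1 < p.2} := measurableSet_lt (by fun_prop) (by fun_prop)
  exact h1.inter h2

lemma lintegral_Ioi_Ioi_swap {ν : Measure ℝ} [SFinite ν] {h : ℝ → ℝ → ℝ≥0∞}
    (hh : Measurable (Function.uncurry h)) :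
    ∫⁻ x in Ioi 0, ∫⁻ y in Ioi x, h x y ∂ν ∂ν = ∫⁻ y in Ioi 0, ∫⁻ x in Ioo 0 y, h x y ∂ν ∂ν := by
  set H : ℝ → ℝ → ℝ≥0∞ := fun x y =>
    {p : ℝ × ℝ | 0 < p.1 ∧ p.1 < p.2}.indicator (Function.uncurry h) (x, y) with hH
  have hHm : Measurable (Function.uncurry H) :=
    hh.indicator measurableSet_increasingPairs
  have h1 : ∫⁻ x in Ioi 0, ∫⁻ y in Ioi x, h x y ∂ν ∂ν = ∫⁻ x, ∫⁻ y, H x y ∂ν ∂ν := by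
    rw [← lintegral_indicator measurableSet_Ioi]
    refine lintegral_congr fun x => ?_
    by_cases hx : 0 < x
    · rw [indicator_of_mem (mem_Ioi.2 hx), ← lintegral_indicator measurableSet_Ioi]
      refine lintegral_congr fun y => ?_
      simp [hH, indicator, hx]
    · rw [indicator_of_notMem (fun h => hx (mem_Ioi.1 h))]
      simp [hH, hx]
  have h2 : ∫⁻ y in Ioi 0, ∫⁻ x in Ioo 0 y, h x y ∂ν ∂ν = ∫⁻ y, ∫⁻ x, H x y ∂ν ∂ν := by
    rw [← lintegral_indicator measurableSet_Ioi]
    refine lintegral_congr fun y => ?_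
    by_cases hy : 0 < y
    · rw [indicator_of_mem (mem_Ioi.2 hy), ← lintegral_indicator measurableSet_Ioo]
      rfl
    · rw [indicator_of_notMem (fun h => hy (mem_Ioi.1 h))]
      have : ∀ x, H x y = 0 := fun x => by
        refine indicator_of_notMem (fun hx => hy ?_) _
        exact hx.1.trans hx.2
      simp [this]
  rw [h1, h2, lintegral_lintegral_swap hHm.aemeasurable]

/-- For a nonnegative integrand, finiteness of the lower integral yields integrability and the value
together. Applied with a probability as the total, it gives absolute convergence. Measurability is
only asked of `E`, not of the explicit formula `f`. -/
lemma integrableOn_and_integral_eq_toReal {α : Type*} [MeasurableSpace α] {ν : Measure α}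
    {s : Set α} (hs : MeasurableSet s) {f : α → ℝ} {E : α → ℝ≥0∞} (hE : Measurable E)
    (hf : ∀ u ∈ s, 0 ≤ f u) (hEf : ∀ u ∈ s, E u = ENNReal.ofReal (f u))
    (hfin : ∫⁻ u in s, E u ∂ν ≠ ∞) :
    IntegrableOn f s ν ∧ ∫ u in s, f u ∂ν = (∫⁻ u in s, E u ∂ν).toReal := by
  have hEq : ∀ u ∈ s, (E u).toReal = f u := fun u hu => by
    rw [hEf u hu, ENNReal.toReal_ofReal (hf u hu)]
  constructor
  · have h : IntegrableOn (fun u => (E u).toReal) s ν :=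
      integrable_toReal_of_lintegral_ne_top hE.aemeasurable hfin
    exact h.congr_fun hEq hs
  · rw [← integral_toReal hE.aemeasurable (ae_lt_top hE hfin)]
    exact (setIntegral_congr_fun hs hEq).symm

lemma setLIntegral_increasingPairs {E : ℝ × ℝ → ℝ≥0∞} (hE : Measurable E) :
    ∫⁻ p in {p : ℝ × ℝ | 0 < p.1 ∧ p.1 < p.2}, E p =
      ∫⁻ y in Ioi 0, ∫⁻ z in Ioi y, E (y, z) := by
  rw [← lintegral_indicator measurableSet_increasingPairs, Measure.volume_eq_prod,
    lintegral_prod _ (hE.indicator measurableSet_increasingPairs).aemeasurable,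
    ← lintegral_indicator measurableSet_Ioi]
  refine lintegral_congr fun y => ?_
  by_cases hy : 0 < y
  · rw [indicator_of_mem (mem_Ioi.2 hy), ← lintegral_indicator measurableSet_Ioi]
    refine lintegral_congr fun z => ?_
    simp [indicator, hy]
  · rw [indicator_of_notMem (fun h => hy (mem_Ioi.1 h))]
    simp [hy]

lemma setIntegral_increasingPairs {f : ℝ × ℝ → ℝ}
    (hf : IntegrableOn f {p : ℝ × ℝ | 0 < p.1 ∧ p.1 < p.2}) :
    ∫ p in {p : ℝ × ℝ | 0 < p.1 ∧ p.1 < p.2}, f p =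
      ∫ y in Ioi 0, ∫ z in Ioi y, f (y, z) := by
  rw [← integrable_indicator_iff measurableSet_increasingPairs, Measure.volume_eq_prod] at hf
  rw [← integral_indicator measurableSet_increasingPairs, Measure.volume_eq_prod,
    integral_prod _ hf, ← integral_indicator measurableSet_Ioi]
  refine integral_congr_ae (Filter.Eventually.of_forall fun y => ?_)
  simp only
  by_cases hy : 0 < y
  · rw [indicator_of_mem (mem_Ioi.2 hy), ← integral_indicator measurableSet_Ioi]
    refine integral_congr_ae (Filter.Eventually.of_forall fun z => ?_)
    simp [indicator, hy]
  · rw [indicator_of_notMem (fun h => hy (mem_Ioi.1 h))]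
    simp [hy]

variable {lam : ℝ}

lemma lintegral_tupleLaw_one {H : (Fin 2 → ℝ) → ℝ≥0∞} (hH : Measurable H) :
    ∫⁻ r, H r ∂tupleLaw lam 1 = ∫⁻ y in Ioi 0, ∫⁻ x in Ioo 0 y,
      H ![x, y] * ENNReal.ofReal (Real.exp (-meanCount lam y))
        ∂radialIntensity lam ∂radialIntensity lam := by
  have hvec : Measurable fun p : ℝ × ℝ => ![p.1, p.2] := by
    refine measurable_pi_iff.2 fun j => ?_
    fin_cases j
    · exact measurable_fst
    · exact measurable_snd
  have hHv : Measurable fun p : ℝ × ℝ => H ![p.1, p.2] := hH.comp hvec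
  rw [lintegral_tupleLaw_succ hH, lintegral_tupleLaw_zero (measurable_nextAverage hH),
    ← lintegral_Ioi_Ioi_swap (by unfold Function.uncurry; fun_prop)]
  refine setLIntegral_congr_fun measurableSet_Ioi fun x _ => ?_
  have hsn : ∀ u, (Fin.snoc (fun _ => x : Fin 1 → ℝ) u : Fin 2 → ℝ) = ![x, u] := by
    intro u
    funext j
    fin_cases j <;> rfl
  simp only [nextAverage, hsn]
  have hHx : Measurable fun u => H ![x, u] := hHv.comp (measurable_const.prodMk measurable_id)
  rw [← lintegral_mul_const _ (by fun_prop)]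
  refine lintegral_congr fun u => ?_
  rw [mul_assoc, ← ENNReal.ofReal_mul (Real.exp_pos _).le, ← Real.exp_add]
  congr 3
  ring

lemma lintegral_tupleLaw_two {H : (Fin 3 → ℝ) → ℝ≥0∞} (hH : Measurable H) :
    ∫⁻ r, H r ∂tupleLaw lam 2 = ∫⁻ y in Ioi 0, ∫⁻ z in Ioi y, ∫⁻ x in Ioo 0 y,
      H ![x, y, z] * ENNReal.ofReal (Real.exp (-meanCount lam z))
        ∂radialIntensity lam ∂radialIntensity lam ∂radialIntensity lam := by
  have hvec : Measurable fun p : ℝ × ℝ × ℝ => ![p.1, p.2.1, p.2.2] := by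
    refine measurable_pi_iff.2 fun j => ?_
    fin_cases j
    · exact measurable_fst
    · exact measurable_fst.comp measurable_snd
    · exact measurable_snd.comp measurable_snd
  have hHv : Measurable fun p : ℝ × ℝ × ℝ => H ![p.1, p.2.1, p.2.2] := hH.comp hvec
  rw [lintegral_tupleLaw_succ hH, lintegral_tupleLaw_one (measurable_nextAverage hH)]
  refine setLIntegral_congr_fun measurableSet_Ioi fun y _ => ?_
  have hHy : Measurable fun p : ℝ × ℝ => H ![p.1, y, p.2] :=
    hHv.comp (measurable_fst.prodMk (measurable_const.prodMk measurable_snd))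
  rw [← lintegral_lintegral_swap (f := fun x z => H ![x, y, z] *
    ENNReal.ofReal (Real.exp (-meanCount lam z))) (by unfold Function.uncurry; fun_prop)]
  refine lintegral_congr fun x => ?_
  have hsn : ∀ u, (Fin.snoc (![x, y] : Fin 2 → ℝ) u : Fin 3 → ℝ) = ![x, y, u] := by
    intro u
    funext j
    fin_cases j <;> rfl
  have hlast : (![x, y] : Fin 2 → ℝ) (Fin.last 1) = y := rfl
  simp only [nextAverage, hsn, hlast]
  have hHx : Measurable fun u => H ![x, y, u] := hHy.comp (measurable_const.prodMk measurable_id)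
  rw [← lintegral_mul_const _ (by fun_prop)]
  refine lintegral_congr fun u => ?_
  rw [mul_assoc, ← ENNReal.ofReal_mul (Real.exp_pos _).le, ← Real.exp_add]
  congr 3
  ring

end Tonelli

/-! ### Tails of the signal power and independence from the interference -/

section Signals

variable {Ω : Type*} [MeasurableSpace Ω] {μ : Measure Ω}
  {g : ℕ → Ω → ℂ} {P η σ T : ℝ}

lemma indepFun_signal_interference [IsProbabilityMeasure μ] (hgm : ∀ i, Measurable (g i)) (hi : iIndepFun g μ) {k : ℕ}
    {S : Finset (Fin (k + 1))} (J : Set ℕ) (hJS : ∀ i ∈ S, (i : ℕ) ∉ J)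
    (hJk : ∀ j, k + 1 + j ∉ J) {sig : (J → ℂ) → ℝ} (hsig : Measurable sig) (x : ℕ → Plane) :
    IndepFun (fun ω => sig fun i : J => g i ω)
      (fun ω => interferencePlusNoise P η σ S (x, fun j => g j ω)) μ := by
  classical
  -- Coefficients of the serving stations are filled in with 0; the interference does not read them,
  -- so it becomes a function of the complementary coefficients alone.
  let ext : ((Jᶜ : Set ℕ) → ℂ) → ℕ → ℂ := fun f j => if h : j ∈ Jᶜ then f ⟨j, h⟩ else 0
  have hext : Measurable ext := by
    refine measurable_pi_iff.2 fun j => ?_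
    by_cases h : j ∈ Jᶜ
    · simp only [ext, h, dite_true]
      exact measurable_pi_apply _
    · simp only [ext, h, dite_false]
      exact measurable_const
  have h := (hi.indepFun_compl hgm J).comp hsig ((measurable_interferencePlusNoise P η σ S).comp
    ((measurable_const (a := x)).prodMk hext))
  have e : (fun ω => interferencePlusNoise P η σ S (x, fun j => g j ω)) =
      (interferencePlusNoise P η σ S ∘ fun a => (x, ext a)) ∘ fun ω i => g i ω := by
    funext ω
    have hrx : ∀ j, j ∉ J → rxPower P η Config.pos Config.chan j (x, fun j => g j ω) =
        rxPower P η Config.pos Config.chan j (x, ext fun i => g i ω) := by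
      intro j hj
      have hj' : j ∈ Jᶜ := hj
      simp only [rxPower, Config.chan, Config.pos, ext, hj', dite_true]
    simp only [Function.comp_apply, interferencePlusNoise, interferenceFrom]
    rw [Finset.sum_congr rfl fun (i : Fin (k + 1)) hi' => hrx i (hJS i hi'), tsum_congr fun j => hrx _ (hJk j)]
  rw [e]
  exact h

lemma measure_single_signal_gt (hgm : ∀ i, Measurable (g i))
    (hlaw : ∀ i, μ.map (g i) = stdComplexGaussian) (hP : 0 < P) (hT : 0 < T) {ρ : ℝ} (hρ : 0 < ρ)
    (i : ℕ) {y : ℝ} (hy : 0 ≤ y) :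
    μ {ω | T * y < P * ‖g i ω‖ ^ 2 * ρ ^ (-η)} =
      ENNReal.ofReal (Real.exp (-(T * ρ ^ η / P * y))) := by
  have hm : MeasurableSet {z : ℂ | T * ρ ^ η / P * y < ‖z‖ ^ 2} :=
    measurableSet_lt (by fun_prop) (by fun_prop)
  have hr := Real.rpow_pos_of_pos hρ η
  rw [← stdComplexGaussian_normSq_gt (by positivity), ← hlaw i, Measure.map_apply (hgm i) hm]
  congr 1
  ext ω
  simp only [mem_ofPred_eq, mem_preimage]
  rw [Real.rpow_neg hρ.le, ← div_eq_mul_inv, lt_div_iff₀ hr, div_mul_eq_mul_div, div_lt_iff₀' hP]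
  constructor <;> intro h <;> linarith

lemma measure_coop_signal_gt [IsProbabilityMeasure μ] (hgm : ∀ i, Measurable (g i)) (hi : iIndepFun g μ)
    (hlaw : ∀ i, μ.map (g i) = stdComplexGaussian) (hP : 0 < P) (hT : 0 < T) {ρ₂ ρ₃ : ℝ}
    (h₂ : 0 < ρ₂) (h₃ : 0 < ρ₃) {y : ℝ} (hy : 0 ≤ y) :
    μ {ω | T * y < ‖((√P * ρ₂ ^ (-η / 2) : ℝ) : ℂ) * g 1 ω
        + ((√P * ρ₃ ^ (-η / 2) : ℝ) : ℂ) * g 2 ω‖ ^ 2} =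
      ENNReal.ofReal (Real.exp (-(coopS P η T ρ₂ ρ₃ * y))) := by
  have hsq : ∀ ρ : ℝ, 0 < ρ → (√P * ρ ^ (-η / 2)) ^ 2 = P * ρ ^ (-η) := by
    intro ρ hρ
    rw [mul_pow, Real.sq_sqrt hP.le, ← Real.rpow_natCast, ← Real.rpow_mul hρ.le]
    congr 2
    push_cast
    ring
  have hpos : 0 < √P * ρ₂ ^ (-η / 2) := by positivity
  rw [measure_normSq_add_gt (hgm 1) (hgm 2) (hlaw 1) (hlaw 2) (hi.indepFun (by norm_num)) hpos
    (by positivity), hsq _ h₂, hsq _ h₃, coopS]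
  congr 3
  rw [← mul_add]
  ring

end Signals

/-! ### Positivity and rewriting of the integrands -/

section Integrands

variable {lam P η σ T : ℝ}

lemma bestConnectedIntegrand_nonneg (hlam : 0 ≤ lam) {x : ℝ} (hx : 0 ≤ x) :
    0 ≤ bestConnectedIntegrand lam P η σ T x := by
  have := Real.pi_pos
  unfold bestConnectedIntegrand
  positivity

lemma integral_div_one_add_nonneg {a y : ℝ} (ha : 0 ≤ a) (hy : 0 ≤ y) :
    0 ≤ ∫ x in (0 : ℝ)..y, x / (1 + a * x ^ (-η)) :=
  intervalIntegral.integral_nonneg hy fun x hx => by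
    have := Real.rpow_nonneg hx.1 (-η)
    have := hx.1
    positivity

lemma lintegral_mul_fadingFactor (hlam : 0 ≤ lam) {a y : ℝ} (ha : 0 ≤ a) (hy : 0 ≤ y) :
    ∫⁻ x in Ioo 0 y, ENNReal.ofReal (2 * Real.pi * lam * x) *
        ENNReal.ofReal (fadingFactor η a x) =
      ENNReal.ofReal (2 * Real.pi * lam * ∫ x in (0 : ℝ)..y, x / (1 + a * x ^ (-η))) := by
  have hpi := Real.pi_pos
  have hfm : Measurable fun x => fadingFactor η a x := measurable_fadingFactor.comp
    (measurable_const.prodMk measurable_id)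
  have hle : ∀ x ∈ Ioo 0 y, 0 ≤ fadingFactor η a x ∧ fadingFactor η a x ≤ 1 := fun x hx =>
    ⟨(fadingFactor_pos ha hx.1.le).le, fadingFactor_le_one ha hx.1.le⟩
  have hpos : ∀ x ∈ Ioo 0 y, 0 ≤ 2 * Real.pi * lam * x * fadingFactor η a x := by
    intro x hx
    have := (hle x hx).1
    have := hx.1.le
    positivity
  have hint : IntegrableOn (fun x => 2 * Real.pi * lam * x * fadingFactor η a x) (Ioo 0 y) := by
    have h1 : IntegrableOn (fun x : ℝ => 2 * Real.pi * lam * x) (Ioo 0 y) :=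
      (Continuous.integrableOn_Icc (by fun_prop)).mono_set Ioo_subset_Icc_self
    refine Integrable.mono' h1 (Measurable.aestronglyMeasurable (by fun_prop)) ?_
    refine (ae_restrict_iff' measurableSet_Ioo).2 (Filter.Eventually.of_forall fun x hx => ?_)
    rw [Real.norm_of_nonneg (hpos x hx)]
    have := hx.1.le
    exact mul_le_of_le_one_right (by positivity) (hle x hx).2
  have hval : ∫ x in Ioo 0 y, 2 * Real.pi * lam * x * fadingFactor η a x =
      2 * Real.pi * lam * ∫ x in (0 : ℝ)..y, x / (1 + a * x ^ (-η)) := by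
    rw [intervalIntegral.integral_of_le hy, integral_Ioc_eq_integral_Ioo, ← integral_const_mul]
    refine setIntegral_congr_fun measurableSet_Ioo fun x _ => ?_
    simp only [fadingFactor]
    ring
  rw [← hval, ofReal_integral_eq_lintegral_ofReal hint
    ((ae_restrict_iff' measurableSet_Ioo).2 (Filter.Eventually.of_forall hpos))]
  refine setLIntegral_congr_fun measurableSet_Ioo fun x hx => ?_
  have := hx.1.le
  exact (ENNReal.ofReal_mul (by positivity)).symm

lemma coopS_pos (hP : 0 < P) (hT : 0 < T) {y z : ℝ} (hy : 0 < y) (hz : 0 < z) :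
    0 < coopS P η T y z := by
  unfold coopS; positivity

lemma coopIntegrand_eq (hη : 2 < η) (hP : 0 < P) (hT : 0 < T) {y z : ℝ} (hy : 0 < y)
    (hz : 0 < z) :
    coopIntegrand lam P η σ T y z = 8 * (Real.pi * lam) ^ 3 * (y * z *
      Real.exp (-(coopS P η T y z * σ ^ 2) - Real.pi * lam * z ^ 2 -
        interferenceExponent lam η (coopS P η T y z * P) z) *
      ∫ x in (0 : ℝ)..y, x / (1 + coopS P η T y z * P * x ^ (-η))) := by
  have hs := coopS_pos (η := η) hP hT hy hz
  rw [interferenceExponent_eq_hypergeometric hη (by positivity) hz, coopIntegrand]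
  congr 4
  ring

/-- Everything depends on A = sP = T/(y⁻⁴ + z⁻⁴), in which P cancels. The arguments of the two
arctangents are y²/√A and √A/z², and √A = y² √(A/y⁴) pulls out the remaining factor y². -/
lemma coopIntegrandFour_eq (hlam : 0 ≤ lam) (hP : 0 < P) (hT : 0 < T) {y z : ℝ} (hy : 0 < y)
    (hz : 0 < z) : coopIntegrandFour lam T y z = coopIntegrand lam P 4 0 T y z := by
  have hpow : ∀ u : ℝ, 0 < u → u ^ (-4 : ℝ) = (u ^ 4)⁻¹ := by
    intro u hu
    rw [Real.rpow_neg hu.le]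
    norm_cast
  have hs := coopS_pos (η := 4) hP hT hy hz
  have hA : coopS P 4 T y z * P = T / ((y ^ 4)⁻¹ + (z ^ 4)⁻¹) := by
    rw [coopS, hpow y hy, hpow z hz]
    field_simp
  have hA0 : 0 < T / ((y ^ 4)⁻¹ + (z ^ 4)⁻¹) := by positivity
  have hdiv : ∀ u : ℝ, 0 < u → √(T / ((y ^ 4)⁻¹ + (z ^ 4)⁻¹)) / u ^ 2 =
      √(T / ((y ^ 4)⁻¹ + (z ^ 4)⁻¹) / u ^ 4) := by
    intro u hu
    rw [Real.sqrt_div hA0.le, show u ^ 4 = (u ^ 2) ^ 2 by ring, Real.sqrt_sq (by positivity)]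
  have hz4 : T / ((y ^ 4)⁻¹ + (z ^ 4)⁻¹) / z ^ 4 = T * y ^ 4 / (y ^ 4 + z ^ 4) := by
    field_simp
    ring
  have hy4 : T / ((y ^ 4)⁻¹ + (z ^ 4)⁻¹) / y ^ 4 = T * z ^ 4 / (y ^ 4 + z ^ 4) := by
    field_simp
    ring
  have hinv : y ^ 2 / √(T / ((y ^ 4)⁻¹ + (z ^ 4)⁻¹)) = √((y ^ 4 + z ^ 4) / (T * z ^ 4)) := by
    rw [← inv_div, hdiv y hy, hy4, ← Real.sqrt_inv, inv_div]
  have hsqrt : √(T / ((y ^ 4)⁻¹ + (z ^ 4)⁻¹)) = y ^ 2 * √(T * z ^ 4 / (y ^ 4 + z ^ 4)) := by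
    rw [← hy4, ← hdiv y hy]
    field_simp
  rw [coopIntegrand_eq (by norm_num) hP hT hy hz, hA, interferenceExponent_four hlam hA0.le hz,
    integral_div_one_add_four hA0 hy.le, hinv, hdiv z hz, hz4, coopIntegrandFour,
    show -(coopS P 4 T y z * 0 ^ 2) - Real.pi * lam * z ^ 2 -
      Real.pi * lam * (√(T / ((y ^ 4)⁻¹ + (z ^ 4)⁻¹)) *
        Real.arctan √(T * y ^ 4 / (y ^ 4 + z ^ 4))) =
      -(Real.pi * lam * (z ^ 2 + √(T / ((y ^ 4)⁻¹ + (z ^ 4)⁻¹)) *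
        Real.arctan √(T * y ^ 4 / (y ^ 4 + z ^ 4)))) by ring]
  generalize Real.exp _ = e
  rw [hsqrt]
  ring

end Integrands

/-! ### The three ways of serving the user -/

section Cases

variable {Ω : Type*} [MeasurableSpace Ω] {μ : Measure Ω} [IsProbabilityMeasure μ]
  {X : ℕ → Ω → Plane} {g : ℕ → Ω → ℂ} {lam P η σ T : ℝ}

lemma measure_bestConnected_eq (hlam : 0 < lam) (hP : 0 < P) (hη : 2 < η) (hT : 0 < T)
    (hX : IsHomogeneousPPP μ lam X) (hord : ∀ᵐ ω ∂μ, Monotone fun i => ‖X i ω‖)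
    (hg : IsRayleighFading μ X g) (hgm : ∀ i, Measurable (g i)) :
    μ {ω | ENNReal.ofReal T < sinrBestConnected P η σ X g ω} =
      ∫⁻ r, conditionalCoverage lam P η σ (∅ : Finset (Fin 1)) (fun r => T * |r 0| ^ η / P) r
        ∂tupleLaw lam 0 := by
  have hglaw : ∀ i, μ.map (g i) = stdComplexGaussian := fun i => (hg.law i).map_eq
  have h := measure_coverage_eq (σ := σ) hlam hP hη hT hX hord hg hgm (∅ : Finset (Fin 1))
    (sig := fun p => P * ‖p.2 0‖ ^ 2 * ‖p.1 0‖ ^ (-η)) (by fun_prop)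
    -- The absolute value keeps `s` nonnegative on all real tuples; distances are unaffected.
    (s := fun r => T * |r 0| ^ η / P) (by fun_prop) (fun r => by positivity)
    (fun r hr => by have := pos_of_mem_increasingTuples hr 0; positivity)
    (fun x hx y hy => by
      have := measure_single_signal_gt (η := η) hgm hglaw hP hT
        (pos_of_mem_increasingTuples hx 0) 0 hy
      simpa using this)
    (fun x => indepFun_signal_interference hgm hg.iIndep {0} (by simp) (by simp)
      (sig := fun f => P * ‖f ⟨0, rfl⟩‖ ^ 2 * ‖x 0‖ ^ (-η)) (by fun_prop) x)
  rw [← h]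
  congr 1
  ext ω
  simp only [interferencePlusNoise, Finset.sum_empty, zero_add]
  rfl

lemma measure_blackout_eq (hlam : 0 < lam) (hP : 0 < P) (hη : 2 < η) (hT : 0 < T)
    (hX : IsHomogeneousPPP μ lam X) (hord : ∀ᵐ ω ∂μ, Monotone fun i => ‖X i ω‖)
    (hg : IsRayleighFading μ X g) (hgm : ∀ i, Measurable (g i)) :
    μ {ω | ENNReal.ofReal T < sinrBlackout P η σ X g ω} =
      ∫⁻ r, conditionalCoverage lam P η σ ({0} : Finset (Fin 2)) (fun r => T * |r 1| ^ η / P) r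
        ∂tupleLaw lam 1 := by
  have hglaw : ∀ i, μ.map (g i) = stdComplexGaussian := fun i => (hg.law i).map_eq
  have h := measure_coverage_eq (σ := σ) hlam hP hη hT hX hord hg hgm ({0} : Finset (Fin 2))
    (sig := fun p => P * ‖p.2 1‖ ^ 2 * ‖p.1 1‖ ^ (-η)) (by fun_prop)
    (s := fun r => T * |r 1| ^ η / P) (by fun_prop) (fun r => by positivity)
    (fun r hr => by have := pos_of_mem_increasingTuples hr 1; positivity)
    (fun x hx y hy => by
      have := measure_single_signal_gt (η := η) hgm hglaw hP hT
        (pos_of_mem_increasingTuples hx 1) 1 hy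
      simpa using this)
    (fun x => indepFun_signal_interference hgm hg.iIndep {1} (by simp)
      (fun j => by simp only [mem_singleton_iff]; omega)
      (sig := fun f => P * ‖f ⟨1, rfl⟩‖ ^ 2 * ‖x 1‖ ^ (-η)) (by fun_prop) x)
  rw [← h]
  congr 1
  ext ω
  simp only [interferencePlusNoise, Finset.sum_singleton]
  rfl

lemma measure_blackoutCoop_eq (hlam : 0 < lam) (hP : 0 < P) (hη : 2 < η) (hT : 0 < T)
    (hX : IsHomogeneousPPP μ lam X) (hord : ∀ᵐ ω ∂μ, Monotone fun i => ‖X i ω‖)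
    (hg : IsRayleighFading μ X g) (hgm : ∀ i, Measurable (g i)) :
    μ {ω | ENNReal.ofReal T < sinrBlackoutCoop P η σ X g ω} =
      ∫⁻ r, conditionalCoverage lam P η σ ({0} : Finset (Fin 3))
        (fun r => coopS P η T |r 1| |r 2|) r ∂tupleLaw lam 2 := by
  have hglaw : ∀ i, μ.map (g i) = stdComplexGaussian := fun i => (hg.law i).map_eq
  have h := measure_coverage_eq (σ := σ) hlam hP hη hT hX hord hg hgm ({0} : Finset (Fin 3))
    (sig := fun p => ‖((√P * ‖p.1 1‖ ^ (-η / 2) : ℝ) : ℂ) * p.2 1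
        + ((√P * ‖p.1 2‖ ^ (-η / 2) : ℝ) : ℂ) * p.2 2‖ ^ 2) (by fun_prop)
    (s := fun r => coopS P η T |r 1| |r 2|) (by unfold coopS; fun_prop)
    (fun r => by unfold coopS; positivity)
    (fun r hr => by
      have h1 := pos_of_mem_increasingTuples hr 1
      have h2 := pos_of_mem_increasingTuples hr 2
      exact coopS_pos hP hT (by positivity) (by positivity))
    (fun x hx y hy => by
      have := measure_coop_signal_gt (η := η) hgm hg.iIndep hglaw hP hT
        (pos_of_mem_increasingTuples hx 1) (pos_of_mem_increasingTuples hx 2) hy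
      simpa using this)
    (fun x => indepFun_signal_interference hgm hg.iIndep {1, 2} (by simp)
      (fun j => by simp only [mem_insert_iff, mem_singleton_iff]; omega)
      (sig := fun f => ‖((√P * ‖x 1‖ ^ (-η / 2) : ℝ) : ℂ) * f ⟨1, by simp⟩
        + ((√P * ‖x 2‖ ^ (-η / 2) : ℝ) : ℂ) * f ⟨2, by simp⟩‖ ^ 2) (by fun_prop) x)
  rw [← h]
  congr 1
  ext ω
  simp only [interferencePlusNoise, Finset.sum_singleton]
  rfl

end Cases

/-! ### Densities with the nearest distance integrated out -/

section Density

variable {lam : ℝ}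

/-- The joint density of the two smallest distances, weighted by `H` and integrated over the first. -/
noncomputable def pairDensity (lam : ℝ) (H : (Fin 2 → ℝ) → ℝ≥0∞) (y : ℝ) : ℝ≥0∞ :=
  ENNReal.ofReal (2 * Real.pi * lam * y) *
    ∫⁻ x in Ioo 0 y, ENNReal.ofReal (2 * Real.pi * lam * x) *
      (H ![x, y] * ENNReal.ofReal (Real.exp (-meanCount lam y)))

/-- The joint density of the three smallest distances, weighted by `H` and integrated over the
first. -/
noncomputable def tripleDensity (lam : ℝ) (H : (Fin 3 → ℝ) → ℝ≥0∞) (p : ℝ × ℝ) : ℝ≥0∞ :=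
  ENNReal.ofReal (2 * Real.pi * lam * p.1) * (ENNReal.ofReal (2 * Real.pi * lam * p.2) *
    ∫⁻ x in Ioo 0 p.1, ENNReal.ofReal (2 * Real.pi * lam * x) *
      (H ![x, p.1, p.2] * ENNReal.ofReal (Real.exp (-meanCount lam p.2))))

lemma measurable_pair {H : (Fin 2 → ℝ) → ℝ≥0∞} (hH : Measurable H) :
    Measurable fun p : ℝ × ℝ => H ![p.2, p.1] := by
  refine hH.comp (measurable_pi_iff.2 fun j => ?_)
  fin_cases j
  · exact measurable_snd
  · exact measurable_fst

lemma measurable_triple {H : (Fin 3 → ℝ) → ℝ≥0∞} (hH : Measurable H) :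
    Measurable fun p : (ℝ × ℝ) × ℝ => H ![p.2, p.1.1, p.1.2] := by
  refine hH.comp (measurable_pi_iff.2 fun j => ?_)
  fin_cases j
  · exact measurable_snd
  · exact measurable_fst.comp measurable_fst
  · exact measurable_snd.comp measurable_fst

lemma measurable_pairDensity {H : (Fin 2 → ℝ) → ℝ≥0∞} (hH : Measurable H) :
    Measurable (pairDensity lam H) := by
  have := measurable_pair hH
  refine Measurable.mul (by fun_prop) (measurable_setLIntegral_Ioo ?_ measurable_id)
  unfold Function.uncurry
  fun_prop

lemma measurable_tripleDensity {H : (Fin 3 → ℝ) → ℝ≥0∞} (hH : Measurable H) :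
    Measurable (tripleDensity lam H) := by
  have := measurable_triple hH
  refine Measurable.mul (by fun_prop) (Measurable.mul (by fun_prop)
    (measurable_setLIntegral_Ioo ?_ measurable_fst))
  unfold Function.uncurry
  fun_prop

lemma lintegral_tupleLaw_pairDensity {H : (Fin 2 → ℝ) → ℝ≥0∞} (hH : Measurable H) :
    ∫⁻ r, H r ∂tupleLaw lam 1 = ∫⁻ y in Ioi 0, pairDensity lam H y := by
  have hHv := measurable_pair hH
  have hHy : ∀ y : ℝ, Measurable fun x => H ![x, y] :=
    fun y => hHv.comp (measurable_const.prodMk measurable_id)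
  have hinner : Measurable fun y => ∫⁻ x in Ioo 0 y, H ![x, y] *
        ENNReal.ofReal (Real.exp (-meanCount lam y)) ∂radialIntensity lam := by
    refine measurable_setLIntegral_Ioo ?_ measurable_id
    unfold Function.uncurry
    fun_prop
  rw [lintegral_tupleLaw_one hH,
    setLIntegral_radialIntensity hinner measurableSet_Ioi subset_rfl]
  refine lintegral_congr fun y => ?_
  have := hHy y
  rw [setLIntegral_radialIntensity (by fun_prop) measurableSet_Ioo Ioo_subset_Ioi_self,
    pairDensity]

lemma lintegral_tupleLaw_tripleDensity {H : (Fin 3 → ℝ) → ℝ≥0∞} (hH : Measurable H) :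
    ∫⁻ r, H r ∂tupleLaw lam 2 =
      ∫⁻ p in {p : ℝ × ℝ | 0 < p.1 ∧ p.1 < p.2}, tripleDensity lam H p := by
  have hHv := measurable_triple hH
  have hHy : ∀ y z : ℝ, Measurable fun x => H ![x, y, z] :=
    fun y z => hHv.comp (measurable_const (a := (y, z)) |>.prodMk measurable_id)
  have hinner : Measurable fun p : ℝ × ℝ => ∫⁻ x in Ioo 0 p.1, H ![x, p.1, p.2] *
        ENNReal.ofReal (Real.exp (-meanCount lam p.2)) ∂radialIntensity lam := by
    refine measurable_setLIntegral_Ioo ?_ measurable_fst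
    unfold Function.uncurry
    fun_prop
  have hinner_snd : ∀ y, Measurable fun z => ∫⁻ x in Ioo 0 y, H ![x, y, z] *
        ENNReal.ofReal (Real.exp (-meanCount lam z)) ∂radialIntensity lam := fun y =>
    hinner.comp (measurable_const.prodMk measurable_id)
  have houter : Measurable fun y => ∫⁻ z in Ioi y, ∫⁻ x in Ioo 0 y, H ![x, y, z] *
        ENNReal.ofReal (Real.exp (-meanCount lam z)) ∂radialIntensity lam ∂radialIntensity lam :=
    measurable_setLIntegral_Ioi hinner measurable_id
  rw [lintegral_tupleLaw_two hH, setLIntegral_radialIntensity houter measurableSet_Ioi subset_rfl,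
    setLIntegral_increasingPairs (measurable_tripleDensity hH)]
  refine setLIntegral_congr_fun measurableSet_Ioi fun y hy => ?_
  have hy0 : 0 < y := hy
  have hdens : Measurable fun p : ℝ × ℝ => ENNReal.ofReal (2 * Real.pi * lam * p.2) *
      ∫⁻ x in Ioo 0 p.1, ENNReal.ofReal (2 * Real.pi * lam * x) *
        (H ![x, p.1, p.2] * ENNReal.ofReal (Real.exp (-meanCount lam p.2))) := by
    refine Measurable.mul (by fun_prop) (measurable_setLIntegral_Ioo ?_ measurable_fst)
    unfold Function.uncurry
    fun_prop
  have hdens_snd : Measurable fun z : ℝ => ENNReal.ofReal (2 * Real.pi * lam * z) *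
      ∫⁻ x in Ioo 0 y, ENNReal.ofReal (2 * Real.pi * lam * x) *
        (H ![x, y, z] * ENNReal.ofReal (Real.exp (-meanCount lam z))) :=
    hdens.comp (measurable_const.prodMk measurable_id)
  simp only [tripleDensity]
  rw [lintegral_const_mul _ hdens_snd,
    setLIntegral_radialIntensity (hinner_snd y) measurableSet_Ioi (Ioi_subset_Ioi hy0.le)]
  congr 1
  refine lintegral_congr fun z => ?_
  have := hHy y z
  rw [setLIntegral_radialIntensity (by fun_prop) measurableSet_Ioo Ioo_subset_Ioi_self]

lemma lintegral_mul_fadingFactor_mul_exp (hlam : 0 ≤ lam) {η a y : ℝ} (ha : 0 ≤ a) (hy : 0 ≤ y)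
    (u v w : ℝ) :
    ∫⁻ x in Ioo 0 y, ENNReal.ofReal (2 * Real.pi * lam * x) *
        (ENNReal.ofReal (Real.exp u) * ENNReal.ofReal (fadingFactor η a x) *
          ENNReal.ofReal (Real.exp v) * ENNReal.ofReal (Real.exp w)) =
      ENNReal.ofReal (Real.exp (u + v + w) *
        (2 * Real.pi * lam * ∫ x in (0 : ℝ)..y, x / (1 + a * x ^ (-η)))) := by
  have hfm : Measurable fun x => fadingFactor η a x := measurable_fadingFactor.comp
    (measurable_const.prodMk measurable_id)
  have h : ∀ x, ENNReal.ofReal (2 * Real.pi * lam * x) *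
        (ENNReal.ofReal (Real.exp u) * ENNReal.ofReal (fadingFactor η a x) *
          ENNReal.ofReal (Real.exp v) * ENNReal.ofReal (Real.exp w)) =
      ENNReal.ofReal (Real.exp (u + v + w)) * (ENNReal.ofReal (2 * Real.pi * lam * x) *
        ENNReal.ofReal (fadingFactor η a x)) := by
    intro x
    rw [Real.exp_add, Real.exp_add,
      ENNReal.ofReal_mul (mul_nonneg (Real.exp_pos u).le (Real.exp_pos v).le),
      ENNReal.ofReal_mul (Real.exp_pos u).le]
    ring
  simp only [h]
  rw [lintegral_const_mul _ (by fun_prop), lintegral_mul_fadingFactor hlam ha hy,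
    ENNReal.ofReal_mul (Real.exp_pos _).le]

end Density

/-! ### Matching densities with the stated integrands -/

section PointwiseIdentities

variable {lam P η σ T : ℝ}

lemma pairDensity_conditionalCoverage (hlam : 0 < lam) (hP : 0 < P) (hη : 2 < η) (hT : 0 < T)
    {y : ℝ} (hy : 0 < y) :
    pairDensity lam (conditionalCoverage lam P η σ ({0} : Finset (Fin 2))
      fun r => T * |r 1| ^ η / P) y = ENNReal.ofReal (blackoutIntegrand lam P η σ T y) := by
  have hpi := Real.pi_pos
  have hyη : 0 < y ^ η := Real.rpow_pos_of_pos hy _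
  have hsP : T * y ^ η / P * P = T * y ^ η := by field_simp
  have hH : ∀ x, conditionalCoverage lam P η σ ({0} : Finset (Fin 2))
      (fun r => T * |r 1| ^ η / P) ![x, y] =
      ENNReal.ofReal (Real.exp (-(T * y ^ η / P * σ ^ 2))) *
        ENNReal.ofReal (fadingFactor η (T * y ^ η) x) *
        ENNReal.ofReal (Real.exp (-interferenceExponent lam η (T * y ^ η) y)) := by
    intro x
    have h1 : (![x, y] : Fin 2 → ℝ) 1 = y := rfl
    have h0 : (![x, y] : Fin 2 → ℝ) 0 = x := rfl
    have hl : (![x, y] : Fin 2 → ℝ) (Fin.last 1) = y := rfl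
    simp only [conditionalCoverage, Finset.prod_singleton, h0, h1, hl, abs_of_pos hy, hsP]
  have hT' : T * y ^ η * y ^ (-η) = T := by rw [Real.rpow_neg hy.le]; field_simp
  simp only [pairDensity, hH]
  rw [lintegral_mul_fadingFactor_mul_exp hlam.le (by positivity) hy.le,
    ← ENNReal.ofReal_mul (by positivity),
    interferenceExponent_eq_hypergeometric hη (by positivity) hy, hT',
    meanCount_of_nonneg hy.le, blackoutIntegrand]
  congr 1
  rw [show -(T * y ^ η / P * σ ^ 2) + -(Real.pi * lam * y ^ 2 * (2 * T / (η - 2) *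
        gaussHypergeometric 1 (1 - 2 / η) (2 - 2 / η) (-T))) + -(Real.pi * lam * y ^ 2) =
        -(T * y ^ η * σ ^ 2 / P) - Real.pi * lam * y ^ 2 *
      (2 * T / (η - 2) * gaussHypergeometric 1 (1 - 2 / η) (2 - 2 / η) (-T) + 1) by ring]
  generalize Real.exp _ = e
  ring

lemma tripleDensity_conditionalCoverage (hlam : 0 < lam) (hP : 0 < P) (hη : 2 < η) (hT : 0 < T)
    {y z : ℝ} (hy : 0 < y) (hz : 0 < z) :
    tripleDensity lam (conditionalCoverage lam P η σ ({0} : Finset (Fin 3))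
      fun r => coopS P η T |r 1| |r 2|) (y, z) =
      ENNReal.ofReal (coopIntegrand lam P η σ T y z) := by
  have hpi := Real.pi_pos
  have hc := coopS_pos (η := η) hP hT hy hz
  have hH : ∀ x, conditionalCoverage lam P η σ ({0} : Finset (Fin 3))
      (fun r => coopS P η T |r 1| |r 2|) ![x, y, z] =
      ENNReal.ofReal (Real.exp (-(coopS P η T y z * σ ^ 2))) *
        ENNReal.ofReal (fadingFactor η (coopS P η T y z * P) x) *
        ENNReal.ofReal (Real.exp (-interferenceExponent lam η (coopS P η T y z * P) z)) := by
    intro x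
    have h1 : (![x, y, z] : Fin 3 → ℝ) 1 = y := rfl
    have h2 : (![x, y, z] : Fin 3 → ℝ) 2 = z := rfl
    have h0 : (![x, y, z] : Fin 3 → ℝ) 0 = x := rfl
    have hl : (![x, y, z] : Fin 3 → ℝ) (Fin.last 2) = z := rfl
    simp only [conditionalCoverage, Finset.prod_singleton, h0, h1, h2, hl, abs_of_pos hy,
      abs_of_pos hz]
  rw [coopIntegrand_eq hη hP hT hy hz]
  simp only [tripleDensity, hH]
  generalize coopS P η T y z = c at hc
  rw [lintegral_mul_fadingFactor_mul_exp hlam.le (by positivity) hy.le,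
    ← ENNReal.ofReal_mul (by positivity), ← ENNReal.ofReal_mul (by positivity),
    meanCount_of_nonneg hz.le]
  congr 1
  rw [show -(c * σ ^ 2) + -interferenceExponent lam η (c * P) z + -(Real.pi * lam * z ^ 2) =
    -(c * σ ^ 2) - Real.pi * lam * z ^ 2 - interferenceExponent lam η (c * P) z by ring]
  generalize Real.exp _ = e
  ring

lemma blackoutIntegrand_nonneg (hT : 0 ≤ T) {y : ℝ} (hy : 0 ≤ y) :
    0 ≤ blackoutIntegrand lam P η σ T y := by
  have := Real.rpow_nonneg hy η
  have hI := integral_div_one_add_nonneg (η := η) (a := T * y ^ η) (by positivity) hy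
  exact mul_nonneg (sq_nonneg _) (mul_nonneg (mul_nonneg hy (Real.exp_pos _).le) hI)

lemma coopIntegrand_nonneg (hlam : 0 ≤ lam) (hP : 0 < P) (hT : 0 < T) {y z : ℝ} (hy : 0 < y)
    (hz : 0 < z) : 0 ≤ coopIntegrand lam P η σ T y z := by
  have hpi := Real.pi_pos
  have hc := coopS_pos (η := η) hP hT hy hz
  have hI := integral_div_one_add_nonneg (η := η) (a := coopS P η T y z * P)
    (by positivity) hy.le
  exact mul_nonneg (by positivity)
    (mul_nonneg (mul_nonneg (mul_nonneg hy.le hz.le) (Real.exp_pos _).le) hI)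

end PointwiseIdentities

/-! ### Coverage probabilities as convergent integrals -/

section Evaluation

variable {Ω : Type*} [MeasurableSpace Ω] {μ : Measure Ω}
  {X : ℕ → Ω → Plane} {g : ℕ → Ω → ℂ} {lam P η σ T : ℝ}

theorem bestConnected_coverage [IsProbabilityMeasure μ] (hlam : 0 < lam) (hP : 0 < P) (hη : 2 < η) (hT : 0 < T)
    (hX : IsHomogeneousPPP μ lam X) (hord : ∀ᵐ ω ∂μ, Monotone fun i => ‖X i ω‖)
    (hg : IsRayleighFading μ X g) (hgm : ∀ i, Measurable (g i)) :
    IntegrableOn (bestConnectedIntegrand lam P η σ T) (Ioi 0) ∧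
      coverageProbability μ (sinrBestConnected P η σ X g) T =
        ∫ x in Ioi 0, bestConnectedIntegrand lam P η σ T x := by
  have hpi := Real.pi_pos
  set s : (Fin 1 → ℝ) → ℝ := fun r => T * |r 0| ^ η / P with hs
  have hsm : Measurable s := by fun_prop
  have hHm := measurable_conditionalCoverage (lam := lam) (P := P) (η := η) (σ := σ) ∅ hsm
  have hc : Measurable fun u : ℝ => (fun _ : Fin 1 => u) := by fun_prop
  have hHc : Measurable fun u : ℝ => conditionalCoverage lam P η σ ∅ s (fun _ => u) := hHm.comp hc
  set E : ℝ → ℝ≥0∞ := fun u => ENNReal.ofReal (2 * Real.pi * lam * u) *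
    (conditionalCoverage lam P η σ ∅ s (fun _ => u) * ENNReal.ofReal (Real.exp (-meanCount lam u)))
    with hE
  have hEm : Measurable E := by fun_prop
  have hval : μ {ω | ENNReal.ofReal T < sinrBestConnected P η σ X g ω} = ∫⁻ u in Ioi 0, E u := by
    rw [measure_bestConnected_eq hlam hP hη hT hX hord hg hgm, lintegral_tupleLaw_zero hHm,
      setLIntegral_radialIntensity (by fun_prop) measurableSet_Ioi subset_rfl]
  have hEf : ∀ u ∈ Ioi (0 : ℝ), E u = ENNReal.ofReal (bestConnectedIntegrand lam P η σ T u) := by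
    intro u hu
    have hu0 : 0 < u := hu
    have hsu : s (fun _ => u) = T * u ^ η / P := by simp only [hs, abs_of_pos hu0]
    have hsP : T * u ^ η / P * P = T * u ^ η := by field_simp
    simp only [hE, conditionalCoverage, Finset.prod_empty, mul_one, hsu, hsP,
      interferenceExponent_nearest hη hT hu0, meanCount_of_nonneg hu0.le]
    rw [← ENNReal.ofReal_mul (Real.exp_pos _).le, ← ENNReal.ofReal_mul (by positivity),
      ← ENNReal.ofReal_mul (by positivity), ← Real.exp_add, ← Real.exp_add, bestConnectedIntegrand]
    congr 3
    ring
  have hfin : ∫⁻ u in Ioi 0, E u ≠ ∞ := hval ▸ measure_ne_top _ _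
  obtain ⟨h1, h2⟩ := integrableOn_and_integral_eq_toReal measurableSet_Ioi hEm
    (fun u hu => bestConnectedIntegrand_nonneg hlam.le (mem_Ioi.1 hu).le) hEf hfin
  exact ⟨h1, by rw [h2, ← hval, coverageProbability, measureReal_def]⟩

theorem blackout_coverage [IsProbabilityMeasure μ] (hlam : 0 < lam) (hP : 0 < P) (hη : 2 < η)
    (hT : 0 < T) (hX : IsHomogeneousPPP μ lam X) (hord : ∀ᵐ ω ∂μ, Monotone fun i => ‖X i ω‖)
    (hg : IsRayleighFading μ X g) (hgm : ∀ i, Measurable (g i)) :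
    IntegrableOn (blackoutIntegrand lam P η σ T) (Ioi 0) ∧
      coverageProbability μ (sinrBlackout P η σ X g) T =
        ∫ y in Ioi 0, blackoutIntegrand lam P η σ T y := by
  have hHm := measurable_conditionalCoverage (lam := lam) (P := P) (η := η) (σ := σ)
    ({0} : Finset (Fin 2)) (s := fun r => T * |r 1| ^ η / P) (by fun_prop)
  have hval := (measure_blackout_eq (σ := σ) hlam hP hη hT hX hord hg hgm).trans
    (lintegral_tupleLaw_pairDensity hHm)
  obtain ⟨h1, h2⟩ := integrableOn_and_integral_eq_toReal measurableSet_Ioi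
    (measurable_pairDensity hHm) (fun y hy => blackoutIntegrand_nonneg hT.le (mem_Ioi.1 hy).le)
    (fun y hy => pairDensity_conditionalCoverage hlam hP hη hT (mem_Ioi.1 hy))
    (hval ▸ measure_ne_top _ _)
  exact ⟨h1, by rw [h2, ← hval, coverageProbability, measureReal_def]⟩

theorem blackoutCoop_coverage [IsProbabilityMeasure μ] (hlam : 0 < lam) (hP : 0 < P)
    (hη : 2 < η) (hT : 0 < T) (hX : IsHomogeneousPPP μ lam X)
    (hord : ∀ᵐ ω ∂μ, Monotone fun i => ‖X i ω‖)
    (hg : IsRayleighFading μ X g) (hgm : ∀ i, Measurable (g i)) :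
    IntegrableOn (fun p : ℝ × ℝ => coopIntegrand lam P η σ T p.1 p.2)
        {p | 0 < p.1 ∧ p.1 < p.2} ∧
      coverageProbability μ (sinrBlackoutCoop P η σ X g) T =
        ∫ r₂ in Ioi 0, ∫ r₃ in Ioi r₂, coopIntegrand lam P η σ T r₂ r₃ := by
  have hHm := measurable_conditionalCoverage (lam := lam) (P := P) (η := η) (σ := σ)
    ({0} : Finset (Fin 3)) (s := fun r => coopS P η T |r 1| |r 2|) (by unfold coopS; fun_prop)
  have hval := (measure_blackoutCoop_eq (σ := σ) hlam hP hη hT hX hord hg hgm).trans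
    (lintegral_tupleLaw_tripleDensity hHm)
  obtain ⟨h1, h2⟩ := integrableOn_and_integral_eq_toReal measurableSet_increasingPairs
    (measurable_tripleDensity hHm)
    (fun p hp => coopIntegrand_nonneg hlam.le hP hT hp.1 (hp.1.trans hp.2))
    (fun p hp => tripleDensity_conditionalCoverage hlam hP hη hT hp.1 (hp.1.trans hp.2))
    (hval ▸ measure_ne_top _ _)
  exact ⟨h1, by rw [← setIntegral_increasingPairs h1, h2, ← hval, coverageProbability,
    measureReal_def]⟩

/-- The channel coefficients may be replaced by measurable ones. -/
lemma IsRayleighFading.exists_measurable (hg : IsRayleighFading μ X g) :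
    ∃ g' : ℕ → Ω → ℂ, IsRayleighFading μ X g' ∧ (∀ i, Measurable (g' i)) ∧
      ∀ᵐ ω ∂μ, ∀ i, g i ω = g' i ω := by
  have hae : ∀ i, g i =ᵐ[μ] (hg.law i).aemeasurable.mk (g i) := fun i =>
    (hg.law i).aemeasurable.ae_eq_mk
  have hall : ∀ᵐ ω ∂μ, ∀ i, g i ω = (hg.law i).aemeasurable.mk (g i) ω := ae_all_iff.2 hae
  refine ⟨fun i => (hg.law i).aemeasurable.mk (g i), ⟨fun i => ?_, ?_, ?_⟩,
    fun i => (hg.law i).aemeasurable.measurable_mk, hall⟩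
  · exact (hg.law i).congr (hae i).symm
  · exact hg.iIndep.congr hae
  · refine hg.indep_positions.congr ?_ Filter.EventuallyEq.rfl
    filter_upwards [hall] with ω hω
    funext i
    exact hω i

end Evaluation

theorem theorem1 {Ω : Type*} [MeasurableSpace Ω] (μ : Measure Ω) [IsProbabilityMeasure μ]
    (lam P η σ T : ℝ) (hlam : 0 < lam) (hP : 0 < P) (hη : 2 < η) (hT : 0 < T)
    (X : ℕ → Ω → Plane) (g : ℕ → Ω → ℂ)
    (hX : IsHomogeneousPPP μ lam X)
    -- the BSs are numbered by increasing distance to the user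
    (hord : ∀ᵐ ω ∂μ, Monotone fun i => ‖X i ω‖)
    (hg : IsRayleighFading μ X g) :
    (IntegrableOn (bestConnectedIntegrand lam P η σ T) (Ioi 0) ∧
      coverageProbability μ (sinrBestConnected P η σ X g) T =
        ∫ x in Ioi 0, bestConnectedIntegrand lam P η σ T x) ∧
    (IntegrableOn (blackoutIntegrand lam P η σ T) (Ioi 0) ∧
      coverageProbability μ (sinrBlackout P η σ X g) T =
        ∫ y in Ioi 0, blackoutIntegrand lam P η σ T y) ∧
    (IntegrableOn (fun p : ℝ × ℝ => coopIntegrand lam P η σ T p.1 p.2)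
        {p | 0 < p.1 ∧ p.1 < p.2} ∧
      coverageProbability μ (sinrBlackoutCoop P η σ X g) T =
        ∫ r₂ in Ioi 0, ∫ r₃ in Ioi r₂, coopIntegrand lam P η σ T r₂ r₃) ∧
    (η = 4 → σ = 0 →
      IntegrableOn (fun p : ℝ × ℝ => coopIntegrandFour lam T p.1 p.2)
        {p | 0 < p.1 ∧ p.1 < p.2} ∧
      coverageProbability μ (sinrBlackoutCoop P η σ X g) T =
        ∫ r₂ in Ioi 0, ∫ r₃ in Ioi r₂, coopIntegrandFour lam T r₂ r₃) := by
  -- `HasLaw` only makes the coefficients almost everywhere measurable. Replacing all of them off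
  -- one null set leaves the three coverage probabilities unchanged.
  obtain ⟨g', hg', hgm, hgg⟩ := hg.exists_measurable
  have hcongr : ∀ F : (ℕ → Ω → ℂ) → Ω → ℝ≥0∞, (∀ᵐ ω ∂μ, F g ω = F g' ω) →
      coverageProbability μ (F g) T = coverageProbability μ (F g') T := by
    intro F hF
    refine measureReal_congr ?_
    filter_upwards [hF] with ω hω
    exact propext (by
      change ENNReal.ofReal T < F g ω ↔ ENNReal.ofReal T < F g' ω
      rw [hω])
  rw [hcongr (sinrBestConnected P η σ X) (by
      filter_upwards [hgg] with ω hω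
      simp only [sinrBestConnected, interferenceFrom, rxPower, hω]),
    hcongr (sinrBlackout P η σ X) (by
      filter_upwards [hgg] with ω hω
      simp only [sinrBlackout, interferenceFrom, rxPower, hω]),
    hcongr (sinrBlackoutCoop P η σ X) (by
      filter_upwards [hgg] with ω hω
      simp only [sinrBlackoutCoop, interferenceFrom, rxPower, hω])]
  have hcoop := blackoutCoop_coverage (σ := σ) hlam hP hη hT hX hord hg' hgm
  refine ⟨bestConnected_coverage hlam hP hη hT hX hord hg' hgm,
    blackout_coverage hlam hP hη hT hX hord hg' hgm, hcoop, ?_⟩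
  rintro rfl rfl
  have heq : ∀ p ∈ {p : ℝ × ℝ | 0 < p.1 ∧ p.1 < p.2},
      coopIntegrand lam P 4 0 T p.1 p.2 = coopIntegrandFour lam T p.1 p.2 := fun p hp =>
    (coopIntegrandFour_eq hlam.le hP hT hp.1 (hp.1.trans hp.2)).symm
  have hint := hcoop.1.congr_fun heq measurableSet_increasingPairs
  refine ⟨hint, ?_⟩
  rw [hcoop.2, ← setIntegral_increasingPairs hcoop.1, ← setIntegral_increasingPairs hint]
  exact setIntegral_congr_fun measurableSet_increasingPairs heq
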